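/- Let $\mathbb T=\mathbb R/2\pi\mathbb Z$, $\hat f(n)=\frac1{2\pi}\langle f,e^{-inx}\rangle$ for $f\in\mathcal D'(\mathbb T)$, and $\mathcal FL^{s,p}=\{f\in\mathcal D'(\mathbb T)\text{ real-valued}:\ \|f\|_{\mathcal FL^{s,p}}:=\|(1+n^2)^{s/2}\hat f(n)\|_{\ell^p(\mathbb Z)}<\infty\}$. Let $s\ge 1/2$, $1\le p\le\infty$, $\frac1p+\frac1{p'}=1$ and $p'(s+\frac14)>1$. For $R>0$ let $B(0,R)$ be the open ball of radius $R$ about $0$ in $\mathcal FL^{s,p}$; if $p=\infty$, only those elements of the ball are taken that lie in the closure of $C^\infty(\mathbb T)$ in $\mathcal FL^{s,\infty}$ (for $p<\infty$ every element does). Consider the modified mKdV equation $$\partial_tu+\partial_x^3u+\Big(u^2-\frac1{2\pi}\int_{\mathbb T}u^2(x,t)\,dx\Big)\partial_xu=0,\qquad u(\cdot,0)=\varphi. \tag{1}$$ By an extended solution map on $B(0,R)$ and $[0,T]$ we mean a uniformly continuous map $W:B(0,R)\to C([0,T],\mathcal FL^{s,p})$ such that for every $\varphi\in B(0,R)\cap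 C^\infty(\mathbb T)$, $W\varphi$ is the classical solution of (1) in $C([0,T],C^\infty(\mathbb T))$. For a function $v$ on $\mathbb T$ put $\mathcal N v=\big(v^2-\frac1{2\pi}\int_{\mathbb T}v^2\,dx\big)\partial_xv$, and let $T_Nf=\sum_{|n|\le N}\hat f(n)e^{inx}$. (a) For every $R>0$ there are $T>0$ and an extended solution map $W$ on $B(0,R)$ and $[0,T]$. (b) Let $R,T>0$, let $W$ be any extended solution map on $B(0,R)$ and $[0,T]$, let $\varphi\in B(0,R)$ and $u=W\varphi\in C([0,T],\mathcal FL^{s,p})$. Then the limit $\mathcal N u:=\lim_{N\to\infty}\mathcal N(T_Nu)$ exists in $C([0,T],\mathcal D'(\mathbb T))$, and $u$ satisfies (1): $u(\cdot,0)=\varphi$, and $\partial_tu+\partial_x^3u+\mathcal N u=0$ in the sense of distributions on $(0,T)\times\mathbb T$. -/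

import Mathlib

open scoped ENNReal Topology ContDiff

namespace MKdV

/-- `C^∞(𝕋)`, `𝕋 = ℝ / 2πℤ`: the smooth `2π`-periodic functions `ℝ → ℂ`. -/
def TestSpace : Submodule ℂ (ℝ → ℂ) where
  carrier := {ψ | ContDiff ℝ ∞ ψ ∧ Function.Periodic ψ (2 * Real.pi)}
  add_mem' := fun ha hb => ⟨ha.1.add hb.1, ha.2.add hb.2⟩
  zero_mem' := ⟨contDiff_const, fun _ => rfl⟩
  smul_mem' := fun c _ hf => ⟨hf.1.const_smul c, fun x => congrArg (fun z => c • z) (hf.2 x)⟩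

/-- `𝒟'(𝕋)`: the linear functionals on `C^∞(𝕋)` that are continuous for the usual Fréchet
topology, that is, bounded by a constant times one of the norms `max_{j ≤ k} sup |ψ^(j)|`. -/
def Distrib : Submodule ℂ (Module.Dual ℂ TestSpace) where
  carrier := {f | ∃ (C : ℝ) (k : ℕ), ∀ (ψ : TestSpace) (M : ℝ),
    (∀ j ≤ k, ∀ x : ℝ, ‖iteratedDeriv j (ψ : ℝ → ℂ) x‖ ≤ M) → ‖f ψ‖ ≤ C * M}
  add_mem' := by
    rintro f g ⟨C, k, hf⟩ ⟨D, l, hg⟩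
    refine ⟨C + D, max k l, fun ψ M h => ?_⟩
    have h1 := hf ψ M fun j hj => h j (hj.trans (le_max_left _ _))
    have h2 := hg ψ M fun j hj => h j (hj.trans (le_max_right _ _))
    calc ‖(f + g) ψ‖ ≤ ‖f ψ‖ + ‖g ψ‖ := norm_add_le _ _
      _ ≤ (C + D) * M := by linarith
  zero_mem' := ⟨0, 0, fun ψ M _ => by simp⟩
  smul_mem' := by
    rintro c f ⟨C, k, hf⟩
    refine ⟨‖c‖ * C, k, fun ψ M h => ?_⟩
    have h1 := hf ψ M h
    calc ‖(c • f) ψ‖ = ‖c‖ * ‖f ψ‖ := norm_mul _ _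
      _ ≤ ‖c‖ * (C * M) := by gcongr
      _ = ‖c‖ * C * M := by ring

/-- The distribution `f` is the function `g`: `⟨f, ψ⟩ = ∫_𝕋 g ψ dx`. -/
def Represents (g : ℝ → ℂ) (f : Distrib) : Prop :=
  ∀ ψ : TestSpace, (f : Module.Dual ℂ TestSpace) ψ
    = ∫ x in (0 : ℝ)..(2 * Real.pi), g x * (ψ : ℝ → ℂ) x

/-- The character `x ↦ e^{i n x}`. -/
noncomputable def char (n : ℤ) : TestSpace :=
  ⟨fun x => Complex.exp (Complex.I * n * x), by
    refine ⟨?_, fun x => ?_⟩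
    · exact (contDiff_const.mul Complex.ofRealCLM.contDiff).cexp
    · rw [Complex.exp_eq_exp_iff_exists_int]
      exact ⟨n, by push_cast; ring⟩⟩

/-- `f̂(n) = (2π)⁻¹ ⟨f, e^{-inx}⟩`. -/
noncomputable def fourierCoef (f : Distrib) (n : ℤ) : ℂ :=
  (2 * Real.pi : ℂ)⁻¹ * (f : Module.Dual ℂ TestSpace) (char (-n))

/-- The norm of `ℱL^{s,p}(𝕋)`, the `ℓ^p` norm of `(1 + n²)^{s/2} f̂(n)`; it is `∞` exactly for the
distributions outside of `ℱL^{s,p}(𝕋)`. -/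
noncomputable def flNorm (s : ℝ) (p : ℝ≥0∞) (f : Distrib) : ℝ≥0∞ :=
  MeasureTheory.eLpNorm
    (fun n : ℤ => (((1 + (n : ℝ) ^ 2) ^ (s / 2) : ℝ) : ℂ) * fourierCoef f n) p
    MeasureTheory.Measure.count

/-- Real distributions: real-valued on real-valued test functions. -/
def IsReal (f : Distrib) : Prop :=
  ∀ ψ : TestSpace, (∀ x, ((ψ : ℝ → ℂ) x).im = 0) → ((f : Module.Dual ℂ TestSpace) ψ).im = 0

/-- The distribution `φ` is the real-valued function `g ∈ C^∞(𝕋)`. -/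
def IsSmoothData (φ : Distrib) (g : ℝ → ℝ) : Prop :=
  ContDiff ℝ ∞ g ∧ Function.Periodic g (2 * Real.pi) ∧ Represents (fun x => (g x : ℂ)) φ

/-- The open ball `B(0,R)` of the space of real elements of `ℱL^{s,p}(𝕋)`. For `p = ∞`, where
smooth functions are not dense, `ℱL^{s,p}(𝕋)` is replaced by the closure of the smooth functions
in it. -/
def ball (s : ℝ) (p : ℝ≥0∞) (R : ℝ) : Set Distrib :=
  {φ | IsReal φ ∧ flNorm s p φ < ENNReal.ofReal R ∧
    (p = ⊤ → ∀ ε > 0, ∃ (χ : Distrib) (g : ℝ → ℝ), IsSmoothData χ g ∧ flNorm s p (φ - χ) < ε)}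

/-- `u ∈ C([0,T], ℱL^{s,p}(𝕋))`, real-valued. -/
def IsContFL (s : ℝ) (p : ℝ≥0∞) (T : ℝ) (u : ℝ → Distrib) : Prop :=
  ∀ t ∈ Set.Icc 0 T, IsReal (u t) ∧ flNorm s p (u t) < ⊤ ∧
    Filter.Tendsto (fun τ => flNorm s p (u τ - u t)) (𝓝[Set.Icc 0 T] t) (𝓝 0)

/-- `(v² - (2π)⁻¹ ∫_𝕋 v² dx) ∂ₓ v` for a function `v` on the torus. -/
noncomputable def nonlin {𝕜 : Type} [RCLike 𝕜] (v : ℝ → 𝕜) (x : ℝ) : 𝕜 :=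
  (v x ^ 2 - (2 * Real.pi)⁻¹ • ∫ y in (0 : ℝ)..(2 * Real.pi), v y ^ 2) * deriv v x

/-- `v ∈ C([0,T], C^∞(𝕋))` is a classical solution on `[0,T] × 𝕋` of
`∂ₜ v + ∂ₓ³ v + (v² - (2π)⁻¹ ∫_𝕋 v² dx) ∂ₓ v = 0`; time derivatives at `0` and `T` are one-sided. -/
structure IsClassicalSolution (T : ℝ) (v : ℝ → ℝ → ℝ) : Prop where
  periodic : ∀ t ∈ Set.Icc 0 T, Function.Periodic (v t) (2 * Real.pi)
  smooth : ∀ t ∈ Set.Icc 0 T, ContDiff ℝ ∞ (v t)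
  cont : ∀ k : ℕ, ContinuousOn (fun q : ℝ × ℝ => iteratedDeriv k (v q.1) q.2)
    (Set.Icc 0 T ×ˢ Set.univ)
  eqn : ∀ t ∈ Set.Icc 0 T, ∀ x : ℝ,
    HasDerivWithinAt (fun τ => v τ x) (-(iteratedDeriv 3 (v t) x + nonlin (v t) x)) (Set.Icc 0 T) t

/-- `W` is a uniformly continuous map from `B(0,R) ⊆ ℱL^{s,p}(𝕋)` to `C([0,T], ℱL^{s,p}(𝕋))` that
extends the solution map for smooth initial data (classical solutions are determined by their
initial values). Only the values `W φ t` with `φ ∈ B(0,R)` and `t ∈ [0,T]` matter. -/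
structure IsSolutionMap (s : ℝ) (p : ℝ≥0∞) (R T : ℝ) (W : Distrib → ℝ → Distrib) : Prop where
  mem : ∀ φ ∈ ball s p R, IsContFL s p T (W φ)
  unifCont : ∀ ε > 0, ∃ δ > 0, ∀ φ ∈ ball s p R, ∀ χ ∈ ball s p R,
    flNorm s p (φ - χ) < δ → ∀ t ∈ Set.Icc 0 T, flNorm s p (W φ t - W χ t) < ε
  extends_smooth : ∀ φ ∈ ball s p R, ∀ g : ℝ → ℝ, IsSmoothData φ g →
    ∃ v : ℝ → ℝ → ℝ, IsClassicalSolution T v ∧ v 0 = g ∧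
      ∀ t ∈ Set.Icc 0 T, Represents (fun x => (v t x : ℂ)) (W φ t)

/-- `T_N f`, the trigonometric polynomial `∑_{|n| ≤ N} f̂(n) e^{inx}`. -/
noncomputable def trunc (N : ℕ) (f : Distrib) (x : ℝ) : ℂ :=
  ∑ n ∈ Finset.Icc (-(N : ℤ)) N, fourierCoef f n * (char n : ℝ → ℂ) x

/-- `F = 𝒩 u`, that is, `F ∈ C([0,T], 𝒟'(𝕋))` and `𝒩(T_N u) → F` in `C([0,T], 𝒟'(𝕋))` as
`N → ∞`. Testing against single functions suffices: on `𝒟'(𝕋)`, the dual of a Fréchet–Montel space,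
weak-* and strong topology have the same convergent sequences and the same continuous curves on
`[0,T]`, and they give the same sequences converging uniformly on `[0,T]` to a continuous curve. -/
def IsNonlinearity (T : ℝ) (u F : ℝ → Distrib) : Prop :=
  ∀ ψ : TestSpace,
    ContinuousOn (fun t => (F t : Module.Dual ℂ TestSpace) ψ) (Set.Icc 0 T) ∧
    TendstoUniformlyOn
      (fun (N : ℕ) (t : ℝ) =>
        ∫ x in (0 : ℝ)..(2 * Real.pi), nonlin (trunc N (u t)) x * (ψ : ℝ → ℂ) x)
      (fun t => (F t : Module.Dual ℂ TestSpace) ψ) Filter.atTop (Set.Icc 0 T)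

/-- `C_c^∞((0,T) × 𝕋)`. -/
structure SpaceTimeTest (T : ℝ) where
  toFun : ℝ → ℝ → ℂ
  smooth : ContDiff ℝ ∞ (fun q : ℝ × ℝ => toFun q.1 q.2)
  periodic : ∀ t, Function.Periodic (toFun t) (2 * Real.pi)
  support : ∃ a b : ℝ, 0 < a ∧ b < T ∧ ∀ t, t ∉ Set.Icc a b → ∀ x, toFun t x = 0

namespace SpaceTimeTest

variable {T : ℝ}

theorem smooth_slice (Ψ : SpaceTimeTest T) (t : ℝ) : ContDiff ℝ ∞ (Ψ.toFun t) :=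
  Ψ.smooth.comp (contDiff_const.prodMk contDiff_id : ContDiff ℝ ∞ fun x : ℝ => (t, x))

/-- `Ψ(t, ·)` -/
def slice (Ψ : SpaceTimeTest T) (t : ℝ) : TestSpace :=
  ⟨Ψ.toFun t, Ψ.smooth_slice t, Ψ.periodic t⟩

/-- `∂ₜ Ψ(t, ·)` -/
noncomputable def dt (Ψ : SpaceTimeTest T) (t : ℝ) : TestSpace :=
  ⟨fun x => deriv (fun τ => Ψ.toFun τ x) t, by
    refine ⟨?_, fun x => ?_⟩
    · have h : (fun x => deriv (fun τ => Ψ.toFun τ x) t)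
          = fun x => fderiv ℝ (fun q : ℝ × ℝ => Ψ.toFun q.1 q.2) (t, x) (1, 0) := by
        funext x
        have h1 := (Ψ.smooth.differentiable (by simp) (t, x)).hasFDerivAt
        have h2 : HasDerivAt (fun τ : ℝ => (τ, x)) ((1 : ℝ), (0 : ℝ)) t :=
          (hasDerivAt_id t).prodMk (hasDerivAt_const t x)
        exact (h1.comp_hasDerivAt t h2).deriv
      rw [h]
      exact ((Ψ.smooth.fderiv_right (m := ∞) (by simp)).comp
        (contDiff_const.prodMk contDiff_id)).clm_apply contDiff_const
    · exact congrArg (fun f : ℝ → ℂ => deriv f t) (funext fun τ => Ψ.periodic τ x)⟩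

/-- `∂ₓ³ Ψ(t, ·)` -/
noncomputable def dx3 (Ψ : SpaceTimeTest T) (t : ℝ) : TestSpace :=
  ⟨fun x => iteratedDeriv 3 (Ψ.toFun t) x, by
    refine ⟨?_, fun x => ?_⟩
    · have h := (Ψ.smooth_slice t).iterate_deriv 3
      simpa only [← iteratedDeriv_eq_iterate] using h
    · have h := congrFun (iteratedDeriv_comp_add_const 3 (Ψ.toFun t) (2 * Real.pi)) x
      exact h.symm.trans
        (congrArg (fun f : ℝ → ℂ => iteratedDeriv 3 f x) (funext (Ψ.periodic t)))⟩

end SpaceTimeTest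

/-- `∂ₜ u + ∂ₓ³ u + F = 0` in the sense of distributions on `(0,T) × 𝕋`. For weakly continuous
curves `u` and `F` in `𝒟'(𝕋)` both integrands are continuous. -/
def SolvesDistrib (T : ℝ) (u F : ℝ → Distrib) : Prop :=
  ∀ Ψ : SpaceTimeTest T,
    (∫ t in (0 : ℝ)..T, (u t : Module.Dual ℂ TestSpace) (Ψ.dt t + Ψ.dx3 t))
      = ∫ t in (0 : ℝ)..T, (F t : Module.Dual ℂ TestSpace) (Ψ.slice t)

end MKdV

/-! Write the `n`-th Fourier coefficient of `u(t)` as `e^{in³t} v_n(t)`. In these variables the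
equation becomes an integral equation: products `v_a v_b v_c` with `a + b + c = n` are integrated in
time against `e^{iΦt}`, where `Φ = a³ + b³ + c³ - n³ = -3(b+c)(a+c)(a+b)`. Subtracting the mean of
`u²` removes every term with `Φ = 0` except the diagonal one, `i n v_n² v_{-n}` (`coef_eq`,
`hasSum_nonT`).

Each mode is measured in a Hölder-1/2 norm in time (`hn`). On such functions integration against
`e^{iΦt}` gains `|Φ|^{-1/2}` and returns a Hölder-1/2 function, with a small factor `√T`
(`norm_integral_phase_le`). This is half of what integration by parts would give, but no time
derivative of `v` appears and the estimate closes. What remains is a trilinear inequality for the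
multiplier `|n| |Φ|^{-1/2}` in weighted `ℓ^p` (`exists_lpN_tri_le`). In the first case one frequency
and two factors of `Φ` are at least a multiple of `|n|`; these factors absorb the derivative, and
Young's inequality with the embedding into `H^α`, `α > 1/4`, finishes. In the second case all three
frequencies are that large; the two surplus weights are traded for decay in two factors of `Φ`, and
Hölder's inequality needs this decay in `ℓ^{p'}`, which is the condition `p'(s + 1/4) > 1`. The
diagonal term needs `s ≥ 1/2`.

For small `T` the Picard iteration therefore contracts, and the solution depends on the data in a
Lipschitz way. The trilinear inequality holds with the same constant under the weights `(1 +
ε|n|)^k`, so smooth data stay smooth on the same interval and give classical solutions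
(`IsTriConst.isProfile_sol`, `IsProfile.exists_classicalSolution`). This proves (a).

For (b), the cubic sum without its derivative converges absolutely because `α > 1/4`, and the
derivative is moved to the test function. The nonlinearity is thus Lipschitz on bounded sets, from
`ℱL^{s,p}` to distributions (`IsCubicConst.enorm_NL_sub_le`). Smooth data are dense in the ball and
`W` is uniformly continuous, so `W φ` is a limit of classical solutions, uniformly in time. It is
then a compact curve in the closure of the smooth functions and its high-frequency tails are
uniformly small. Hence `𝒩(T_N u)` converges, and the weak equation passes to the limit
(`IsContFL.isNonlinearity_NL`, `IsSolutionMap.solvesDistrib`). -/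

namespace MKdV
open MeasureTheory Filter

/-! ### Sequence spaces with values in `[0,∞]` -/

/-- The `ℓ^p` norm of a sequence with values in `[0,∞]`. -/
noncomputable def lpN {ι : Type*} [MeasurableSpace ι] (p : ℝ≥0∞) (A : ι → ℝ≥0∞) : ℝ≥0∞ :=
  eLpNorm A p Measure.count

section lpN

set_option linter.unusedSectionVars false

variable {ι : Type*} [MeasurableSpace ι] [DiscreteMeasurableSpace ι] {p : ℝ≥0∞}

theorem lpN_top (A : ι → ℝ≥0∞) : lpN ⊤ A = ⨆ i, A i := by
  simp [lpN]

theorem lpN_eq_tsum (h0 : p ≠ 0) (ht : p ≠ ⊤) (A : ι → ℝ≥0∞) :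
    lpN p A = (∑' i, A i ^ p.toReal) ^ (1 / p.toReal) := by
  rw [lpN, eLpNorm_eq_lintegral_rpow_enorm_toReal h0 ht]
  simp [lintegral_count]

theorem lpN_rpow (h0 : p ≠ 0) (ht : p ≠ ⊤) (A : ι → ℝ≥0∞) :
    lpN p A ^ p.toReal = ∑' i, A i ^ p.toReal := by
  rw [lpN_eq_tsum h0 ht, ← ENNReal.rpow_mul, one_div,
    inv_mul_cancel₀ (ENNReal.toReal_pos h0 ht).ne', ENNReal.rpow_one]

theorem lpN_one (A : ι → ℝ≥0∞) : lpN 1 A = ∑' i, A i := by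
  simp [lpN_eq_tsum]

theorem lpN_two_sq (A : ι → ℝ≥0∞) : lpN 2 A ^ 2 = ∑' i, A i ^ 2 := by
  have := lpN_rpow (p := 2) (by simp) (by simp) A
  simpa using this

theorem lpN_mono {A B : ι → ℝ≥0∞} (h : ∀ i, A i ≤ B i) : lpN p A ≤ lpN p B :=
  eLpNorm_mono_enorm (by simpa using h)

theorem le_lpN (h0 : p ≠ 0) (A : ι → ℝ≥0∞) (i : ι) : A i ≤ lpN p A := by
  simpa [lpN] using enorm_le_eLpNorm_count A i h0

theorem lpN_zero : lpN p (fun _ : ι => 0) = 0 := by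
  simp [lpN]

theorem lpN_add_le (hp : 1 ≤ p) (A B : ι → ℝ≥0∞) :
    lpN p (fun i => A i + B i) ≤ lpN p A + lpN p B :=
  eLpNorm_add_le (f := A) (g := B) (Measurable.of_discrete).aestronglyMeasurable
    (Measurable.of_discrete).aestronglyMeasurable hp

theorem lpN_const_mul (h0 : p ≠ 0) (c : ℝ≥0∞) (A : ι → ℝ≥0∞) :
    lpN p (fun i => c * A i) = c * lpN p A := by
  by_cases ht : p = ⊤
  · subst ht; simp [lpN_top, ENNReal.mul_iSup]
  · have hr := ENNReal.toReal_pos h0 ht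
    rw [lpN_eq_tsum h0 ht, lpN_eq_tsum h0 ht]
    simp_rw [ENNReal.mul_rpow_of_nonneg _ _ hr.le]
    rw [ENNReal.tsum_mul_left, ENNReal.mul_rpow_of_nonneg _ _ (by positivity),
      ← ENNReal.rpow_mul, mul_one_div_cancel hr.ne', ENNReal.rpow_one]

/-- Fatou's lemma for counting measure. Norm bounds pass through it to infinite sums and to limits
of Picard iterates, so completeness of the function spaces is never needed. -/
theorem lpN_le_of_le_liminf (h0 : p ≠ 0) {A : ι → ℝ≥0∞} {B : ℕ → ι → ℝ≥0∞} {C : ℝ≥0∞}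
    (hA : ∀ i, A i ≤ liminf (fun k => B k i) atTop) (hB : ∀ᶠ k in atTop, lpN p (B k) ≤ C) :
    lpN p A ≤ C := by
  by_cases ht : p = ⊤
  · subst ht
    rw [lpN_top]
    refine iSup_le fun i => (hA i).trans ?_
    refine liminf_le_of_frequently_le' (Eventually.frequently ?_)
    filter_upwards [hB] with k hk
    exact (le_lpN (by simp) (B k) i).trans hk
  · have hr := ENNReal.toReal_pos h0 ht
    rw [← ENNReal.rpow_le_rpow_iff hr, lpN_rpow h0 ht, ← lintegral_count]
    calc ∫⁻ i, A i ^ p.toReal ∂Measure.count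
        ≤ ∫⁻ i, liminf (fun k => B k i ^ p.toReal) atTop ∂Measure.count := by
          refine lintegral_mono fun i => ?_
          have hm : Monotone (fun x : ℝ≥0∞ => x ^ p.toReal) :=
            ENNReal.monotone_rpow_of_nonneg hr.le
          have := (hm.map_liminf_of_continuousAt (fun k => B k i)
            (ENNReal.continuous_rpow_const.continuousAt) (F := atTop))
          refine (hm (hA i)).trans ?_
          simpa [Function.comp_def] using this.le
      _ ≤ liminf (fun k => ∫⁻ i, B k i ^ p.toReal ∂Measure.count) atTop :=
          lintegral_liminf_le fun k => Measurable.of_discrete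
      _ ≤ C ^ p.toReal := by
          refine liminf_le_of_frequently_le' (Eventually.frequently ?_)
          filter_upwards [hB] with k hk
          rw [lintegral_count, ← lpN_rpow h0 ht]
          gcongr

theorem lpN_sum_le (hp : 1 ≤ p) {κ : Type*} (S : Finset κ) (A : κ → ι → ℝ≥0∞) :
    lpN p (fun i => ∑ k ∈ S, A k i) ≤ ∑ k ∈ S, lpN p (A k) := by
  classical
  induction S using Finset.induction_on with
  | empty => simp [lpN_zero]
  | insert a S ha ih =>
    simp only [Finset.sum_insert ha]
    exact (lpN_add_le hp _ _).trans (by gcongr)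

/-- Minkowski's inequality for infinite sums: countability gives a sequence of finite sets
exhausting the index set, and Fatou passes to the limit. -/
theorem lpN_tsum_le (hp : 1 ≤ p) {κ : Type*} [Countable κ] (A : κ → ι → ℝ≥0∞) :
    lpN p (fun i => ∑' k, A k i) ≤ ∑' k, lpN p (A k) := by
  have h0 : p ≠ 0 := (zero_lt_one.trans_le hp).ne'
  obtain ⟨S, hS⟩ := exists_seq_tendsto (atTop : Filter (Finset κ))
  refine lpN_le_of_le_liminf h0 (B := fun k i => ∑ j ∈ S k, A j i) (fun i => ?_)
    (Eventually.of_forall fun k => (lpN_sum_le hp _ _).trans (ENNReal.sum_le_tsum _))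
  exact ((ENNReal.summable.hasSum.comp hS).liminf_eq).ge

theorem lpN_comp_equiv {κ : Type*} [MeasurableSpace κ] [DiscreteMeasurableSpace κ]
    (h0 : p ≠ 0) (e : κ ≃ ι) (A : ι → ℝ≥0∞) :
    lpN p (fun i => A (e i)) = lpN p A := by
  by_cases ht : p = ⊤
  · subst ht; rw [lpN_top, lpN_top]; exact e.iSup_comp (g := A)
  · rw [lpN_eq_tsum h0 ht, lpN_eq_tsum h0 ht, ← e.tsum_eq]

/-- Hölder's inequality. -/
theorem lpN_mul_le {q r : ℝ≥0∞} (hq : q ≠ 0) (hp : p ≠ 0) (hr : r⁻¹ = p⁻¹ + q⁻¹)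
    (A B : ι → ℝ≥0∞) : lpN r (fun i => A i * B i) ≤ lpN p A * lpN q B := by
  -- Since `0 * ⊤ = 0`, vanishing and infinite norms are treated separately. In the remaining case
  -- all entries are finite, and Hölder's inequality for real functions applies.
  by_cases hA0 : lpN p A = 0
  · have : ∀ i, A i = 0 := fun i => le_antisymm ((le_lpN hp A i).trans hA0.le) zero_le
    simp [this, lpN_zero]
  by_cases hB0 : lpN q B = 0
  · have : ∀ i, B i = 0 := fun i => le_antisymm ((le_lpN hq B i).trans hB0.le) zero_le
    simp [this, lpN_zero]
  by_cases hAt : lpN p A = ⊤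
  · simp [hAt, ENNReal.top_mul hB0]
  by_cases hBt : lpN q B = ⊤
  · simp [hBt, ENNReal.mul_top hA0]
  have hA : ∀ i, A i ≠ ⊤ := fun i => ((le_lpN hp A i).trans_lt (Ne.lt_top hAt)).ne
  have hB : ∀ i, B i ≠ ⊤ := fun i => ((le_lpN hq B i).trans_lt (Ne.lt_top hBt)).ne
  have : ENNReal.HolderTriple p q r := ⟨hr.symm⟩
  have key := eLpNorm_le_eLpNorm_mul_eLpNorm_of_nnnorm (μ := (Measure.count : Measure ι))
    (p := p) (q := q) (r := r)
    (f := fun i => ((A i).toNNReal : ℝ)) (g := fun i => ((B i).toNNReal : ℝ))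
    (Measurable.of_discrete).aestronglyMeasurable
    (Measurable.of_discrete).aestronglyMeasurable (fun x y => x * y) 1
    (Eventually.of_forall fun i => by simp)
  have e1 : lpN r (fun i => A i * B i)
      = eLpNorm (fun i => ((A i).toNNReal : ℝ) * ((B i).toNNReal : ℝ)) r Measure.count := by
    refine eLpNorm_congr_enorm_ae (Eventually.of_forall fun i => ?_)
    simp [enorm_mul, ENNReal.coe_toNNReal (hA i), ENNReal.coe_toNNReal (hB i)]
  have e2 : lpN p A = eLpNorm (fun i => ((A i).toNNReal : ℝ)) p Measure.count := by
    refine eLpNorm_congr_enorm_ae (Eventually.of_forall fun i => ?_)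
    simp [ENNReal.coe_toNNReal (hA i)]
  have e3 : lpN q B = eLpNorm (fun i => ((B i).toNNReal : ℝ)) q Measure.count := by
    refine eLpNorm_congr_enorm_ae (Eventually.of_forall fun i => ?_)
    simp [ENNReal.coe_toNNReal (hB i)]
  rw [e1, e2, e3]
  simpa using key

theorem tsum_mul_le_lpN {q : ℝ≥0∞} (hpq : p⁻¹ + q⁻¹ = 1) (A B : ι → ℝ≥0∞) :
    ∑' i, A i * B i ≤ lpN p A * lpN q B := by
  have hp : p ≠ 0 := by rintro rfl; simp at hpq
  have hq : q ≠ 0 := by rintro rfl; simp at hpq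
  rw [← lpN_one]
  exact lpN_mul_le hq hp (by simpa using hpq.symm) A B

theorem tsum_mul_sq_le (A B : ι → ℝ≥0∞) :
    (∑' i, A i * B i) ^ 2 ≤ (∑' i, A i ^ 2) * ∑' i, B i ^ 2 := by
  have := tsum_mul_le_lpN (p := 2) (q := 2) (by simp [ENNReal.inv_two_add_inv_two]) A B
  calc (∑' i, A i * B i) ^ 2 ≤ (lpN 2 A * lpN 2 B) ^ 2 := by gcongr
    _ = _ := by rw [mul_pow, lpN_two_sq, lpN_two_sq]

/-- Write `A i ^ 2` as `A i ^ (2 - p) * A i ^ p` and bound the first factor by the `ℓ^p` norm. -/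
theorem lpN_two_le (h0 : p ≠ 0) (h2 : p ≤ 2) (A : ι → ℝ≥0∞) : lpN 2 A ≤ lpN p A := by
  have ht : p ≠ ⊤ := (h2.trans_lt (by simp)).ne
  have hr := ENNReal.toReal_pos h0 ht
  have hr2 : p.toReal ≤ 2 := by simpa using ENNReal.toReal_mono (by simp) h2
  rw [← ENNReal.rpow_le_rpow_iff (z := 2) (by norm_num)]
  have h22 := lpN_rpow (p := 2) (by simp) (by simp) A
  simp only [ENNReal.toReal_ofNat] at h22
  rw [h22]
  calc ∑' i, A i ^ (2 : ℝ) = ∑' i, A i ^ (2 - p.toReal) * A i ^ p.toReal := by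
        refine tsum_congr fun i => ?_
        rw [← ENNReal.rpow_add_of_nonneg _ _ (by linarith) hr.le]; simp
    _ ≤ ∑' i, lpN p A ^ (2 - p.toReal) * A i ^ p.toReal := by
        refine ENNReal.tsum_le_tsum fun i => ?_
        gcongr
        exact le_lpN h0 A i
    _ = lpN p A ^ (2 : ℝ) := by
        rw [ENNReal.tsum_mul_left, ← lpN_rpow h0 ht,
          ← ENNReal.rpow_add_of_nonneg _ _ (by linarith) hr.le]; simp

end lpN

/-- Young's inequality `ℓ^1 * ℓ^p ⊆ ℓ^p`. -/
theorem lpN_conv_le {p : ℝ≥0∞} (hp : 1 ≤ p) (k A : ℤ → ℝ≥0∞) :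
    lpN p (fun n => ∑' m, k m * A (n - m)) ≤ (∑' m, k m) * lpN p A := by
  have h0 : p ≠ 0 := (zero_lt_one.trans_le hp).ne'
  refine (lpN_tsum_le hp fun m n => k m * A (n - m)).trans ?_
  rw [← ENNReal.tsum_mul_right]
  refine ENNReal.tsum_le_tsum fun m => ?_
  rw [lpN_const_mul h0]
  gcongr
  exact (lpN_comp_equiv h0 (Equiv.subRight m) A).le

/-! ### Power weights, the embedding into `H^α`, and convolution sums -/

/-- The weight `(1 + a²)^β`. -/
noncomputable def jp (β : ℝ) (a : ℤ) : ℝ≥0∞ := ENNReal.ofReal ((1 + (a : ℝ) ^ 2) ^ β)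

theorem one_add_sq_pos (a : ℤ) : 0 < 1 + (a : ℝ) ^ 2 := by positivity

theorem jp_mul (β γ : ℝ) (a : ℤ) : jp β a * jp γ a = jp (β + γ) a := by
  rw [jp, jp, jp, ← ENNReal.ofReal_mul (by positivity), Real.rpow_add (one_add_sq_pos a)]

theorem jp_zero (a : ℤ) : jp 0 a = 1 := by simp [jp]

theorem jp_mul_neg (β : ℝ) (a : ℤ) : jp β a * jp (-β) a = 1 := by
  rw [jp_mul, add_neg_cancel, jp_zero]

theorem jp_ne_top (β : ℝ) (a : ℤ) : jp β a ≠ ⊤ := ENNReal.ofReal_ne_top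

theorem jp_mono {β γ : ℝ} (h : β ≤ γ) (a : ℤ) : jp β a ≤ jp γ a :=
  ENNReal.ofReal_le_ofReal (Real.rpow_le_rpow_of_exponent_le (by nlinarith [sq_nonneg (a : ℝ)]) h)

theorem one_le_jp {β : ℝ} (h : 0 ≤ β) (a : ℤ) : 1 ≤ jp β a := by
  rw [← jp_zero a]; exact jp_mono h a

theorem jp_le_one {β : ℝ} (h : β ≤ 0) (a : ℤ) : jp β a ≤ 1 := by
  rw [← jp_zero a]; exact jp_mono h a

theorem jp_rpow (β r : ℝ) (hr : 0 ≤ r) (a : ℤ) : jp β a ^ r = jp (β * r) a := by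
  rw [jp, jp, ENNReal.ofReal_rpow_of_nonneg (by positivity) hr, Real.rpow_mul (by positivity)]

theorem jp_sq (β : ℝ) (a : ℤ) : jp β a ^ 2 = jp (2 * β) a := by
  rw [sq, jp_mul, two_mul]

theorem jp_neg (β : ℝ) (a : ℤ) : jp β (-a) = jp β a := by simp [jp]

theorem tsum_jp_ne_top {γ : ℝ} (h : 1 / 2 < γ) : ∑' m, jp (-γ) m ≠ ⊤ := by
  have hs : Summable fun n : ℤ => (1 + (n : ℝ) ^ 2) ^ (-γ) := by
    have h1 := (Real.summable_abs_int_rpow (b := 2 * γ) (by linarith)).add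
      (summable_of_ne_finset_zero (f := fun n : ℤ => if n = 0 then (1 : ℝ) else 0) (s := {0})
        (by intro n hn; simpa using hn))
    refine Summable.of_nonneg_of_le (fun n => by positivity) (fun n => ?_) h1
    by_cases hn : n = 0
    · subst hn; simp; positivity
    · have hn' : (n : ℝ) ≠ 0 := by exact_mod_cast hn
      simp only [hn, if_false, add_zero]
      rw [show -(2 * γ) = 2 * (-γ) by ring, Real.rpow_mul (abs_nonneg _)]
      refine Real.rpow_le_rpow_of_nonpos (by positivity) ?_ (by linarith)
      simp
  have := hs.tsum_ofReal_ne_top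
  exact this

theorem lpN_jp_ne_top {r : ℝ≥0∞} {β : ℝ} (h : 1 < r * ENNReal.ofReal β) :
    lpN r (jp (-β / 2)) ≠ ⊤ := by
  have hβ : 0 < β := by
    by_contra hb
    rw [ENNReal.ofReal_of_nonpos (not_lt.1 hb)] at h
    simp at h
  have h0 : r ≠ 0 := by rintro rfl; simp at h
  by_cases ht : r = ⊤
  · subst ht
    rw [lpN_top]
    exact ((iSup_le fun a => jp_le_one (by linarith) a).trans_lt ENNReal.one_lt_top).ne
  · have hr := ENNReal.toReal_pos h0 ht
    rw [lpN_eq_tsum h0 ht]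
    have h1 : 1 < r.toReal * β := by
      rw [← ENNReal.ofReal_toReal ht, ← ENNReal.ofReal_mul hr.le, ← ENNReal.ofReal_one] at h
      exact (ENNReal.ofReal_lt_ofReal_iff_of_nonneg zero_le_one).1 h
    simp_rw [jp_rpow _ _ hr.le]
    have := tsum_jp_ne_top (γ := β / 2 * r.toReal) (by linarith)
    refine ENNReal.rpow_ne_top_of_nonneg (by positivity) ?_
    convert this using 4
    ring

/-- The smaller of the two brackets may carry both exponents. Summing this gives convolution bounds
that do not depend on the translation. -/
theorem jp_mul_jp_le {β γ : ℝ} (hβ : 0 ≤ β) (hγ : 0 ≤ γ) (x y : ℤ) :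
    jp (-β) x * jp (-γ) y ≤ jp (-(β + γ)) x + jp (-(β + γ)) y := by
  have aux : ∀ {β γ : ℝ}, 0 ≤ β → ∀ a b : ℤ, 1 + (a : ℝ) ^ 2 ≤ 1 + (b : ℝ) ^ 2 →
      jp (-β) b ≤ jp (-β) a := by
    intro β γ hβ a b h
    exact ENNReal.ofReal_le_ofReal
      (Real.rpow_le_rpow_of_nonpos (one_add_sq_pos a) h (by linarith))
  rcases le_total (1 + (x : ℝ) ^ 2) (1 + (y : ℝ) ^ 2) with h | h
  · refine le_trans ?_ le_self_add
    rw [neg_add, ← jp_mul]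
    gcongr
    exact aux (γ := γ) hγ x y h
  · refine le_trans ?_ le_add_self
    rw [neg_add, ← jp_mul]
    gcongr
    exact aux (γ := γ) hβ y x h

theorem tsum_jp_mul_jp_le {β γ : ℝ} (hβ : 0 ≤ β) (hγ : 0 ≤ γ) (e : ℤ ≃ ℤ) :
    ∑' m, jp (-β) (e m) * jp (-γ) m ≤ 2 * ∑' m, jp (-(β + γ)) m := by
  calc ∑' m, jp (-β) (e m) * jp (-γ) m
      ≤ ∑' m, (jp (-(β + γ)) (e m) + jp (-(β + γ)) m) :=
        ENNReal.tsum_le_tsum fun m => jp_mul_jp_le hβ hγ _ _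
    _ = 2 * ∑' m, jp (-(β + γ)) m := by
        rw [ENNReal.tsum_add, e.tsum_eq (fun m => jp (-(β + γ)) m), two_mul]

/-- The norm of `H^α`. -/
noncomputable def hN (α : ℝ) (A : ℤ → ℝ≥0∞) : ℝ≥0∞ := lpN 2 (fun n => jp (α / 2) n * A n)

theorem hN_sq (α : ℝ) (A : ℤ → ℝ≥0∞) : hN α A ^ 2 = ∑' n, (jp (α / 2) n * A n) ^ 2 :=
  lpN_two_sq _

theorem le_of_sq_le_sq' {a b : ℝ≥0∞} (h : a ^ 2 ≤ b ^ 2) : a ≤ b :=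
  (ENNReal.pow_le_pow_left_iff two_ne_zero).1 h

/-- Cauchy–Schwarz with the kernel split evenly: each half receives the negative weight of the other
variable, so the inner sum over that variable is bounded uniformly. It is useful for `α > 1/4`, when
the constant is finite. -/
theorem tsum_jp_bilinear_le {α : ℝ} (hα : 0 ≤ α) (B D : ℤ → ℝ≥0∞) :
    ∑' q : ℤ × ℤ, jp (-(1 / 4)) (q.1 + q.2) * B q.1 * D q.2
      ≤ (2 * ∑' m, jp (-(1 / 4 + α)) m) * hN α B * hN α D := by
  set S := ∑' m, jp (-(1 / 4 + α)) m
  have aux : ∀ B : ℤ → ℝ≥0∞, ∑' q : ℤ × ℤ,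
      (jp (-(1 / 8)) (q.1 + q.2) * jp (-(α / 2)) q.2 * (jp (α / 2) q.1 * B q.1)) ^ 2
        ≤ 2 * S * hN α B ^ 2 := by
    intro B
    rw [ENNReal.tsum_prod', hN_sq, ← ENNReal.tsum_mul_left]
    refine ENNReal.tsum_le_tsum fun x => ?_
    simp_rw [mul_pow _ (jp (α / 2) x * B x), ENNReal.tsum_mul_right]
    gcongr
    refine le_trans (le_of_eq (tsum_congr fun y => ?_))
      (tsum_jp_mul_jp_le (by norm_num) hα (Equiv.addLeft x))
    rw [mul_pow, jp_sq, jp_sq]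
    simp only [Equiv.coe_addLeft]
    ring_nf
  refine le_of_sq_le_sq' ?_
  calc (∑' q : ℤ × ℤ, jp (-(1 / 4)) (q.1 + q.2) * B q.1 * D q.2) ^ 2
      = (∑' q : ℤ × ℤ,
          (jp (-(1 / 8)) (q.1 + q.2) * jp (-(α / 2)) q.2 * (jp (α / 2) q.1 * B q.1)) *
          (jp (-(1 / 8)) (q.1 + q.2) * jp (-(α / 2)) q.1 * (jp (α / 2) q.2 * D q.2))) ^ 2 := by
        congr 1
        refine tsum_congr fun q => ?_
        have e1 : jp (-(1 / 4)) (q.1 + q.2)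
            = jp (-(1 / 8)) (q.1 + q.2) * jp (-(1 / 8)) (q.1 + q.2) := by
          rw [jp_mul]; norm_num
        calc _ = jp (-(1 / 4)) (q.1 + q.2) * B q.1 * D q.2
              * (jp (α / 2) q.1 * jp (-(α / 2)) q.1) * (jp (α / 2) q.2 * jp (-(α / 2)) q.2) := by
              rw [jp_mul_neg, jp_mul_neg, mul_one, mul_one]
          _ = _ := by rw [e1]; ring
    _ ≤ (2 * S * hN α B ^ 2) * (2 * S * hN α D ^ 2) := by
        refine (tsum_mul_sq_le _ _).trans (mul_le_mul' (aux B) ?_)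
        refine le_trans (le_of_eq ?_) (aux D)
        rw [← (Equiv.prodComm ℤ ℤ).tsum_eq]
        refine tsum_congr fun q => ?_
        simp [add_comm]
    _ = _ := by ring

/-- Cauchy–Schwarz again: two factors form a tensor product of square-summable sequences. In the
other square the third frequency becomes an independent variable, and the weights sum uniformly.
This serves part (b), where no time oscillation is exploited. -/
theorem tsum_trilinear_le {α : ℝ} (hα : 0 ≤ α) (A B D : ℤ → ℝ≥0∞) (n : ℤ) :
    ∑' q : ℤ × ℤ, A q.1 * B q.2 * D (n - q.1 - q.2)
      ≤ (1 + 2 * ∑' m, jp (-(2 * α)) m) * hN α A * hN α B * hN α D := by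
  set S := ∑' m, jp (-(2 * α)) m
  have h1 : ∑' q : ℤ × ℤ, ((jp (α / 2) q.1 * A q.1) * (jp (α / 2) q.2 * B q.2)) ^ 2
      = hN α A ^ 2 * hN α B ^ 2 := by
    rw [ENNReal.tsum_prod', hN_sq, hN_sq, ← ENNReal.tsum_mul_right]
    refine tsum_congr fun x => ?_
    rw [← ENNReal.tsum_mul_left]
    simp_rw [mul_pow]
  have h2 : ∑' q : ℤ × ℤ, (jp (-(α / 2)) q.1 * jp (-(α / 2)) q.2 * D (n - q.1 - q.2)) ^ 2
      ≤ 2 * S * hN α D ^ 2 := by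
    let e : ℤ × ℤ ≃ ℤ × ℤ :=
      { toFun := fun q => (n - q.1 - q.2, q.2), invFun := fun q => (n - q.1 - q.2, q.2)
        left_inv := fun q => by ext <;> simp <;> ring
        right_inv := fun q => by ext <;> simp <;> ring }
    rw [← e.tsum_eq, ENNReal.tsum_prod', hN_sq, ← ENNReal.tsum_mul_left]
    refine ENNReal.tsum_le_tsum fun m => ?_
    have : ∀ y : ℤ, (jp (-(α / 2)) (e (m, y)).1 * jp (-(α / 2)) (e (m, y)).2
        * D (n - (e (m, y)).1 - (e (m, y)).2)) ^ 2
        = jp (-α) ((Equiv.subLeft (n - m)) y) * jp (-α) y * D m ^ 2 := by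
      intro y
      simp only [e, Equiv.coe_fn_mk, Equiv.subLeft_apply, mul_pow, jp_sq]
      ring_nf
    simp_rw [this, ENNReal.tsum_mul_right]
    have h3 := tsum_jp_mul_jp_le hα hα (Equiv.subLeft (n - m))
    rw [← two_mul] at h3
    refine mul_le_mul' h3 ?_
    gcongr
    exact le_mul_of_one_le_left zero_le (one_le_jp (by linarith) m)
  refine le_of_sq_le_sq' ?_
  calc (∑' q : ℤ × ℤ, A q.1 * B q.2 * D (n - q.1 - q.2)) ^ 2
      = (∑' q : ℤ × ℤ, ((jp (α / 2) q.1 * A q.1) * (jp (α / 2) q.2 * B q.2)) *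
          (jp (-(α / 2)) q.1 * jp (-(α / 2)) q.2 * D (n - q.1 - q.2))) ^ 2 := by
        congr 1
        refine tsum_congr fun q => ?_
        calc _ = A q.1 * B q.2 * D (n - q.1 - q.2)
              * (jp (α / 2) q.1 * jp (-(α / 2)) q.1) * (jp (α / 2) q.2 * jp (-(α / 2)) q.2) := by
              rw [jp_mul_neg, jp_mul_neg, mul_one, mul_one]
          _ = _ := by ring
    _ ≤ (hN α A ^ 2 * hN α B ^ 2) * (2 * S * hN α D ^ 2) :=
        (tsum_mul_sq_le _ _).trans (mul_le_mul' h1.le h2)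
    _ = 2 * S * (hN α A * hN α B * hN α D) ^ 2 := by ring
    -- Rounding `√(2 * S)` up to `1 + 2 * S` avoids a root in the constant.
    _ ≤ (1 + 2 * S) ^ 2 * (hN α A * hN α B * hN α D) ^ 2 := by
        gcongr
        calc 2 * S ≤ 1 + 2 * S := le_add_self
          _ ≤ (1 + 2 * S) ^ 2 := by
            rw [sq]; exact le_mul_of_one_le_left zero_le le_self_add
    _ = _ := by ring

theorem inv_lt_ofReal_iff {r : ℝ≥0∞} {b : ℝ} (hb : 0 < b) :
    r⁻¹ < ENNReal.ofReal b ↔ 1 < r * ENNReal.ofReal b := by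
  rw [ENNReal.inv_lt_iff_inv_lt, ← one_div, ENNReal.div_lt_iff (Or.inl (by simpa using hb))
    (Or.inl ENNReal.ofReal_ne_top)]

/-- `ℱL^{s,p} ⊆ H^α` for some `α > 1/4`. -/
theorem exists_hN_le {s : ℝ} {p p' : ℝ≥0∞} (hs : 1 / 2 ≤ s) (hp : 1 ≤ p)
    (hpp' : p⁻¹ + p'⁻¹ = 1) (hsp : 1 < p' * ENNReal.ofReal (s + 1 / 4)) :
    ∃ α : ℝ, 1 / 4 < α ∧ ∃ C : ℝ≥0∞, C ≠ ⊤ ∧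
      ∀ A : ℤ → ℝ≥0∞, hN α A ≤ C * lpN p (fun n => jp (s / 2) n * A n) := by
  have h0 : p ≠ 0 := (zero_lt_one.trans_le hp).ne'
  rcases le_total p 2 with h2 | h2
  · refine ⟨s, by linarith, 1, by simp, fun A => ?_⟩
    rw [one_mul]
    exact lpN_two_le h0 h2 _
  · have hinv : p⁻¹ ≤ 2⁻¹ := ENNReal.inv_le_inv.2 h2
    set e := (p⁻¹).toReal with he
    have hpt : p⁻¹ ≠ ⊤ := ENNReal.inv_ne_top.2 h0
    have hpe : p⁻¹ = ENNReal.ofReal e := (ENNReal.ofReal_toReal hpt).symm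
    have he2 : e ≤ 1 / 2 := by
      have := ENNReal.toReal_mono (by simp) hinv
      rw [he]
      refine this.trans ?_
      rw [ENNReal.toReal_inv]; norm_num
    have he0 : 0 ≤ e := ENNReal.toReal_nonneg
    have hp'1 : p'⁻¹ = ENNReal.ofReal (1 - e) := by
      rw [ENNReal.ofReal_sub _ he0, ENNReal.ofReal_one, ← hpe]
      exact ENNReal.eq_sub_of_add_eq hpt (by rw [add_comm]; exact hpp')
    have hp'0 : p'⁻¹ ≠ 0 := by
      rw [hp'1]; simp; linarith
    have hp't : p' ≠ ⊤ := by rintro rfl; simp at hp'0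
    have hse : 3 / 4 < s + e := by
      have h3 : p'⁻¹ < ENNReal.ofReal (s + 1 / 4) := by
        exact (inv_lt_ofReal_iff (by linarith)).2 hsp
      rw [hp'1, ENNReal.ofReal_lt_ofReal_iff (by linarith)] at h3
      linarith
    -- The hypothesis on `p'` now reads `s + 1/p > 3/4`. Taking `α` below `s + 1/p - 1/2` makes the
    -- Hölder weight summable, and `α < 1/2 ≤ s` keeps `s - α` positive.
    obtain ⟨α, h1, h2⟩ := exists_between (show 1 / 4 < min (1 / 2) (s + e - 1 / 2) by
      rw [lt_min_iff]; constructor <;> linarith)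
    rw [lt_min_iff] at h2
    -- The Hölder exponent with `1/2 = 1/p + 1/r`; it is `⊤` when `p = 2`.
    set r := (2⁻¹ - p⁻¹)⁻¹ with hr
    have hri : r⁻¹ = ENNReal.ofReal (1 / 2 - e) := by
      rw [hr, inv_inv, ENNReal.ofReal_sub _ he0, ← hpe, one_div,
        ENNReal.ofReal_inv_of_pos two_pos, ENNReal.ofReal_ofNat]
    have hr0 : r ≠ 0 := by
      rw [hr]; simp
    refine ⟨α, h1, lpN r (jp (-(s - α) / 2)), lpN_jp_ne_top ?_, fun A => ?_⟩
    · have : r⁻¹ < ENNReal.ofReal (s - α) := by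
        rw [hri, ENNReal.ofReal_lt_ofReal_iff (by linarith)]
        linarith
      exact (inv_lt_ofReal_iff (by linarith)).1 this
    · calc hN α A = lpN 2 (fun n => jp (-(s - α) / 2) n * (jp (s / 2) n * A n)) := by
            rw [hN]; congr 1; ext n
            rw [← mul_assoc, jp_mul]; ring_nf
        _ ≤ _ := by
            refine lpN_mul_le h0 hr0 ?_ _ _
            rw [hr, inv_inv, tsub_add_cancel_of_le hinv]

/-! ### The resonance function and pointwise bounds of the multiplier -/

/-- `(n - n₁)(n - n₂)(n - n₃)`, where `n = n₁ + n₂ + n₃`. -/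
def res (a b c : ℤ) : ℤ := (b + c) * (a + c) * (a + b)

/-- The size of the trilinear multiplier after one half of the phase has been gained. -/
noncomputable def kap (a b c : ℤ) : ℝ :=
  if res a b c ≠ 0 then |((a + b + c : ℤ) : ℝ)| * |(res a b c : ℝ)| ^ (-(1 / 2) : ℝ)
  else if a = b ∧ c = -a then |(a : ℝ)| else 0

theorem abs_rpow_neg_half_le {x : ℤ} (hx : x ≠ 0) :
    |(x : ℝ)| ^ (-(1 / 2) : ℝ) ≤ 2 * (1 + (x : ℝ) ^ 2) ^ (-(1 / 4) : ℝ) := by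
  have hx1 : (1 : ℝ) ≤ |(x : ℝ)| := by exact_mod_cast Int.one_le_abs hx
  have h1 : (1 + (x : ℝ) ^ 2) / 2 ≤ |(x : ℝ)| ^ 2 := by
    rw [sq_abs]; nlinarith [sq_abs (x : ℝ)]
  calc |(x : ℝ)| ^ (-(1 / 2) : ℝ) = (|(x : ℝ)| ^ 2) ^ (-(1 / 4) : ℝ) := by
        rw [← Real.rpow_natCast, ← Real.rpow_mul (abs_nonneg _)]; norm_num
    _ ≤ ((1 + (x : ℝ) ^ 2) / 2) ^ (-(1 / 4) : ℝ) :=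
        Real.rpow_le_rpow_of_nonpos (by positivity) h1 (by norm_num)
    _ = 2 ^ (1 / 4 : ℝ) * (1 + (x : ℝ) ^ 2) ^ (-(1 / 4) : ℝ) := by
        rw [Real.div_rpow (by positivity) (by norm_num), Real.rpow_neg (x := 2) (by norm_num),
          div_inv_eq_mul, mul_comm]
    _ ≤ 2 * (1 + (x : ℝ) ^ 2) ^ (-(1 / 4) : ℝ) := by
        gcongr
        calc (2 : ℝ) ^ (1 / 4 : ℝ) ≤ 2 ^ (1 : ℝ) :=
              Real.rpow_le_rpow_of_exponent_le (by norm_num) (by norm_num)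
          _ = 2 := by simp

theorem weight_le {s : ℝ} (hs : 0 ≤ s) {n m : ℤ} {K : ℕ} (hK : 1 ≤ K) (h : |n| ≤ K * |m|) :
    (1 + (n : ℝ) ^ 2) ^ s ≤ ((K : ℝ) ^ 2) ^ s * (1 + (m : ℝ) ^ 2) ^ s := by
  rw [← Real.mul_rpow (by positivity) (by positivity)]
  refine Real.rpow_le_rpow (by positivity) ?_ hs
  have h' : |(n : ℝ)| ≤ K * |(m : ℝ)| := by exact_mod_cast h
  have hK' : (1 : ℝ) ≤ K := by exact_mod_cast hK
  have h2 : (n : ℝ) ^ 2 ≤ (K * |(m : ℝ)|) ^ 2 := by rw [← sq_abs]; gcongr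
  rw [mul_pow, sq_abs] at h2
  nlinarith

/-- Two factors of the resonance function are at least `|n| / 10`, so the root of their product pays
for the whole derivative. The third factor keeps its decay `|x|^{-1/2}`. -/
theorem kernel_le_of_high {s : ℝ} (hs : 0 ≤ s) {n m x y z : ℤ} (hx : x ≠ 0) (hy : y ≠ 0)
    (hz : z ≠ 0) (hm : |n| ≤ 10 * |m|) (hny : |n| ≤ 10 * |y|) (hnz : |n| ≤ 10 * |z|) :
    (1 + (n : ℝ) ^ 2) ^ s * (|(n : ℝ)| * |((x * y * z : ℤ) : ℝ)| ^ (-(1 / 2) : ℝ))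
      ≤ 20 * (100 ^ s * ((1 + (m : ℝ) ^ 2) ^ s * (1 + (x : ℝ) ^ 2) ^ (-(1 / 4) : ℝ))) := by
  have h1 := weight_le hs (K := 10) (by norm_num) (by exact_mod_cast hm)
  have hY : (0 : ℝ) < |(y : ℝ)| := by positivity
  have hZ : (0 : ℝ) < |(z : ℝ)| := by positivity
  have h2 : |(n : ℝ)| ≤ 10 * (|(y : ℝ)| * |(z : ℝ)|) ^ (1 / 2 : ℝ) := by
    have hny' : |(n : ℝ)| ≤ 10 * |(y : ℝ)| := by exact_mod_cast hny
    have hnz' : |(n : ℝ)| ≤ 10 * |(z : ℝ)| := by exact_mod_cast hnz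
    rw [← Real.sqrt_eq_rpow]
    have : |(n : ℝ)| / 10 ≤ √(|(y : ℝ)| * |(z : ℝ)|) := by
      refine Real.le_sqrt_of_sq_le ?_
      rw [sq]
      exact mul_le_mul (by linarith) (by linarith) (by positivity) (by positivity)
    linarith
  have h3 : |(n : ℝ)| * |((x * y * z : ℤ) : ℝ)| ^ (-(1 / 2) : ℝ)
      ≤ 20 * (1 + (x : ℝ) ^ 2) ^ (-(1 / 4) : ℝ) := by
    push_cast
    rw [mul_assoc, abs_mul, abs_mul (y : ℝ), Real.mul_rpow (abs_nonneg _) (by positivity)]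
    have h4 : (|(y : ℝ)| * |(z : ℝ)|) ^ (1 / 2 : ℝ) * (|(y : ℝ)| * |(z : ℝ)|) ^ (-(1 / 2) : ℝ)
        = 1 := by
      rw [← Real.rpow_add (by positivity)]; norm_num
    calc |(n : ℝ)| * (|(x : ℝ)| ^ (-(1 / 2) : ℝ) * (|(y : ℝ)| * |(z : ℝ)|) ^ (-(1 / 2) : ℝ))
        ≤ (10 * (|(y : ℝ)| * |(z : ℝ)|) ^ (1 / 2 : ℝ)) *
          (|(x : ℝ)| ^ (-(1 / 2) : ℝ) * (|(y : ℝ)| * |(z : ℝ)|) ^ (-(1 / 2) : ℝ)) := by gcongr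
      _ = 10 * |(x : ℝ)| ^ (-(1 / 2) : ℝ) * ((|(y : ℝ)| * |(z : ℝ)|) ^ (1 / 2 : ℝ) *
          (|(y : ℝ)| * |(z : ℝ)|) ^ (-(1 / 2) : ℝ)) := by ring
      _ ≤ 10 * (2 * (1 + (x : ℝ) ^ 2) ^ (-(1 / 4) : ℝ)) * 1 := by
          rw [h4]
          gcongr
          exact abs_rpow_neg_half_le hx
      _ = _ := by ring
  calc _ ≤ (((10 : ℕ) : ℝ) ^ 2) ^ s * (1 + (m : ℝ) ^ 2) ^ s *
        (20 * (1 + (x : ℝ) ^ 2) ^ (-(1 / 4) : ℝ)) := by gcongr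
    _ = _ := by norm_num; ring

/-- Only one factor `z` is known to reach `|n|`, so half a derivative is left over; it is split
evenly between `x` and `y`. Three large frequencies provide two more weights than the output uses.
As `|x|, |y| ≤ |n|`, these two weights cover the excess and leave the stronger decay with exponent
`s + 1/8` in both variables. Here `s` is half of the regularity index. -/
theorem kernel_le_of_all_high {s : ℝ} (hs : 1 / 8 ≤ s) {n a b c x y z : ℤ} (hx : x ≠ 0)
    (hy : y ≠ 0) (ha : |n| ≤ 2 * |a|) (hb : |n| ≤ 2 * |b|) (hc : |n| ≤ 2 * |c|)
    (hxn : |x| ≤ |n|) (hyn : |y| ≤ |n|) (hzn : |n| ≤ |z|) :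
    (1 + (n : ℝ) ^ 2) ^ s * (|(n : ℝ)| * |((x * y * z : ℤ) : ℝ)| ^ (-(1 / 2) : ℝ))
      ≤ 4 * (64 ^ s * (((1 + (a : ℝ) ^ 2) ^ s * (1 + (b : ℝ) ^ 2) ^ s * (1 + (c : ℝ) ^ 2) ^ s) *
        ((1 + (x : ℝ) ^ 2) ^ (-(s + 1 / 8)) * (1 + (y : ℝ) ^ 2) ^ (-(s + 1 / 8))))) := by
  have hs0 : 0 ≤ s := by linarith
  have h1 := weight_le hs0 (K := 2) (by norm_num) (by exact_mod_cast ha)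
  have h2 := weight_le hs0 (K := 2) (by norm_num) (by exact_mod_cast hb)
  have h3 := weight_le hs0 (K := 2) (by norm_num) (by exact_mod_cast hc)
  have hn : n ≠ 0 := by
    rintro rfl
    rw [abs_zero] at hxn
    exact hx (abs_nonpos_iff.1 hxn)
  have hN : (0 : ℝ) < |(n : ℝ)| := by positivity
  have hz : |(n : ℝ)| * |(z : ℝ)| ^ (-(1 / 2) : ℝ) ≤ (1 + (n : ℝ) ^ 2) ^ (1 / 4 : ℝ) := by
    have hzn' : |(n : ℝ)| ≤ |(z : ℝ)| := by exact_mod_cast hzn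
    calc |(n : ℝ)| * |(z : ℝ)| ^ (-(1 / 2) : ℝ)
        ≤ |(n : ℝ)| ^ (1 : ℝ) * |(n : ℝ)| ^ (-(1 / 2) : ℝ) := by
          rw [Real.rpow_one]
          exact mul_le_mul_of_nonneg_left
            (Real.rpow_le_rpow_of_nonpos hN hzn' (by norm_num)) hN.le
      _ = (|(n : ℝ)| ^ 2) ^ (1 / 4 : ℝ) := by
          rw [← Real.rpow_add hN, ← Real.rpow_natCast, ← Real.rpow_mul (abs_nonneg _)]; norm_num
      _ ≤ (1 + (n : ℝ) ^ 2) ^ (1 / 4 : ℝ) := by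
          rw [sq_abs]
          exact Real.rpow_le_rpow (by positivity) (by linarith) (by norm_num)
  have aux : ∀ x : ℤ, |x| ≤ |n| → (1 + (n : ℝ) ^ 2) ^ (1 / 8 : ℝ) * (1 + (x : ℝ) ^ 2) ^ (-(1 / 4) : ℝ)
      ≤ (1 + (n : ℝ) ^ 2) ^ s * (1 + (x : ℝ) ^ 2) ^ (-(s + 1 / 8)) := by
    intro x hxn
    have hxn' : |(x : ℝ)| ≤ |(n : ℝ)| := by exact_mod_cast hxn
    have : (1 + (n : ℝ) ^ 2) ^ (1 / 8 - s) ≤ (1 + (x : ℝ) ^ 2) ^ (1 / 8 - s) := by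
      refine Real.rpow_le_rpow_of_nonpos (one_add_sq_pos x) ?_ (by linarith)
      have := sq_le_sq.2 hxn'
      linarith
    calc _ = (1 + (n : ℝ) ^ 2) ^ s * ((1 + (n : ℝ) ^ 2) ^ (1 / 8 - s)
          * (1 + (x : ℝ) ^ 2) ^ (-(1 / 4) : ℝ)) := by
          rw [← mul_assoc, ← Real.rpow_add (one_add_sq_pos n)]; ring_nf
      _ ≤ (1 + (n : ℝ) ^ 2) ^ s * ((1 + (x : ℝ) ^ 2) ^ (1 / 8 - s)
          * (1 + (x : ℝ) ^ 2) ^ (-(1 / 4) : ℝ)) := by gcongr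
      _ = _ := by
          rw [← Real.rpow_add (one_add_sq_pos x)]; ring_nf
  have e64 : (64 : ℝ) ^ s = (((2 : ℕ) : ℝ) ^ 2) ^ s * (((2 : ℕ) : ℝ) ^ 2) ^ s
      * (((2 : ℕ) : ℝ) ^ 2) ^ s := by
    rw [← Real.mul_rpow (by positivity) (by positivity),
      ← Real.mul_rpow (by positivity) (by positivity)]
    norm_num
  have e8 : (1 + (n : ℝ) ^ 2) ^ (1 / 4 : ℝ)
      = (1 + (n : ℝ) ^ 2) ^ (1 / 8 : ℝ) * (1 + (n : ℝ) ^ 2) ^ (1 / 8 : ℝ) := by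
    rw [← Real.rpow_add (one_add_sq_pos n)]; norm_num
  push_cast
  rw [abs_mul, abs_mul, Real.mul_rpow (by positivity) (abs_nonneg _),
    Real.mul_rpow (abs_nonneg _) (abs_nonneg _)]
  calc (1 + (n : ℝ) ^ 2) ^ s * (|(n : ℝ)| * (|(x : ℝ)| ^ (-(1 / 2) : ℝ)
        * |(y : ℝ)| ^ (-(1 / 2) : ℝ) * |(z : ℝ)| ^ (-(1 / 2) : ℝ)))
      = (1 + (n : ℝ) ^ 2) ^ s * (|(x : ℝ)| ^ (-(1 / 2) : ℝ) * |(y : ℝ)| ^ (-(1 / 2) : ℝ)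
        * (|(n : ℝ)| * |(z : ℝ)| ^ (-(1 / 2) : ℝ))) := by ring
    _ ≤ (1 + (n : ℝ) ^ 2) ^ s * ((2 * (1 + (x : ℝ) ^ 2) ^ (-(1 / 4) : ℝ))
        * (2 * (1 + (y : ℝ) ^ 2) ^ (-(1 / 4) : ℝ)) * (1 + (n : ℝ) ^ 2) ^ (1 / 4 : ℝ)) := by
        gcongr
        · exact abs_rpow_neg_half_le hx
        · exact abs_rpow_neg_half_le hy
    _ = 4 * ((1 + (n : ℝ) ^ 2) ^ s
        * ((1 + (n : ℝ) ^ 2) ^ (1 / 8 : ℝ) * (1 + (x : ℝ) ^ 2) ^ (-(1 / 4) : ℝ))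
        * ((1 + (n : ℝ) ^ 2) ^ (1 / 8 : ℝ) * (1 + (y : ℝ) ^ 2) ^ (-(1 / 4) : ℝ))) := by
        rw [e8]; ring
    _ ≤ 4 * ((1 + (n : ℝ) ^ 2) ^ s
        * ((1 + (n : ℝ) ^ 2) ^ s * (1 + (x : ℝ) ^ 2) ^ (-(s + 1 / 8)))
        * ((1 + (n : ℝ) ^ 2) ^ s * (1 + (y : ℝ) ^ 2) ^ (-(s + 1 / 8)))) := by
        refine mul_le_mul_of_nonneg_left ?_ (by norm_num)
        exact mul_le_mul (mul_le_mul_of_nonneg_left (aux x hxn) (by positivity)) (aux y hyn)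
          (by positivity) (by positivity)
    _ = 4 * (((1 + (n : ℝ) ^ 2) ^ s * (1 + (n : ℝ) ^ 2) ^ s * (1 + (n : ℝ) ^ 2) ^ s)
        * ((1 + (x : ℝ) ^ 2) ^ (-(s + 1 / 8)) * (1 + (y : ℝ) ^ 2) ^ (-(s + 1 / 8)))) := by ring
    _ ≤ 4 * (((((2 : ℕ) : ℝ) ^ 2) ^ s * (1 + (a : ℝ) ^ 2) ^ s
        * ((((2 : ℕ) : ℝ) ^ 2) ^ s * (1 + (b : ℝ) ^ 2) ^ s)
        * ((((2 : ℕ) : ℝ) ^ 2) ^ s * (1 + (c : ℝ) ^ 2) ^ s))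
        * ((1 + (x : ℝ) ^ 2) ^ (-(s + 1 / 8)) * (1 + (y : ℝ) ^ 2) ^ (-(s + 1 / 8)))) := by
        gcongr
    _ = _ := by rw [e64]; ring

/-- With `n = a + b + c`, the factors of the resonance function are `n - a`, `n - b`, `n - c`, with
sum `2n`. The constants 10 and 2 leave enough room for a proof by linear arithmetic on absolute
values. -/
theorem high_frequency_cases (a b c : ℤ) :
    (|a + b + c| ≤ 10 * |a| ∧ |a + b + c| ≤ 10 * |a + c| ∧ |a + b + c| ≤ 10 * |a + b|) ∨
    (|a + b + c| ≤ 10 * |b| ∧ |a + b + c| ≤ 10 * |b + c| ∧ |a + b + c| ≤ 10 * |a + b|) ∨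
    (|a + b + c| ≤ 10 * |c| ∧ |a + b + c| ≤ 10 * |b + c| ∧ |a + b + c| ≤ 10 * |a + c|) ∨
    ((|a + b + c| ≤ 2 * |a| ∧ |a + b + c| ≤ 2 * |b| ∧ |a + b + c| ≤ 2 * |c|) ∧
      ((|b + c| ≤ |a + b + c| ∧ |a + c| ≤ |a + b + c| ∧ |a + b + c| ≤ |a + b|) ∨
      (|b + c| ≤ |a + b + c| ∧ |a + b| ≤ |a + b + c| ∧ |a + b + c| ≤ |a + c|) ∨
      (|a + c| ≤ |a + b + c| ∧ |a + b| ≤ |a + b + c| ∧ |a + b + c| ≤ |b + c|))) := by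
  simp only [Int.abs_eq_natAbs]
  omega

/-- The first three terms on the right are made for Young's inequality, one for each frequency that
carries the weight. The remaining three, one for each pair of factors with decay, are made for
Hölder's inequality. -/
theorem weight_mul_kap_le {s : ℝ} (hs : 1 / 2 ≤ s) (a b c : ℤ) :
    jp (s / 2) (a + b + c) * ENNReal.ofReal (kap a b c) ≤ ENNReal.ofReal (20 * 100 ^ s) *
      (jp (s / 2) a * jp (-(1 / 4)) (b + c) + jp (s / 2) b * jp (-(1 / 4)) (a + c)
        + jp (s / 2) c * jp (-(1 / 4)) (a + b)
        + jp (s / 2) a * jp (s / 2) b * jp (s / 2) c *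
          (jp (-(s / 2 + 1 / 8)) (b + c) * jp (-(s / 2 + 1 / 8)) (a + c)
          + jp (-(s / 2 + 1 / 8)) (b + c) * jp (-(s / 2 + 1 / 8)) (a + b)
          + jp (-(s / 2 + 1 / 8)) (a + c) * jp (-(s / 2 + 1 / 8)) (a + b))) := by
  have hK : (100 : ℝ) ^ (s / 2) ≤ 100 ^ s :=
    Real.rpow_le_rpow_of_exponent_le (by norm_num) (by linarith)
  have hK' : (64 : ℝ) ^ (s / 2) ≤ 100 ^ s :=
    (Real.rpow_le_rpow (by norm_num) (by norm_num) (by linarith)).trans hK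
  by_cases hr : res a b c = 0
  · by_cases hab : a = b ∧ c = -a
    -- The diagonal term has no oscillation: its full derivative is paid by two of the three
    -- weights, together `(1 + a²)^s`. This is where `s ≥ 1/2` is needed.
    · obtain ⟨rfl, rfl⟩ := hab
      have e1 : kap a a (-a) = |(a : ℝ)| := by simp [kap, hr]
      have e2 : ENNReal.ofReal |(a : ℝ)| ≤ jp s a := by
        refine ENNReal.ofReal_le_ofReal ?_
        calc |(a : ℝ)| = ((a : ℝ) ^ 2) ^ (1 / 2 : ℝ) := by
              rw [← Real.sqrt_eq_rpow, Real.sqrt_sq_eq_abs]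
          _ ≤ (1 + (a : ℝ) ^ 2) ^ (1 / 2 : ℝ) :=
              Real.rpow_le_rpow (by positivity) (by linarith) (by norm_num)
          _ ≤ _ := Real.rpow_le_rpow_of_exponent_le (by nlinarith [sq_nonneg (a : ℝ)]) hs
      have e3 : (1 : ℝ≥0∞) ≤ ENNReal.ofReal (20 * 100 ^ s) := by
        rw [← ENNReal.ofReal_one]
        refine ENNReal.ofReal_le_ofReal ?_
        have := Real.one_le_rpow (x := 100) (z := s) (by norm_num) (by linarith)
        linarith
      have e4 : jp (-(s / 2 + 1 / 8)) (a + -a) = 1 := by simp [jp]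
      rw [e1, add_neg_cancel_right]
      calc jp (s / 2) a * ENNReal.ofReal |(a : ℝ)| ≤ jp (s / 2) a * jp s a := by gcongr
        _ = 1 * (jp (s / 2) a * jp (s / 2) a * jp (s / 2) (-a) *
            (jp (-(s / 2 + 1 / 8)) (a + -a) * jp (-(s / 2 + 1 / 8)) (a + -a))) := by
            rw [e4, jp_neg, show jp s a = jp (s / 2) a * jp (s / 2) a by rw [jp_mul, add_halves]]
            ring
        _ ≤ _ := by
            refine mul_le_mul' e3 (le_trans ?_ le_add_self)
            gcongr
            rw [add_assoc]
            exact le_self_add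
    · simp [kap, hr, hab]
  have hne := hr
  rw [res, ← ne_eq, mul_ne_zero_iff, mul_ne_zero_iff] at hne
  obtain ⟨⟨hx, hy⟩, hz⟩ := hne
  have hk : kap a b c = |((a + b + c : ℤ) : ℝ)| * |(res a b c : ℝ)| ^ (-(1 / 2) : ℝ) := by
    simp only [kap, ne_eq, hr, not_false_eq_true, if_true]
  have hP : ∀ m x y z : ℤ, x ≠ 0 → y ≠ 0 → z ≠ 0 → res a b c = x * y * z →
      |a + b + c| ≤ 10 * |m| → |a + b + c| ≤ 10 * |y| → |a + b + c| ≤ 10 * |z| →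
      jp (s / 2) (a + b + c) * ENNReal.ofReal (kap a b c)
        ≤ ENNReal.ofReal (20 * 100 ^ s) * (jp (s / 2) m * jp (-(1 / 4)) x) := by
    intro m x y z hx hy hz he hm h2 h3
    rw [hk, jp, jp, jp, ← ENNReal.ofReal_mul (by positivity), ← ENNReal.ofReal_mul (by positivity),
      ← ENNReal.ofReal_mul (by positivity), he]
    refine ENNReal.ofReal_le_ofReal ((kernel_le_of_high (by linarith) hx hy hz hm h2 h3).trans ?_)
    rw [mul_assoc]
    gcongr
  have hQ : ∀ x y z : ℤ, x ≠ 0 → y ≠ 0 → res a b c = x * y * z →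
      |a + b + c| ≤ 2 * |a| → |a + b + c| ≤ 2 * |b| → |a + b + c| ≤ 2 * |c| →
      |x| ≤ |a + b + c| → |y| ≤ |a + b + c| → |a + b + c| ≤ |z| →
      jp (s / 2) (a + b + c) * ENNReal.ofReal (kap a b c)
        ≤ ENNReal.ofReal (20 * 100 ^ s) * (jp (s / 2) a * jp (s / 2) b * jp (s / 2) c *
          (jp (-(s / 2 + 1 / 8)) x * jp (-(s / 2 + 1 / 8)) y)) := by
    intro x y z hx hy he h1 h2 h3 h4 h5 h6
    rw [hk, jp, jp, jp, jp, jp, jp, ← ENNReal.ofReal_mul (by positivity),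
      ← ENNReal.ofReal_mul (by positivity), ← ENNReal.ofReal_mul (by positivity),
      ← ENNReal.ofReal_mul (by positivity), ← ENNReal.ofReal_mul (by positivity),
      ← ENNReal.ofReal_mul (by positivity), he]
    refine ENNReal.ofReal_le_ofReal
      ((kernel_le_of_all_high (by linarith) hx hy h1 h2 h3 h4 h5 h6).trans ?_)
    rw [← mul_assoc 4]
    gcongr
    norm_num
  rcases high_frequency_cases a b c with h | h | h | ⟨⟨h1, h2, h3⟩, h | h | h⟩
  · refine (hP a (b + c) (a + c) (a + b) hx hy hz rfl h.1 h.2.1 h.2.2).trans ?_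
    gcongr
    rw [add_assoc, add_assoc]
    exact le_self_add
  · refine (hP b (a + c) (b + c) (a + b) hy hx hz (by rw [res]; ring) h.1 h.2.1 h.2.2).trans ?_
    gcongr
    exact le_add_self.trans (le_self_add.trans le_self_add)
  · refine (hP c (a + b) (b + c) (a + c) hz hx hy (by rw [res]; ring) h.1 h.2.1 h.2.2).trans ?_
    gcongr
    exact le_add_self.trans le_self_add
  · refine (hQ (b + c) (a + c) (a + b) hx hy rfl h1 h2 h3 h.1 h.2.1 h.2.2).trans ?_
    gcongr
    refine le_trans ?_ le_add_self
    gcongr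
    rw [add_assoc]
    exact le_self_add
  · refine (hQ (b + c) (a + b) (a + c) hx hz (by rw [res]; ring) h1 h2 h3 h.1 h.2.1 h.2.2).trans ?_
    gcongr
    refine le_trans ?_ le_add_self
    gcongr
    exact le_add_self.trans le_self_add
  · refine (hQ (a + c) (a + b) (b + c) hy hz (by rw [res]; ring) h1 h2 h3 h.1 h.2.1 h.2.2).trans ?_
    gcongr
    refine le_trans ?_ le_add_self
    gcongr
    exact le_add_self

/-! ### The trilinear estimate in `ℱL^{s,p}` -/

theorem lpN_prod {ι κ : Type*} [MeasurableSpace ι] [DiscreteMeasurableSpace ι]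
    [MeasurableSpace κ] [DiscreteMeasurableSpace κ] [DiscreteMeasurableSpace (ι × κ)]
    {p : ℝ≥0∞} (h0 : p ≠ 0) (F : ι × κ → ℝ≥0∞) :
    lpN p F = lpN p fun i => lpN p fun j => F (i, j) := by
  by_cases ht : p = ⊤
  · subst ht
    simp only [lpN_top]
    exact iSup_prod
  · have hr := ENNReal.toReal_pos h0 ht
    rw [lpN_eq_tsum h0 ht, lpN_eq_tsum h0 ht, ENNReal.tsum_prod']
    simp_rw [lpN_rpow h0 ht]

theorem lpN_mul_prod {ι κ : Type*} [MeasurableSpace ι] [DiscreteMeasurableSpace ι]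
    [MeasurableSpace κ] [DiscreteMeasurableSpace κ] [DiscreteMeasurableSpace (ι × κ)]
    {p : ℝ≥0∞} (h0 : p ≠ 0) (A : ι → ℝ≥0∞) (B : κ → ℝ≥0∞) :
    lpN p (fun q : ι × κ => A q.1 * B q.2) = lpN p A * lpN p B := by
  rw [lpN_prod h0]
  simp_rw [lpN_const_mul h0, mul_comm _ (lpN p B)]
  rw [lpN_const_mul h0]

/-- The trilinear form with multiplier `kap`. -/
noncomputable def tri (A B D : ℤ → ℝ≥0∞) (n : ℤ) : ℝ≥0∞ :=
  ∑' q : ℤ × ℤ, ENNReal.ofReal (kap q.1 q.2 (n - q.1 - q.2)) * (A q.1 * B q.2 * D (n - q.1 - q.2))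

/-- The involution `(n₁, n₂) ↦ (n₃, n₂)`. -/
def swap13 (n : ℤ) : ℤ × ℤ ≃ ℤ × ℤ where
  toFun q := (n - q.1 - q.2, q.2)
  invFun q := (n - q.1 - q.2, q.2)
  left_inv q := by ext <;> simp; ring
  right_inv q := by ext <;> simp; ring

/-- The involution `(n₁, n₂) ↦ (n₁, n₃)`. -/
def swap23 (n : ℤ) : ℤ × ℤ ≃ ℤ × ℤ where
  toFun q := (q.1, n - q.1 - q.2)
  invFun q := (q.1, n - q.1 - q.2)
  left_inv q := by ext <;> simp
  right_inv q := by ext <;> simp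

/-- The part of `tri` in which the first frequency carries the weight. -/
noncomputable def triHigh (A B D : ℤ → ℝ≥0∞) (n : ℤ) : ℝ≥0∞ :=
  ∑' q : ℤ × ℤ, jp (-(1 / 4)) (n - q.1) * (A q.1 * B q.2 * D (n - q.1 - q.2))

/-- As a function of `n` this is the convolution of `A` with the sequence `jp (-(1/4)) · (B * D)`.
The bilinear bound puts that sequence in `ℓ^1`, and Young's inequality concludes. -/
theorem lpN_triHigh_le {p : ℝ≥0∞} (hp : 1 ≤ p) {α : ℝ} (hα : 0 ≤ α) (A B D : ℤ → ℝ≥0∞) :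
    lpN p (triHigh A B D) ≤ (2 * ∑' m, jp (-(1 / 4 + α)) m) * hN α B * hN α D * lpN p A := by
  set k : ℤ → ℝ≥0∞ := fun m => jp (-(1 / 4)) m * ∑' y, B y * D (m - y) with hk
  have h1 : triHigh A B D = fun n => ∑' m, k m * A (n - m) := by
    ext n
    rw [triHigh, ENNReal.tsum_prod', ← (Equiv.subLeft n).tsum_eq]
    refine tsum_congr fun m => ?_
    simp only [Equiv.subLeft_apply, sub_sub_cancel, hk]
    rw [mul_right_comm, ← ENNReal.tsum_mul_left]
    exact tsum_congr fun y => by ring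
  have h2 : ∑' m, k m ≤ (2 * ∑' m, jp (-(1 / 4 + α)) m) * hN α B * hN α D := by
    refine le_trans (le_of_eq ?_) (tsum_jp_bilinear_le hα B D)
    simp only [hk]
    simp_rw [← ENNReal.tsum_mul_left]
    rw [ENNReal.tsum_comm, ENNReal.tsum_prod']
    refine tsum_congr fun x => ?_
    rw [← (Equiv.addLeft x).tsum_eq]
    refine tsum_congr fun y => ?_
    simp only [Equiv.coe_addLeft, add_sub_cancel_left]
    ring
  rw [h1]
  exact (lpN_conv_le hp k A).trans (by gcongr)

/-- The part of `tri` in which all three frequencies carry the weight. -/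
noncomputable def triAll (σ : ℝ) (A B D : ℤ → ℝ≥0∞) (n : ℤ) : ℝ≥0∞ :=
  ∑' q : ℤ × ℤ, jp (-σ) (n - q.1) * jp (-σ) (n - q.2) * (A q.1 * B q.2 * D (n - q.1 - q.2))

/-- For fixed `n`, Hölder's inequality over frequency pairs separates the weights, whose `ℓ^{p'}`
norm factorises and is translation invariant. The `ℓ^p` norm over all frequencies is then that of a
tensor product, after a bijective change of variables. -/
theorem lpN_triAll_le {p p' : ℝ≥0∞} (hpp' : p⁻¹ + p'⁻¹ = 1) (σ : ℝ) (A B D : ℤ → ℝ≥0∞) :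
    lpN p (triAll σ A B D) ≤ lpN p' (jp (-σ)) ^ 2 * (lpN p A * lpN p B * lpN p D) := by
  have hp : p ≠ 0 := by rintro rfl; simp at hpp'
  have hp' : p' ≠ 0 := by rintro rfl; simp at hpp'
  have h1 : ∀ n, triAll σ A B D n ≤ lpN p' (jp (-σ)) ^ 2 *
      lpN p (fun q : ℤ × ℤ => A q.1 * B q.2 * D (n - q.1 - q.2)) := by
    intro n
    refine (tsum_mul_le_lpN (by rwa [add_comm]) _ _).trans_eq ?_
    rw [lpN_mul_prod hp' (fun m => jp (-σ) (n - m)) fun m => jp (-σ) (n - m), sq]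
    congr 2 <;> exact lpN_comp_equiv hp' (Equiv.subLeft n) (jp (-σ))
  refine (lpN_mono h1).trans ?_
  rw [lpN_const_mul hp]
  gcongr
  let e : ℤ × (ℤ × ℤ) ≃ ℤ × (ℤ × ℤ) :=
    { toFun := fun x => (x.1 - x.2.1 - x.2.2, x.2)
      invFun := fun x => (x.1 + x.2.1 + x.2.2, x.2)
      left_inv := fun x => by ext <;> simp; ring
      right_inv := fun x => by ext <;> simp; ring }
  rw [← lpN_prod hp fun x : ℤ × (ℤ × ℤ) => A x.2.1 * B x.2.2 * D (x.1 - x.2.1 - x.2.2)]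
  have h2 := lpN_comp_equiv hp e fun x => D x.1 * (A x.2.1 * B x.2.2)
  rw [lpN_mul_prod hp D fun q : ℤ × ℤ => A q.1 * B q.2, lpN_mul_prod hp] at h2
  rw [mul_comm _ (lpN p D), ← h2]
  exact (lpN_mono fun x => by simp [e, mul_comm])

/-- The pointwise kernel bound is summed over frequency pairs. The involutions `swap13`, `swap23`
and the exchange of the two indices bring every term to `triHigh` or `triAll` with permuted
arguments. -/
theorem weight_mul_tri_le {s : ℝ} (hs : 1 / 2 ≤ s) (A B D : ℤ → ℝ≥0∞) (n : ℤ) :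
    jp (s / 2) n * tri A B D n ≤ ENNReal.ofReal (20 * 100 ^ s) *
      (triHigh (fun n => jp (s / 2) n * A n) B D n + triHigh (fun n => jp (s / 2) n * B n) A D n
        + triHigh (fun n => jp (s / 2) n * D n) B A n
        + (triAll (s / 2 + 1 / 8) (fun n => jp (s / 2) n * A n) (fun n => jp (s / 2) n * B n)
            (fun n => jp (s / 2) n * D n) n
          + triAll (s / 2 + 1 / 8) (fun n => jp (s / 2) n * A n) (fun n => jp (s / 2) n * D n)
            (fun n => jp (s / 2) n * B n) n
          + triAll (s / 2 + 1 / 8) (fun n => jp (s / 2) n * D n) (fun n => jp (s / 2) n * B n)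
            (fun n => jp (s / 2) n * A n) n)) := by
  rw [tri, ← ENNReal.tsum_mul_left]
  have e2 : triHigh (fun n => jp (s / 2) n * B n) A D n = ∑' q : ℤ × ℤ,
      jp (s / 2) q.2 * jp (-(1 / 4)) (n - q.2) * (A q.1 * B q.2 * D (n - q.1 - q.2)) := by
    rw [triHigh, ← (Equiv.prodComm ℤ ℤ).tsum_eq]
    refine tsum_congr fun q => ?_
    simp only [Equiv.prodComm_apply, Prod.fst_swap, Prod.snd_swap]
    rw [show n - q.2 - q.1 = n - q.1 - q.2 by ring]
    ring
  have e3 : triHigh (fun n => jp (s / 2) n * D n) B A n = ∑' q : ℤ × ℤ,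
      jp (s / 2) (n - q.1 - q.2) * jp (-(1 / 4)) (n - (n - q.1 - q.2))
        * (A q.1 * B q.2 * D (n - q.1 - q.2)) := by
    rw [triHigh, ← (swap13 n).tsum_eq]
    refine tsum_congr fun q => ?_
    simp only [swap13, Equiv.coe_fn_mk]
    rw [show n - (n - q.1 - q.2) - q.2 = q.1 by ring]
    ring
  have e5 : triAll (s / 2 + 1 / 8) (fun n => jp (s / 2) n * A n) (fun n => jp (s / 2) n * D n)
      (fun n => jp (s / 2) n * B n) n = ∑' q : ℤ × ℤ,
      jp (s / 2) q.1 * jp (s / 2) q.2 * jp (s / 2) (n - q.1 - q.2) *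
        (jp (-(s / 2 + 1 / 8)) (n - q.1) * jp (-(s / 2 + 1 / 8)) (n - (n - q.1 - q.2)))
        * (A q.1 * B q.2 * D (n - q.1 - q.2)) := by
    rw [triAll, ← (swap23 n).tsum_eq]
    refine tsum_congr fun q => ?_
    simp only [swap23, Equiv.coe_fn_mk]
    rw [show n - q.1 - (n - q.1 - q.2) = q.2 by ring]
    ring
  have e6 : triAll (s / 2 + 1 / 8) (fun n => jp (s / 2) n * D n) (fun n => jp (s / 2) n * B n)
      (fun n => jp (s / 2) n * A n) n = ∑' q : ℤ × ℤ,
      jp (s / 2) q.1 * jp (s / 2) q.2 * jp (s / 2) (n - q.1 - q.2) *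
        (jp (-(s / 2 + 1 / 8)) (n - q.2) * jp (-(s / 2 + 1 / 8)) (n - (n - q.1 - q.2)))
        * (A q.1 * B q.2 * D (n - q.1 - q.2)) := by
    rw [triAll, ← (swap13 n).tsum_eq]
    refine tsum_congr fun q => ?_
    simp only [swap13, Equiv.coe_fn_mk]
    rw [show n - (n - q.1 - q.2) - q.2 = q.1 by ring]
    ring
  rw [e2, e3, e5, e6, triHigh, triAll]
  simp only [← ENNReal.tsum_add, ← ENNReal.tsum_mul_left]
  refine ENNReal.tsum_le_tsum fun q => ?_
  have key := weight_mul_kap_le hs q.1 q.2 (n - q.1 - q.2)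
  rw [show q.1 + q.2 + (n - q.1 - q.2) = n by ring, show q.2 + (n - q.1 - q.2) = n - q.1 by ring,
    show q.1 + (n - q.1 - q.2) = n - q.2 by ring] at key
  rw [show n - (n - q.1 - q.2) = q.1 + q.2 by ring, ← mul_assoc]
  refine (mul_le_mul_left key _).trans (le_of_eq ?_)
  ring

/-- The trilinear estimate in `ℱL^{s,p}`. -/
theorem exists_lpN_tri_le {s : ℝ} {p p' : ℝ≥0∞} (hs : 1 / 2 ≤ s) (hp : 1 ≤ p)
    (hpp' : p⁻¹ + p'⁻¹ = 1) (hsp : 1 < p' * ENNReal.ofReal (s + 1 / 4)) :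
    ∃ C : ℝ≥0∞, C ≠ ⊤ ∧ ∀ A B D : ℤ → ℝ≥0∞,
      lpN p (fun n => jp (s / 2) n * tri A B D n) ≤ C * (lpN p (fun n => jp (s / 2) n * A n) *
        lpN p (fun n => jp (s / 2) n * B n) * lpN p (fun n => jp (s / 2) n * D n)) := by
  have h0 : p ≠ 0 := (zero_lt_one.trans_le hp).ne'
  obtain ⟨α, hα, C₁, hC₁, hN_le⟩ := exists_hN_le hs hp hpp' hsp
  set S := 2 * ∑' m, jp (-(1 / 4 + α)) m with hS
  set L := lpN p' (jp (-(s / 2 + 1 / 8))) ^ 2 with hL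
  have hSt : S ≠ ⊤ := ENNReal.mul_ne_top (by simp) (tsum_jp_ne_top (by linarith))
  -- Since `2(s/2 + 1/8) = s + 1/4`, finiteness of this norm is exactly the hypothesis `p'(s + 1/4)
  -- > 1`.
  have hLt : L ≠ ⊤ := by
    refine ENNReal.pow_ne_top ?_
    have := lpN_jp_ne_top hsp
    convert this using 3
    ring
  have hH : ∀ A B D : ℤ → ℝ≥0∞, lpN p (triHigh (fun n => jp (s / 2) n * A n) B D) ≤
      S * C₁ ^ 2 * (lpN p (fun n => jp (s / 2) n * A n) *
        lpN p (fun n => jp (s / 2) n * B n) * lpN p (fun n => jp (s / 2) n * D n)) := by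
    intro A B D
    calc _ ≤ S * hN α B * hN α D * lpN p (fun n => jp (s / 2) n * A n) :=
          lpN_triHigh_le hp (by linarith) _ B D
      _ ≤ S * (C₁ * lpN p (fun n => jp (s / 2) n * B n)) *
          (C₁ * lpN p (fun n => jp (s / 2) n * D n)) * lpN p (fun n => jp (s / 2) n * A n) := by
          gcongr <;> exact hN_le _
      _ = _ := by ring
  refine ⟨ENNReal.ofReal (20 * 100 ^ s) * (3 * (S * C₁ ^ 2) + 3 * L), ?_, fun A B D => ?_⟩
  · finiteness
  refine (lpN_mono (weight_mul_tri_le hs A B D)).trans ?_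
  rw [lpN_const_mul h0, mul_assoc]
  gcongr
  calc _ ≤ S * C₁ ^ 2 * (lpN p (fun n => jp (s / 2) n * A n) *
        lpN p (fun n => jp (s / 2) n * B n) * lpN p (fun n => jp (s / 2) n * D n))
      + S * C₁ ^ 2 * (lpN p (fun n => jp (s / 2) n * B n) *
        lpN p (fun n => jp (s / 2) n * A n) * lpN p (fun n => jp (s / 2) n * D n))
      + S * C₁ ^ 2 * (lpN p (fun n => jp (s / 2) n * D n) *
        lpN p (fun n => jp (s / 2) n * B n) * lpN p (fun n => jp (s / 2) n * A n))
      + (L * (lpN p (fun n => jp (s / 2) n * A n) *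
          lpN p (fun n => jp (s / 2) n * B n) * lpN p (fun n => jp (s / 2) n * D n))
        + L * (lpN p (fun n => jp (s / 2) n * A n) *
          lpN p (fun n => jp (s / 2) n * D n) * lpN p (fun n => jp (s / 2) n * B n))
        + L * (lpN p (fun n => jp (s / 2) n * D n) *
          lpN p (fun n => jp (s / 2) n * B n) * lpN p (fun n => jp (s / 2) n * A n))) := by
        refine (lpN_add_le hp _ _).trans (add_le_add ?_ ?_)
        · refine (lpN_add_le hp _ _).trans (add_le_add ?_ (hH D B A))
          exact (lpN_add_le hp _ _).trans (add_le_add (hH A B D) (hH B A D))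
        · refine (lpN_add_le hp _ _).trans (add_le_add ?_ (lpN_triAll_le hpp' _ _ _ _))
          exact (lpN_add_le hp _ _).trans
            (add_le_add (lpN_triAll_le hpp' _ _ _ _) (lpN_triAll_le hpp' _ _ _ _))
    _ = _ := by ring

/-! ### Hölder-1/2 norms in time and oscillatory integrals -/

/-- The rescaled Hölder-`1/2` norm on `[0,T]`. -/
noncomputable def hn (T : ℝ) (f : ℝ → ℂ) : ℝ≥0∞ :=
  (⨆ t ∈ Set.Icc 0 T, ‖f t‖ₑ) ⊔ ⨆ t ∈ Set.Icc 0 T, ⨆ t' ∈ Set.Icc 0 T,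
    ‖f t - f t'‖ₑ * ENNReal.ofReal (√T) / ENNReal.ofReal (√|t - t'|)

theorem hn_le_iff {T : ℝ} {f : ℝ → ℂ} {A : ℝ≥0∞} :
    hn T f ≤ A ↔ (∀ t ∈ Set.Icc 0 T, ‖f t‖ₑ ≤ A) ∧ ∀ t ∈ Set.Icc 0 T, ∀ t' ∈ Set.Icc 0 T,
      ‖f t - f t'‖ₑ * ENNReal.ofReal (√T) ≤ A * ENNReal.ofReal (√|t - t'|) := by
  rw [hn, sup_le_iff, iSup₂_le_iff]
  refine and_congr_right fun _ => ?_
  simp only [iSup_le_iff]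
  refine forall₄_congr fun t ht t' ht' => ?_
  by_cases h : t = t'
  · subst h; simp
  · have : 0 < √|t - t'| := Real.sqrt_pos.2 (abs_pos.2 (sub_ne_zero.2 h))
    exact ENNReal.div_le_iff (by simpa using this) ENNReal.ofReal_ne_top

theorem enorm_le_hn {T : ℝ} (f : ℝ → ℂ) {t : ℝ} (ht : t ∈ Set.Icc 0 T) : ‖f t‖ₑ ≤ hn T f :=
  (hn_le_iff.1 le_rfl).1 t ht

theorem enorm_sub_le_hn {T : ℝ} (f : ℝ → ℂ) {t t' : ℝ} (ht : t ∈ Set.Icc 0 T)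
    (ht' : t' ∈ Set.Icc 0 T) :
    ‖f t - f t'‖ₑ * ENNReal.ofReal (√T) ≤ hn T f * ENNReal.ofReal (√|t - t'|) :=
  (hn_le_iff.1 le_rfl).2 t ht t' ht'

theorem hn_le_ofReal {T A : ℝ} {f : ℝ → ℂ} (hA : 0 ≤ A)
    (h1 : ∀ t ∈ Set.Icc 0 T, ‖f t‖ ≤ A)
    (h2 : ∀ t ∈ Set.Icc 0 T, ∀ t' ∈ Set.Icc 0 T, t' ≤ t → ‖f t - f t'‖ * √T ≤ A * √(t - t')) :
    hn T f ≤ ENNReal.ofReal A := by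
  have h3 : ∀ t ∈ Set.Icc 0 T, ∀ t' ∈ Set.Icc 0 T, ‖f t - f t'‖ * √T ≤ A * √|t - t'| := by
    intro t ht t' ht'
    rcases le_total t' t with h | h
    · rw [abs_of_nonneg (by linarith)]; exact h2 t ht t' ht' h
    · rw [norm_sub_rev, abs_sub_comm, abs_of_nonneg (by linarith)]; exact h2 t' ht' t ht h
  refine hn_le_iff.2 ⟨fun t ht => ?_, fun t ht t' ht' => ?_⟩
  · rw [← ofReal_norm]; exact ENNReal.ofReal_le_ofReal (h1 t ht)
  · rw [← ofReal_norm, ← ENNReal.ofReal_mul (norm_nonneg _), ← ENNReal.ofReal_mul hA]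
    exact ENNReal.ofReal_le_ofReal (h3 t ht t' ht')

theorem norm_le_of_hn_le {T A : ℝ} {f : ℝ → ℂ} (hA : 0 ≤ A) (h : hn T f ≤ ENNReal.ofReal A) :
    (∀ t ∈ Set.Icc 0 T, ‖f t‖ ≤ A) ∧
      ∀ t ∈ Set.Icc 0 T, ∀ t' ∈ Set.Icc 0 T, ‖f t - f t'‖ * √T ≤ A * √|t - t'| := by
  obtain ⟨h1, h2⟩ := hn_le_iff.1 h
  refine ⟨fun t ht => ?_, fun t ht t' ht' => ?_⟩
  · have := h1 t ht
    rw [← ofReal_norm] at this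
    exact (ENNReal.ofReal_le_ofReal_iff hA).1 this
  · have := h2 t ht t' ht'
    rw [← ofReal_norm, ← ENNReal.ofReal_mul (norm_nonneg _), ← ENNReal.ofReal_mul hA] at this
    exact (ENNReal.ofReal_le_ofReal_iff (by positivity)).1 this

theorem hn_congr {T : ℝ} {f g : ℝ → ℂ} (h : ∀ t ∈ Set.Icc 0 T, f t = g t) : hn T f = hn T g := by
  have : ∀ {f g : ℝ → ℂ}, (∀ t ∈ Set.Icc 0 T, f t = g t) → hn T f ≤ hn T g := by
    intro f g h
    refine hn_le_iff.2 ⟨fun t ht => ?_, fun t ht t' ht' => ?_⟩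
    · rw [h t ht]; exact enorm_le_hn g ht
    · rw [h t ht, h t' ht']; exact enorm_sub_le_hn g ht ht'
  exact le_antisymm (this h) (this fun t ht => (h t ht).symm)

theorem hn_const_le (T : ℝ) (c : ℂ) : hn T (fun _ => c) ≤ ‖c‖ₑ :=
  hn_le_iff.2 ⟨fun _ _ => le_rfl, fun _ _ _ _ => by simp⟩

theorem hn_add_le (T : ℝ) (f g : ℝ → ℂ) : hn T (fun t => f t + g t) ≤ hn T f + hn T g := by
  refine hn_le_iff.2 ⟨fun t ht => ?_, fun t ht t' ht' => ?_⟩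
  · exact (enorm_add_le _ _).trans (add_le_add (enorm_le_hn f ht) (enorm_le_hn g ht))
  · rw [add_sub_add_comm, add_mul]
    calc _ ≤ (‖f t - f t'‖ₑ + ‖g t - g t'‖ₑ) * ENNReal.ofReal (√T) := by
          gcongr; exact enorm_add_le _ _
      _ ≤ _ := by
          rw [add_mul]
          exact add_le_add (enorm_sub_le_hn f ht ht') (enorm_sub_le_hn g ht ht')

theorem hn_const_mul_le (T : ℝ) (c : ℂ) (f : ℝ → ℂ) : hn T (fun t => c * f t) ≤ ‖c‖ₑ * hn T f := by
  refine hn_le_iff.2 ⟨fun t ht => ?_, fun t ht t' ht' => ?_⟩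
  · rw [enorm_mul]; gcongr; exact enorm_le_hn f ht
  · rw [← mul_sub, enorm_mul, mul_assoc, mul_assoc]
    exact mul_le_mul' le_rfl (enorm_sub_le_hn f ht ht')

theorem hn_mul_le (T : ℝ) (f g : ℝ → ℂ) : hn T (fun t => f t * g t) ≤ 2 * (hn T f * hn T g) := by
  refine hn_le_iff.2 ⟨fun t ht => ?_, fun t ht t' ht' => ?_⟩
  · rw [enorm_mul]
    refine (mul_le_mul' (enorm_le_hn f ht) (enorm_le_hn g ht)).trans ?_
    exact le_mul_of_one_le_left zero_le one_le_two
  · rw [show f t * g t - f t' * g t' = f t * (g t - g t') + (f t - f t') * g t' by ring]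
    calc _ ≤ (‖f t‖ₑ * ‖g t - g t'‖ₑ + ‖f t - f t'‖ₑ * ‖g t'‖ₑ) * ENNReal.ofReal (√T) := by
          gcongr
          rw [← enorm_mul, ← enorm_mul]
          exact enorm_add_le _ _
      _ = ‖f t‖ₑ * (‖g t - g t'‖ₑ * ENNReal.ofReal (√T))
          + ‖f t - f t'‖ₑ * ENNReal.ofReal (√T) * ‖g t'‖ₑ := by ring
      _ ≤ hn T f * (hn T g * ENNReal.ofReal (√|t - t'|))
          + hn T f * ENNReal.ofReal (√|t - t'|) * hn T g :=
          add_le_add (mul_le_mul' (enorm_le_hn f ht) (enorm_sub_le_hn g ht ht'))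
            (mul_le_mul' (enorm_sub_le_hn f ht ht') (enorm_le_hn g ht'))
      _ = _ := by ring

theorem hn_tsum_le {T : ℝ} {ι : Type*} (f : ι → ℝ → ℂ)
    (hf : ∑' i, hn T (f i) ≠ ⊤) :
    (∀ t ∈ Set.Icc 0 T, Summable fun i => f i t) ∧
      hn T (fun t => ∑' i, f i t) ≤ ∑' i, hn T (f i) := by
  have hs : ∀ t ∈ Set.Icc 0 T, Summable fun i => f i t := fun t ht =>
    Summable.of_enorm (ne_top_of_le_ne_top hf
      (ENNReal.tsum_le_tsum fun i => enorm_le_hn (f i) ht))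
  refine ⟨hs, hn_le_iff.2 ⟨fun t ht => ?_, fun t ht t' ht' => ?_⟩⟩
  · exact (enorm_tsum_le_tsum_enorm).trans (ENNReal.tsum_le_tsum fun i => enorm_le_hn (f i) ht)
  · rw [← (hs t ht).tsum_sub (hs t' ht'), ← ENNReal.tsum_mul_right]
    refine (mul_le_mul_left enorm_tsum_le_tsum_enorm _).trans ?_
    rw [← ENNReal.tsum_mul_right]
    exact ENNReal.tsum_le_tsum fun i => enorm_sub_le_hn (f i) ht ht'

theorem hn_le_of_tendsto {T : ℝ} {f : ℝ → ℂ} {F : ℕ → ℝ → ℂ}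
    (h : ∀ t ∈ Set.Icc 0 T, Tendsto (fun k => F k t) atTop (𝓝 (f t))) :
    hn T f ≤ liminf (fun k => hn T (F k)) atTop := by
  refine hn_le_iff.2 ⟨fun t ht => ?_, fun t ht t' ht' => ?_⟩
  · rw [← (h t ht).enorm.liminf_eq]
    exact liminf_le_liminf (Eventually.of_forall fun k => enorm_le_hn (F k) ht)
  · by_cases hc : √|t - t'| = 0
    · have : t = t' := by
        rw [Real.sqrt_eq_zero (abs_nonneg _)] at hc
        exact sub_eq_zero.1 (abs_eq_zero.1 hc)
      simp [this]
    · have hc0 : ENNReal.ofReal (√|t - t'|) ≠ 0 := by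
        simpa using (Real.sqrt_nonneg _).lt_of_ne' hc
      rw [← ENNReal.div_le_iff hc0 ENNReal.ofReal_ne_top]
      have h1 : Tendsto (fun k => ‖F k t - F k t'‖ₑ * ENNReal.ofReal (√T)
          / ENNReal.ofReal (√|t - t'|)) atTop (𝓝 (‖f t - f t'‖ₑ * ENNReal.ofReal (√T)
          / ENNReal.ofReal (√|t - t'|))) := by
        refine ENNReal.Tendsto.div_const (ENNReal.Tendsto.mul_const
          ((h t ht).sub (h t' ht')).enorm (Or.inr ENNReal.ofReal_ne_top)) (Or.inr hc0)
      rw [← h1.liminf_eq]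
      refine liminf_le_liminf (Eventually.of_forall fun k => ?_)
      exact (ENNReal.div_le_iff hc0 ENNReal.ofReal_ne_top).2 (enorm_sub_le_hn (F k) ht ht')

theorem continuousOn_of_hn_ne_top {T : ℝ} (hT : 0 < T) {f : ℝ → ℂ} (h : hn T f ≠ ⊤) :
    ContinuousOn f (Set.Icc 0 T) := by
  have h1 := (norm_le_of_hn_le ENNReal.toReal_nonneg (ENNReal.ofReal_toReal h).ge).2
  intro t ht
  have hT' := Real.sqrt_pos.2 hT
  rw [ContinuousWithinAt, tendsto_iff_norm_sub_tendsto_zero]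
  have h2 : Tendsto (fun τ => (hn T f).toReal * √|τ - t| / √T) (𝓝[Set.Icc 0 T] t) (𝓝 0) := by
    have : ContinuousAt (fun τ : ℝ => (hn T f).toReal * √|τ - t| / √T) t := by fun_prop
    have h3 := this.tendsto
    simp only [sub_self, abs_zero, Real.sqrt_zero, mul_zero, zero_div] at h3
    exact h3.mono_left nhdsWithin_le_nhds
  refine squeeze_zero' (Eventually.of_forall fun _ => norm_nonneg _) ?_ h2
  filter_upwards [self_mem_nhdsWithin] with τ hτ
  rw [le_div_iff₀ hT']
  exact h1 τ hτ t ht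

/-- A bound by `B √(t - t')` on every subinterval controls both parts of the norm by `B √T`; this
`√T` is the source of smallness in the contraction. -/
theorem hn_integral_le {T B : ℝ} (hB : 0 ≤ B) {g : ℝ → ℂ} (hg : ContinuousOn g (Set.Icc 0 T))
    (h : ∀ t' t, 0 ≤ t' → t' ≤ t → t ≤ T → ‖∫ τ in t'..t, g τ‖ ≤ B * √(t - t')) :
    hn T (fun t => ∫ τ in (0 : ℝ)..t, g τ) ≤ ENNReal.ofReal (B * √T) := by
  have hi : ∀ t ∈ Set.Icc 0 T, IntervalIntegrable g volume 0 t := fun t ht =>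
    (hg.mono (by rw [Set.uIcc_of_le ht.1]; exact Set.Icc_subset_Icc_right ht.2)).intervalIntegrable
  refine hn_le_ofReal (by positivity) (fun t ht => ?_) fun t ht t' ht' htt => ?_
  · refine (h 0 t le_rfl ht.1 ht.2).trans ?_
    gcongr
    linarith [ht.2]
  · rw [intervalIntegral.integral_interval_sub_left (hi t ht) (hi t' ht')]
    calc _ ≤ B * √(t - t') * √T := by
          gcongr; exact h t' t ht'.1 htt ht.2
      _ = _ := by ring

theorem norm_exp_phase (Φ t : ℝ) : ‖Complex.exp (Complex.I * Φ * t)‖ = 1 := by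
  rw [show Complex.I * Φ * t = ((Φ * t : ℝ) : ℂ) * Complex.I by push_cast; ring]
  exact Complex.norm_exp_ofReal_mul_I _

/-- A shift by the half period `δ = π/|Φ|` reverses the sign of the exponential. Twice the integral
is therefore an integral of `f(t) - f(t + δ)`, of size `√δ` by the Hölder bound, plus two boundary
integrals over intervals of length `δ`. -/
theorem norm_integral_phase_le {T A Φ : ℝ} (hT : 0 < T) (hΦ : Φ ≠ 0) (hA : 0 ≤ A) {f : ℝ → ℂ}
    (hf : ContinuousOn f (Set.Icc 0 T)) (h1 : ∀ t ∈ Set.Icc 0 T, ‖f t‖ ≤ A)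
    (h2 : ∀ t ∈ Set.Icc 0 T, ∀ t' ∈ Set.Icc 0 T, ‖f t - f t'‖ * √T ≤ A * √|t - t'|)
    {a b : ℝ} (ha : 0 ≤ a) (hab : a ≤ b) (hb : b ≤ T) :
    ‖∫ t in a..b, Complex.exp (Complex.I * Φ * t) * f t‖
      ≤ 2 * A * √(Real.pi / |Φ|) * √(b - a) := by
  set δ := Real.pi / |Φ| with hδ
  have hδ0 : 0 < δ := div_pos Real.pi_pos (abs_pos.2 hΦ)
  set g : ℝ → ℂ := fun t => Complex.exp (Complex.I * Φ * t) * f t with hg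
  have hgc : ContinuousOn g (Set.Icc 0 T) := by
    refine ContinuousOn.mul (Continuous.continuousOn (by fun_prop)) hf
  have hgn : ∀ t ∈ Set.Icc 0 T, ‖g t‖ ≤ A := fun t ht => by
    rw [hg]; simp only [norm_mul, norm_exp_phase, one_mul]; exact h1 t ht
  have htriv : ∀ c d, 0 ≤ c → c ≤ d → d ≤ T → ‖∫ t in c..d, g t‖ ≤ A * (d - c) := by
    intro c d hc hcd hd
    have := intervalIntegral.norm_integral_le_of_norm_le_const (a := c) (b := d) (C := A) (f := g)
      (fun t ht => by
        rw [Set.uIoc_of_le hcd] at ht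
        exact hgn t ⟨hc.trans ht.1.le, ht.2.trans hd⟩)
    rwa [abs_of_nonneg (by linarith)] at this
  have hint : ∀ c d, 0 ≤ c → c ≤ d → d ≤ T → IntervalIntegrable g volume c d := by
    intro c d hc hcd hd
    refine (hgc.mono ?_).intervalIntegrable
    rw [Set.uIcc_of_le hcd]
    exact Set.Icc_subset_Icc hc hd
  have hsq : ∀ x y : ℝ, 0 ≤ x → x ≤ y → x ≤ √x * √y := by
    intro x y hx hxy
    calc x = √x * √x := (Real.mul_self_sqrt hx).symm
      _ ≤ √x * √y := by gcongr
  -- On intervals shorter than the half period the trivial bound suffices, because `b - a ≤ √δ √(b -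
  -- a)`.
  rcases le_total (b - a) δ with hsmall | hlarge
  · calc _ ≤ A * (b - a) := htriv a b ha hab hb
      _ ≤ A * (√(b - a) * √δ) := by gcongr; exact hsq _ _ (by linarith) hsmall
      _ ≤ 2 * (A * (√(b - a) * √δ)) := by
          have : 0 ≤ A * (√(b - a) * √δ) := by positivity
          linarith
      _ = _ := by ring
  · have hshift : ∫ t in (a + δ)..b, g t
        = ∫ t in a..(b - δ), -(Complex.exp (Complex.I * Φ * t) * f (t + δ)) := by
      have := intervalIntegral.integral_comp_add_right (a := a) (b := b - δ) g δ
      rw [sub_add_cancel] at this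
      rw [← this]
      refine intervalIntegral.integral_congr fun t _ => ?_
      have e : Complex.exp (Complex.I * Φ * ((t + δ : ℝ) : ℂ))
          = -Complex.exp (Complex.I * Φ * t) := by
        have : Complex.exp (Complex.I * Φ * δ) = -1 := by
          rcases lt_or_gt_of_ne hΦ with hneg | hpos
          · have : Complex.I * Φ * δ = -(Real.pi * Complex.I) := by
              rw [hδ, abs_of_neg hneg]; push_cast
              have : (Φ : ℂ) ≠ 0 := by exact_mod_cast hΦ
              field_simp
            rw [this, Complex.exp_neg, Complex.exp_pi_mul_I]; norm_num
          · have : Complex.I * Φ * δ = Real.pi * Complex.I := by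
              rw [hδ, abs_of_pos hpos]; push_cast
              have : (Φ : ℂ) ≠ 0 := by exact_mod_cast hΦ
              field_simp
            rw [this, Complex.exp_pi_mul_I]
        push_cast
        rw [mul_add, Complex.exp_add, this]; ring
      simp only [hg, e]
      ring
    have e1 : ∫ t in a..b, g t = (∫ t in a..(a + δ), g t) + ∫ t in (a + δ)..b, g t :=
      (intervalIntegral.integral_add_adjacent_intervals
        (hint _ _ ha (by linarith) (by linarith)) (hint _ _ (by linarith) (by linarith) hb)).symm
    have e2 : ∫ t in a..b, g t = (∫ t in a..(b - δ), g t) + ∫ t in (b - δ)..b, g t :=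
      (intervalIntegral.integral_add_adjacent_intervals
        (hint _ _ ha (by linarith) (by linarith)) (hint _ _ (by linarith) (by linarith) hb)).symm
    have hf2 : IntervalIntegrable (fun t => -(Complex.exp (Complex.I * Φ * t) * f (t + δ)))
        volume a (b - δ) := by
      refine ContinuousOn.intervalIntegrable ?_
      refine (ContinuousOn.mul (Continuous.continuousOn (by fun_prop)) ?_).neg
      refine hf.comp (Continuous.continuousOn (by fun_prop)) fun t ht => ?_
      rw [Set.uIcc_of_le (by linarith)] at ht
      exact ⟨by linarith [ht.1], by linarith [ht.2]⟩
    have e3 : (∫ t in a..(b - δ), g t) + ∫ t in (a + δ)..b, g t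
        = ∫ t in a..(b - δ), Complex.exp (Complex.I * Φ * t) * (f t - f (t + δ)) := by
      rw [hshift, ← intervalIntegral.integral_add (hint _ _ ha (by linarith) (by linarith)) hf2]
      refine intervalIntegral.integral_congr fun t _ => ?_
      simp only [hg]; ring
    have hmain : ‖∫ t in a..(b - δ), Complex.exp (Complex.I * Φ * t) * (f t - f (t + δ))‖
        ≤ A * √δ / √T * (b - a) := by
      have := intervalIntegral.norm_integral_le_of_norm_le_const (a := a) (b := b - δ)
        (C := A * √δ / √T) (f := fun t => Complex.exp (Complex.I * Φ * t) * (f t - f (t + δ)))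
        (fun t ht => by
          rw [Set.uIoc_of_le (by linarith)] at ht
          rw [norm_mul, norm_exp_phase, one_mul, le_div_iff₀ (Real.sqrt_pos.2 hT)]
          have := h2 t ⟨by linarith [ht.1], by linarith [ht.2]⟩ (t + δ)
            ⟨by linarith [ht.1], by linarith [ht.2]⟩
          rwa [show t - (t + δ) = -δ by ring, abs_neg, abs_of_pos hδ0] at this)
      refine this.trans ?_
      rw [abs_of_nonneg (by linarith)]
      gcongr
      linarith
    -- One copy of the integral is split at `a + δ`, the other at `b - δ`. Shifting the end of the
    -- first copy onto the start of the second produces the difference.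
    have hsplit : 2 * (∫ t in a..b, g t)
        = (∫ t in a..(b - δ), Complex.exp (Complex.I * Φ * t) * (f t - f (t + δ)))
          + (∫ t in a..(a + δ), g t) + ∫ t in (b - δ)..b, g t := by
      rw [← e3]; rw [two_mul]; nth_rewrite 1 [e1]; rw [e2]; ring
    have hδh : δ ≤ √δ * √(b - a) := hsq _ _ hδ0.le hlarge
    have hhT : (b - a) / √T ≤ √(b - a) := by
      rw [div_le_iff₀ (Real.sqrt_pos.2 hT)]
      exact hsq _ _ (by linarith) (by linarith)
    -- The three contributions are each at most `A √δ √(b - a)`, using `b - a ≤ T` for the first and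
    -- `δ ≤ b - a` for the others. The resulting constant `3/2` is rounded up to `2`.
    have hfin : 2 * ‖∫ t in a..b, g t‖ ≤ 3 * (A * √δ * √(b - a)) := by
      calc 2 * ‖∫ t in a..b, g t‖ = ‖2 * (∫ t in a..b, g t)‖ := by simp
        _ ≤ A * √δ / √T * (b - a) + A * δ + A * δ := by
            rw [hsplit]
            refine (norm_add₃_le).trans (add_le_add (add_le_add hmain ?_) ?_)
            · exact (htriv a (a + δ) ha (by linarith) (by linarith)).trans_eq (by ring)
            · exact (htriv (b - δ) b (by linarith) (by linarith) hb).trans_eq (by ring)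
        _ = A * √δ * ((b - a) / √T) + A * δ + A * δ := by ring
        _ ≤ A * √δ * √(b - a) + A * (√δ * √(b - a)) + A * (√δ * √(b - a)) := by gcongr
        _ = _ := by ring
    have : 0 ≤ A * √δ * √(b - a) := by positivity
    calc _ ≤ 2 * (A * √δ * √(b - a)) := by linarith
      _ = _ := by ring

theorem hn_integral_phase_le {T Φ : ℝ} (hT : 0 < T) (hΦ : Φ ≠ 0) {f : ℝ → ℂ} (hf : hn T f ≠ ⊤) :
    hn T (fun t => ∫ τ in (0 : ℝ)..t, Complex.exp (Complex.I * Φ * τ) * f τ)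
      ≤ ENNReal.ofReal (2 * √(Real.pi / |Φ|) * √T) * hn T f := by
  have hc := continuousOn_of_hn_ne_top hT hf
  obtain ⟨h1, h2⟩ := norm_le_of_hn_le ENNReal.toReal_nonneg (ENNReal.ofReal_toReal hf).ge
  refine (hn_integral_le (B := 2 * (hn T f).toReal * √(Real.pi / |Φ|)) (by positivity) ?_
    fun t' t h0 h htT => ?_).trans_eq ?_
  · exact ContinuousOn.mul (Continuous.continuousOn (by fun_prop)) hc
  · exact norm_integral_phase_le hT hΦ ENNReal.toReal_nonneg hc h1 h2 h0 h htT
  · conv_rhs => rw [← ENNReal.ofReal_toReal hf]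
    rw [← ENNReal.ofReal_mul (by positivity)]
    ring_nf

/-- The substitute for the phase gain in the diagonal term: the smallness comes from the length of
the interval alone. -/
theorem hn_integral_le_self {T : ℝ} (hT : 0 < T) {f : ℝ → ℂ} (hf : hn T f ≠ ⊤) :
    hn T (fun t => ∫ τ in (0 : ℝ)..t, f τ) ≤ ENNReal.ofReal T * hn T f := by
  have hc := continuousOn_of_hn_ne_top hT hf
  obtain ⟨h1, h2⟩ := norm_le_of_hn_le ENNReal.toReal_nonneg (ENNReal.ofReal_toReal hf).ge
  refine (hn_integral_le (B := (hn T f).toReal * √T) (by positivity) hc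
    fun t' t h0 h htT => ?_).trans_eq ?_
  · have := intervalIntegral.norm_integral_le_of_norm_le_const (a := t') (b := t)
      (C := (hn T f).toReal) (f := f) (fun τ hτ => by
        rw [Set.uIoc_of_le h] at hτ
        exact h1 τ ⟨h0.trans hτ.1.le, hτ.2.trans htT⟩)
    rw [abs_of_nonneg (by linarith)] at this
    refine this.trans ?_
    rw [mul_assoc]
    gcongr
    calc t - t' = √(t - t') * √(t - t') := (Real.mul_self_sqrt (by linarith)).symm
      _ ≤ √T * √(t - t') := by gcongr; linarith
  · conv_rhs => rw [← ENNReal.ofReal_toReal hf]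
    rw [← ENNReal.ofReal_mul hT.le, mul_assoc, Real.mul_self_sqrt hT.le, mul_comm]

/-! ### The Duhamel integral in the interaction picture -/

/-- The multiplier of the trilinear form of the equation. -/
noncomputable def coef (a b c : ℤ) : ℂ :=
  if res a b c ≠ 0 then -(Complex.I * ((a + b + c : ℤ) : ℂ) / 3)
  else if a = b ∧ c = -a then Complex.I * a else 0

/-- The phase `a³ + b³ + c³ - (a + b + c)³`. -/
def phase (a b c : ℤ) : ℝ := -3 * (res a b c : ℝ)

/-- One term of the Duhamel integral in the interaction picture. -/
noncomputable def duhTerm (u v z : ℤ → ℝ → ℂ) (n : ℤ) (q : ℤ × ℤ) (t : ℝ) : ℂ :=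
  coef q.1 q.2 (n - q.1 - q.2) * ∫ τ in (0 : ℝ)..t,
    Complex.exp (Complex.I * phase q.1 q.2 (n - q.1 - q.2) * τ)
      * (u q.1 τ * v q.2 τ * z (n - q.1 - q.2) τ)

/-- The Duhamel integral in the interaction picture. -/
noncomputable def duh (u v z : ℤ → ℝ → ℂ) (n : ℤ) (t : ℝ) : ℂ :=
  ∑' q : ℤ × ℤ, duhTerm u v z n q t

theorem hn_mul3_le (T : ℝ) (f g h : ℝ → ℂ) :
    hn T (fun t => f t * g t * h t) ≤ 4 * (hn T f * hn T g * hn T h) := by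
  refine (hn_mul_le T (fun t => f t * g t) h).trans ?_
  calc 2 * (hn T (fun t => f t * g t) * hn T h) ≤ 2 * (2 * (hn T f * hn T g) * hn T h) := by
        gcongr; exact hn_mul_le T f g
    _ = _ := by ring

theorem hn_mul3_ne_top {T : ℝ} {f g h : ℝ → ℂ} (hf : hn T f ≠ ⊤) (hg : hn T g ≠ ⊤)
    (hh : hn T h ≠ ⊤) : hn T (fun t => f t * g t * h t) ≠ ⊤ :=
  ne_top_of_le_ne_top (by finiteness) (hn_mul3_le T f g h)

/-- Off resonance the phase integral gains `|res|^{-1/2} √T`, which combined with `|n|/3` gives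
`kap`. On the diagonal the gain is `T`, and `T ≤ 1` lets `√T` dominate it. The constant `12` covers
both `16/3` and `4`. -/
theorem hn_duhTerm_le {T : ℝ} (hT : 0 < T) (hT1 : T ≤ 1) {u v z : ℤ → ℝ → ℂ}
    (hu : ∀ n, hn T (u n) ≠ ⊤) (hv : ∀ n, hn T (v n) ≠ ⊤) (hz : ∀ n, hn T (z n) ≠ ⊤)
    (n : ℤ) (q : ℤ × ℤ) :
    hn T (duhTerm u v z n q) ≤ ENNReal.ofReal (12 * √T) *
      (ENNReal.ofReal (kap q.1 q.2 (n - q.1 - q.2)) *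
        (hn T (u q.1) * hn T (v q.2) * hn T (z (n - q.1 - q.2)))) := by
  set c := n - q.1 - q.2 with hc
  have hfin := hn_mul3_ne_top (hu q.1) (hv q.2) (hz c)
  have h4 := hn_mul3_le T (u q.1) (v q.2) (z c)
  have hT2 : T ≤ √T := by
    calc T = √T * √T := (Real.mul_self_sqrt hT.le).symm
      _ ≤ √T * 1 := by gcongr; exact Real.sqrt_le_one.2 hT1
      _ = √T := mul_one _
  refine (hn_const_mul_le T _ _).trans ?_
  simp only [← hc]
  by_cases hr : res q.1 q.2 c = 0
  · by_cases hab : q.1 = q.2 ∧ c = -q.1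
    · have e1 : coef q.1 q.2 c = Complex.I * q.1 := by
        rw [coef, if_neg (by simpa using hr), if_pos hab]
      have e2 : kap q.1 q.2 c = |(q.1 : ℝ)| := by
        rw [kap, if_neg (by simpa using hr), if_pos hab]
      have e3 : phase q.1 q.2 c = 0 := by simp [phase, hr]
      simp only [e1, e2, e3, Complex.ofReal_zero, mul_zero, zero_mul, Complex.exp_zero, one_mul]
      have e4 : ‖Complex.I * (q.1 : ℂ)‖ₑ = ENNReal.ofReal |(q.1 : ℝ)| := by
        rw [← ofReal_norm]; simp
      calc _ ≤ ‖Complex.I * (q.1 : ℂ)‖ₑ * (ENNReal.ofReal T *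
            (4 * (hn T (u q.1) * hn T (v q.2) * hn T (z c)))) := by
            gcongr
            exact (hn_integral_le_self hT hfin).trans (by gcongr)
        _ = ENNReal.ofReal (4 * T) * (ENNReal.ofReal |(q.1 : ℝ)| *
            (hn T (u q.1) * hn T (v q.2) * hn T (z c))) := by
            rw [e4, ENNReal.ofReal_mul (by norm_num), ENNReal.ofReal_ofNat]; ring
        _ ≤ _ := by
            gcongr
            linarith
    · have e1 : coef q.1 q.2 c = 0 := by
        rw [coef, if_neg (by simpa using hr), if_neg hab]
      simp [e1]
  · have e1 : coef q.1 q.2 c = -(Complex.I * ((q.1 + q.2 + c : ℤ) : ℂ) / 3) := by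
      rw [coef, if_pos hr]
    have e2 : kap q.1 q.2 c
        = |((q.1 + q.2 + c : ℤ) : ℝ)| * |(res q.1 q.2 c : ℝ)| ^ (-(1 / 2) : ℝ) := by
      rw [kap, if_pos hr]
    have hr' : (res q.1 q.2 c : ℝ) ≠ 0 := by exact_mod_cast hr
    have hΦ : phase q.1 q.2 c ≠ 0 := mul_ne_zero (by norm_num) hr'
    have e4 : ‖coef q.1 q.2 c‖ₑ = ENNReal.ofReal (|((q.1 + q.2 + c : ℤ) : ℝ)| / 3) := by
      rw [e1, ← ofReal_norm, norm_neg, norm_div, norm_mul, Complex.norm_I, one_mul,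
        Complex.norm_intCast]; simp
    have e5 : √(Real.pi / |phase q.1 q.2 c|) ≤ 2 * |(res q.1 q.2 c : ℝ)| ^ (-(1 / 2) : ℝ) := by
      rw [Real.rpow_neg (abs_nonneg _), ← Real.sqrt_eq_rpow, ← div_eq_mul_inv,
        le_div_iff₀ (Real.sqrt_pos.2 (abs_pos.2 hr')), ← Real.sqrt_mul (by positivity)]
      refine Real.sqrt_le_iff.2 ⟨by norm_num, ?_⟩
      rw [phase, abs_mul, show |(-3 : ℝ)| = 3 by norm_num]
      have : Real.pi / (3 * |(res q.1 q.2 c : ℝ)|) * |(res q.1 q.2 c : ℝ)| = Real.pi / 3 := by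
        have := (abs_pos.2 hr').ne'
        field_simp
      rw [this]
      linarith [Real.pi_le_four]
    calc _ ≤ ‖coef q.1 q.2 c‖ₑ * (ENNReal.ofReal (2 * √(Real.pi / |phase q.1 q.2 c|) * √T) *
            (4 * (hn T (u q.1) * hn T (v q.2) * hn T (z c)))) := by
            gcongr
            exact (hn_integral_phase_le hT hΦ hfin).trans (by gcongr)
      _ = ENNReal.ofReal (|((q.1 + q.2 + c : ℤ) : ℝ)| / 3 *
          (2 * √(Real.pi / |phase q.1 q.2 c|) * √T * 4)) *
            (hn T (u q.1) * hn T (v q.2) * hn T (z c)) := by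
            rw [e4, ENNReal.ofReal_mul (p := |((q.1 + q.2 + c : ℤ) : ℝ)| / 3) (by positivity),
              ENNReal.ofReal_mul (q := 4) (by positivity), ENNReal.ofReal_ofNat]; ring
      _ ≤ ENNReal.ofReal (12 * √T * (|((q.1 + q.2 + c : ℤ) : ℝ)| *
          |(res q.1 q.2 c : ℝ)| ^ (-(1 / 2) : ℝ))) *
            (hn T (u q.1) * hn T (v q.2) * hn T (z c)) := by
            gcongr ENNReal.ofReal ?_ * _
            calc _ ≤ |((q.1 + q.2 + c : ℤ) : ℝ)| / 3 *
                  (2 * (2 * |(res q.1 q.2 c : ℝ)| ^ (-(1 / 2) : ℝ)) * √T * 4) := by gcongr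
              _ = 16 / 3 * (√T * (|((q.1 + q.2 + c : ℤ) : ℝ)| *
                  |(res q.1 q.2 c : ℝ)| ^ (-(1 / 2) : ℝ))) := by ring
              _ ≤ 12 * (√T * (|((q.1 + q.2 + c : ℤ) : ℝ)| *
                  |(res q.1 q.2 c : ℝ)| ^ (-(1 / 2) : ℝ))) := by
                  gcongr; norm_num
              _ = _ := by ring
      _ = _ := by rw [e2, ENNReal.ofReal_mul (p := 12 * √T) (by positivity)]; ring

theorem hn_duh_le {T : ℝ} (hT : 0 < T) (hT1 : T ≤ 1) {u v z : ℤ → ℝ → ℂ}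
    (hu : ∀ n, hn T (u n) ≠ ⊤) (hv : ∀ n, hn T (v n) ≠ ⊤) (hz : ∀ n, hn T (z n) ≠ ⊤) (n : ℤ)
    (hfin : tri (fun n => hn T (u n)) (fun n => hn T (v n)) (fun n => hn T (z n)) n ≠ ⊤) :
    (∀ t ∈ Set.Icc 0 T, Summable fun q => duhTerm u v z n q t) ∧
      hn T (duh u v z n) ≤ ENNReal.ofReal (12 * √T) *
        tri (fun n => hn T (u n)) (fun n => hn T (v n)) (fun n => hn T (z n)) n := by
  have h1 : ∑' q, hn T (duhTerm u v z n q) ≤ ENNReal.ofReal (12 * √T) *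
      tri (fun n => hn T (u n)) (fun n => hn T (v n)) (fun n => hn T (z n)) n := by
    rw [tri, ← ENNReal.tsum_mul_left]
    exact ENNReal.tsum_le_tsum fun q => hn_duhTerm_le hT hT1 hu hv hz n q
  have h2 := hn_tsum_le (T := T) (duhTerm u v z n)
    (ne_top_of_le_ne_top (ENNReal.mul_ne_top ENNReal.ofReal_ne_top hfin) h1)
  exact ⟨h2.1, h2.2.trans h1⟩

/-! ### Weighted norms and the contraction estimate -/

/-- Submultiplicative weights. -/
structure IsWeight (ρ : ℤ → ℝ≥0∞) : Prop where
  one_le : ∀ n, 1 ≤ ρ n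
  ne_top : ∀ n, ρ n ≠ ⊤
  mul_le : ∀ a b c, ρ (a + b + c) ≤ ρ a * ρ b * ρ c

theorem isWeight_one : IsWeight fun _ => 1 :=
  ⟨fun _ => le_rfl, fun _ => by simp, fun _ _ _ => by simp⟩

/-- The weighted `ℱL^{s,p}` norm of a sequence. -/
noncomputable def wN (s : ℝ) (p : ℝ≥0∞) (ρ : ℤ → ℝ≥0∞) (A : ℤ → ℝ≥0∞) : ℝ≥0∞ :=
  lpN p fun n => jp (s / 2) n * (ρ n * A n)

section wN

variable {s : ℝ} {p : ℝ≥0∞} {ρ : ℤ → ℝ≥0∞}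

theorem wN_mono {A B : ℤ → ℝ≥0∞} (h : ∀ n, A n ≤ B n) : wN s p ρ A ≤ wN s p ρ B :=
  lpN_mono fun n => by gcongr; exact h n

theorem wN_add_le (hp : 1 ≤ p) (A B : ℤ → ℝ≥0∞) :
    wN s p ρ (fun n => A n + B n) ≤ wN s p ρ A + wN s p ρ B := by
  simp only [wN, mul_add]
  exact lpN_add_le hp _ _

theorem wN_const_mul (hp : 1 ≤ p) (c : ℝ≥0∞) (A : ℤ → ℝ≥0∞) :
    wN s p ρ (fun n => c * A n) = c * wN s p ρ A := by
  rw [wN, wN, ← lpN_const_mul (zero_lt_one.trans_le hp).ne']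
  congr 1; ext n; ring

theorem le_wN (hs : 0 ≤ s) (hp : 1 ≤ p) (hρ : IsWeight ρ) (A : ℤ → ℝ≥0∞) (n : ℤ) :
    A n ≤ wN s p ρ A := by
  refine le_trans ?_ (le_lpN (zero_lt_one.trans_le hp).ne' _ n)
  refine (le_mul_of_one_le_left zero_le (hρ.one_le n)).trans ?_
  exact le_mul_of_one_le_left zero_le (one_le_jp (by linarith) n)

theorem wN_le_of_le_liminf (hp : 1 ≤ p) (hρ : IsWeight ρ) {A : ℤ → ℝ≥0∞} {B : ℕ → ℤ → ℝ≥0∞}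
    {C : ℝ≥0∞} (hA : ∀ n, A n ≤ liminf (fun k => B k n) atTop)
    (hB : ∀ᶠ k in atTop, wN s p ρ (B k) ≤ C) : wN s p ρ A ≤ C := by
  refine lpN_le_of_le_liminf (zero_lt_one.trans_le hp).ne' (fun n => ?_) hB
  have hc : jp (s / 2) n * ρ n ≠ ⊤ := ENNReal.mul_ne_top (jp_ne_top _ _) (hρ.ne_top n)
  simp_rw [← mul_assoc]
  have hm : Monotone fun x : ℝ≥0∞ => jp (s / 2) n * ρ n * x := fun a b h => by
    simp only; gcongr
  have := hm.map_liminf_of_continuousAt (fun k => B k n)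
    (ENNReal.continuous_const_mul hc).continuousAt (F := atTop)
  refine (hm (hA n)).trans (this.le.trans ?_)
  simp [Function.comp_def]

/-- Because `n` is the sum of the three frequencies, a submultiplicative weight is distributed over
the three inputs at no cost. The constant, and with it the existence time, does not depend on `ρ`;
persistence of regularity rests on this. -/
theorem wN_tri_le {C : ℝ≥0∞} (hρ : IsWeight ρ)
    (hC : ∀ A B D : ℤ → ℝ≥0∞, lpN p (fun n => jp (s / 2) n * tri A B D n) ≤
      C * (lpN p (fun n => jp (s / 2) n * A n) * lpN p (fun n => jp (s / 2) n * B n)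
        * lpN p (fun n => jp (s / 2) n * D n))) (A B D : ℤ → ℝ≥0∞) :
    wN s p ρ (tri A B D) ≤ C * (wN s p ρ A * wN s p ρ B * wN s p ρ D) := by
  refine le_trans (lpN_mono fun n => ?_)
    (hC (fun n => ρ n * A n) (fun n => ρ n * B n) (fun n => ρ n * D n))
  gcongr
  rw [tri, tri, ← ENNReal.tsum_mul_left]
  refine ENNReal.tsum_le_tsum fun q => ?_
  have := hρ.mul_le q.1 q.2 (n - q.1 - q.2)
  rw [show q.1 + q.2 + (n - q.1 - q.2) = n by ring] at this
  refine (mul_le_mul_left this _).trans (le_of_eq ?_)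
  ring

end wN

/-- The weighted norm of a family of functions of time. -/
noncomputable def xN (s : ℝ) (p : ℝ≥0∞) (ρ : ℤ → ℝ≥0∞) (T : ℝ) (u : ℤ → ℝ → ℂ) : ℝ≥0∞ :=
  wN s p ρ fun n => hn T (u n)

/-- `K` is an admissible constant in the trilinear estimate on `[0,T]`. -/
structure IsTriConst (s : ℝ) (p : ℝ≥0∞) (T : ℝ) (K : ℝ≥0∞) : Prop where
  hs : 0 ≤ s
  hp : 1 ≤ p
  hT : 0 < T
  hT1 : T ≤ 1
  bound : ∃ C : ℝ≥0∞, C ≠ ⊤ ∧ ENNReal.ofReal (12 * √T) * C ≤ K ∧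
    ∀ A B D : ℤ → ℝ≥0∞, lpN p (fun n => jp (s / 2) n * tri A B D n) ≤
      C * (lpN p (fun n => jp (s / 2) n * A n) * lpN p (fun n => jp (s / 2) n * B n)
        * lpN p (fun n => jp (s / 2) n * D n))

namespace IsTriConst

variable {s : ℝ} {p : ℝ≥0∞} {ρ : ℤ → ℝ≥0∞} {T : ℝ} {K : ℝ≥0∞}

theorem hn_ne_top (h : IsTriConst s p T K) (hρ : IsWeight ρ) {u : ℤ → ℝ → ℂ}
    (hu : xN s p ρ T u ≠ ⊤) (n : ℤ) : hn T (u n) ≠ ⊤ :=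
  ne_top_of_le_ne_top hu (le_wN h.hs h.hp hρ (fun n => hn T (u n)) n)

theorem xN_duh_le (h : IsTriConst s p T K) (hρ : IsWeight ρ) {u v z : ℤ → ℝ → ℂ}
    (hu : xN s p ρ T u ≠ ⊤) (hv : xN s p ρ T v ≠ ⊤) (hz : xN s p ρ T z ≠ ⊤) :
    (∀ n, ∀ t ∈ Set.Icc 0 T, Summable fun q => duhTerm u v z n q t) ∧
    xN s p ρ T (duh u v z) ≤ K * (xN s p ρ T u * xN s p ρ T v * xN s p ρ T z) := by
  obtain ⟨C, hC, hCK, hb⟩ := h.bound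
  have h1 := wN_tri_le hρ hb (fun n => hn T (u n)) (fun n => hn T (v n)) fun n => hn T (z n)
  have h2 : ∀ n, tri (fun n => hn T (u n)) (fun n => hn T (v n)) (fun n => hn T (z n)) n ≠ ⊤ := by
    intro n
    refine ne_top_of_le_ne_top ?_ ((le_wN h.hs h.hp hρ _ n).trans h1)
    exact ENNReal.mul_ne_top hC (ENNReal.mul_ne_top (ENNReal.mul_ne_top hu hv) hz)
  have h3 := fun n => hn_duh_le h.hT h.hT1 (h.hn_ne_top hρ hu) (h.hn_ne_top hρ hv)
    (h.hn_ne_top hρ hz) n (h2 n)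
  refine ⟨fun n => (h3 n).1, ?_⟩
  calc xN s p ρ T (duh u v z) ≤ ENNReal.ofReal (12 * √T) * wN s p ρ
        (tri (fun n => hn T (u n)) (fun n => hn T (v n)) (fun n => hn T (z n))) := by
        rw [← wN_const_mul h.hp]
        exact wN_mono fun n => (h3 n).2
    _ ≤ ENNReal.ofReal (12 * √T) * (C * (xN s p ρ T u * xN s p ρ T v * xN s p ρ T z)) := by
        gcongr; exact h1
    _ ≤ _ := by
        rw [← mul_assoc]; gcongr

theorem xN_add_le (h : IsTriConst s p T K) (u v : ℤ → ℝ → ℂ) :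
    xN s p ρ T (fun n t => u n t + v n t) ≤ xN s p ρ T u + xN s p ρ T v :=
  (wN_mono fun n => hn_add_le T (u n) (v n)).trans (wN_add_le h.hp _ _)

theorem xN_sub_le (h : IsTriConst s p T K) (u v : ℤ → ℝ → ℂ) :
    xN s p ρ T (fun n t => u n t - v n t) ≤ xN s p ρ T u + xN s p ρ T v := by
  refine (wN_mono fun n => ?_).trans (wN_add_le h.hp _ _)
  have h1 := hn_add_le T (u n) (fun t => -1 * v n t)
  have h2 := hn_const_mul_le T (-1) (v n)
  simp only [enorm_neg, enorm_one, one_mul] at h2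
  simpa [sub_eq_add_neg] using h1.trans (add_le_add_right h2 _)

theorem duhTerm_sub (h : IsTriConst s p T K) (hρ : IsWeight ρ) {u v : ℤ → ℝ → ℂ}
    (hu : xN s p ρ T u ≠ ⊤) (hv : xN s p ρ T v ≠ ⊤) (n : ℤ) (q : ℤ × ℤ) {t : ℝ}
    (ht : t ∈ Set.Icc 0 T) :
    duhTerm u u u n q t - duhTerm v v v n q t
      = duhTerm (fun n t => u n t - v n t) u u n q t
        + duhTerm v (fun n t => u n t - v n t) u n q t
        + duhTerm v v (fun n t => u n t - v n t) n q t := by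
  have hd : xN s p ρ T (fun n t => u n t - v n t) ≠ ⊤ :=
    ne_top_of_le_ne_top (ENNReal.add_ne_top.2 ⟨hu, hv⟩) (h.xN_sub_le u v)
  have hc : ∀ {w : ℤ → ℝ → ℂ}, xN s p ρ T w ≠ ⊤ → ∀ n, ContinuousOn (w n) (Set.uIcc 0 t) := by
    intro w hw n
    rw [Set.uIcc_of_le ht.1]
    exact (continuousOn_of_hn_ne_top h.hT (h.hn_ne_top hρ hw n)).mono
      (Set.Icc_subset_Icc_right ht.2)
  have hi : ∀ {w₁ w₂ w₃ : ℤ → ℝ → ℂ}, xN s p ρ T w₁ ≠ ⊤ → xN s p ρ T w₂ ≠ ⊤ →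
      xN s p ρ T w₃ ≠ ⊤ → IntervalIntegrable (fun τ : ℝ =>
        Complex.exp (Complex.I * phase q.1 q.2 (n - q.1 - q.2) * τ)
          * (w₁ q.1 τ * w₂ q.2 τ * w₃ (n - q.1 - q.2) τ)) volume 0 t := by
    intro w₁ w₂ w₃ h₁ h₂ h₃
    refine ContinuousOn.intervalIntegrable ?_
    exact (Continuous.continuousOn (by fun_prop)).mul (((hc h₁ _).mul (hc h₂ _)).mul (hc h₃ _))
  simp only [duhTerm, ← mul_sub, ← mul_add]
  rw [← intervalIntegral.integral_sub (hi hu hu hu) (hi hv hv hv),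
    ← intervalIntegral.integral_add (hi hd hu hu) (hi hv hd hu),
    ← intervalIntegral.integral_add ((hi hd hu hu).add (hi hv hd hu)) (hi hv hv hd)]
  congr 1
  refine intervalIntegral.integral_congr fun τ _ => ?_
  ring

/-- The difference of the cubic expressions telescopes into three terms, each with one factor `u -
v`; this explains the `3 * M ^ 2` in the smallness condition. -/
theorem xN_duh_sub_le (h : IsTriConst s p T K) (hρ : IsWeight ρ) {M : ℝ≥0∞} (hM : M ≠ ⊤)
    (hK : K * (3 * M ^ 2) ≤ 2⁻¹) {u v : ℤ → ℝ → ℂ}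
    (hu : xN s p ρ T u ≤ M) (hv : xN s p ρ T v ≤ M) :
    xN s p ρ T (fun n t => duh u u u n t - duh v v v n t)
      ≤ 2⁻¹ * xN s p ρ T (fun n t => u n t - v n t) := by
  have hu' := ne_top_of_le_ne_top hM hu
  have hv' := ne_top_of_le_ne_top hM hv
  set w : ℤ → ℝ → ℂ := fun n t => u n t - v n t with hw
  have hd : xN s p ρ T w ≠ ⊤ :=
    ne_top_of_le_ne_top (ENNReal.add_ne_top.2 ⟨hu', hv'⟩) (h.xN_sub_le u v)
  obtain ⟨s1, b1⟩ := h.xN_duh_le hρ hd hu' hu'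
  obtain ⟨s2, b2⟩ := h.xN_duh_le hρ hv' hd hu'
  obtain ⟨s3, b3⟩ := h.xN_duh_le hρ hv' hv' hd
  have e : ∀ n, ∀ t ∈ Set.Icc 0 T, duh u u u n t - duh v v v n t
      = duh w u u n t + duh v w u n t + duh v v w n t := by
    intro n t ht
    rw [duh, duh, ← ((h.xN_duh_le hρ hu' hu' hu').1 n t ht).tsum_sub
      ((h.xN_duh_le hρ hv' hv' hv').1 n t ht), duh, duh, duh,
      ← (s1 n t ht).tsum_add (s2 n t ht), ← ((s1 n t ht).add (s2 n t ht)).tsum_add (s3 n t ht)]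
    exact tsum_congr fun q => h.duhTerm_sub hρ hu' hv' n q ht
  calc xN s p ρ T (fun n t => duh u u u n t - duh v v v n t)
      ≤ xN s p ρ T (fun n t => duh w u u n t + duh v w u n t + duh v v w n t) :=
        wN_mono fun n => (hn_congr (e n)).le
    _ ≤ xN s p ρ T (duh w u u) + xN s p ρ T (duh v w u) + xN s p ρ T (duh v v w) :=
        (h.xN_add_le _ _).trans (add_le_add_left (h.xN_add_le _ _) _)
    _ ≤ K * (xN s p ρ T w * M * M) + K * (M * xN s p ρ T w * M) + K * (M * M * xN s p ρ T w) := by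
        refine add_le_add (add_le_add (b1.trans ?_) (b2.trans ?_)) (b3.trans ?_) <;> gcongr
    _ = K * (3 * M ^ 2) * xN s p ρ T w := by ring
    _ ≤ _ := by gcongr

end IsTriConst

/-! ### Picard iteration -/

/-- Picard iterates. -/
noncomputable def pic (φ : ℤ → ℂ) : ℕ → ℤ → ℝ → ℂ
  | 0 => fun n _ => φ n
  | k + 1 => fun n t => φ n + duh (pic φ k) (pic φ k) (pic φ k) n t

/-- The limit of the Picard iterates. -/
noncomputable def sol (φ : ℤ → ℂ) (n : ℤ) (t : ℝ) : ℂ :=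
  limUnder atTop fun k => pic φ k n t

namespace IsTriConst

variable {s : ℝ} {p : ℝ≥0∞} {ρ : ℤ → ℝ≥0∞} {T : ℝ} {K M : ℝ≥0∞} {φ : ℤ → ℂ}

theorem xN_const_le (φ : ℤ → ℂ) :
    xN s p ρ T (fun n _ => φ n) ≤ wN s p ρ fun n => ‖φ n‖ₑ :=
  wN_mono fun n => hn_const_le T (φ n)

theorem xN_pic_le (h : IsTriConst s p T K) (hρ : IsWeight ρ) (hM : M ≠ ⊤)
    (hK : K * (3 * M ^ 2) ≤ 2⁻¹) (hφ : wN s p ρ (fun n => ‖φ n‖ₑ) ≤ M / 2) (k : ℕ) :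
    xN s p ρ T (pic φ k) ≤ M := by
  induction k with
  | zero => exact (xN_const_le φ).trans (hφ.trans ENNReal.half_le_self)
  | succ k ih =>
    have ih' := ne_top_of_le_ne_top hM ih
    calc xN s p ρ T (pic φ (k + 1))
        ≤ xN s p ρ T (fun n _ => φ n) + xN s p ρ T (duh (pic φ k) (pic φ k) (pic φ k)) :=
          h.xN_add_le _ _
      _ ≤ M / 2 + K * (M * M * M) := by
          refine add_le_add ((xN_const_le φ).trans hφ) ((h.xN_duh_le hρ ih' ih' ih').2.trans ?_)
          gcongr
      _ ≤ M / 2 + M / 2 := by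
          gcongr
          calc K * (M * M * M) ≤ K * (3 * M ^ 2) * M := by
                rw [show K * (3 * M ^ 2) * M = 3 * (K * (M * M * M)) by ring]
                exact le_mul_of_one_le_left zero_le (by norm_num)
            _ ≤ 2⁻¹ * M := by gcongr
            _ = M / 2 := by rw [ENNReal.div_eq_inv_mul]
      _ = M := ENNReal.add_halves M

theorem xN_pic_sub_le (h : IsTriConst s p T K) (hρ : IsWeight ρ) (hM : M ≠ ⊤)
    (hK : K * (3 * M ^ 2) ≤ 2⁻¹) (hφ : wN s p ρ (fun n => ‖φ n‖ₑ) ≤ M / 2) (k m : ℕ) :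
    xN s p ρ T (fun n t => pic φ (k + m) n t - pic φ k n t) ≤ 2 * M / 2 ^ k := by
  induction k with
  | zero =>
    refine (h.xN_sub_le _ _).trans ?_
    rw [pow_zero, div_one, two_mul]
    exact add_le_add (h.xN_pic_le hρ hM hK hφ _) (h.xN_pic_le hρ hM hK hφ _)
  | succ k ih =>
    have := h.xN_duh_sub_le hρ hM hK (h.xN_pic_le hρ hM hK hφ (k + m))
      (h.xN_pic_le hρ hM hK hφ k)
    rw [show k + 1 + m = (k + m) + 1 by ring]
    simp only [pic, add_sub_add_left_eq_sub]
    refine this.trans ((mul_le_mul_right ih _).trans_eq ?_)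
    rw [ENNReal.div_eq_inv_mul, ENNReal.div_eq_inv_mul, pow_succ,
      ENNReal.mul_inv (Or.inl (by simp)) (Or.inl (by simp))]
    ring

/-- Convergence is needed only mode by mode and at each time; norm bounds are recovered by lower
semicontinuity. The limit `sol` makes no reference to `ρ`, so bounds in different weighted norms
concern the same function. -/
theorem tendsto_pic (h : IsTriConst s p T K) (hρ : IsWeight ρ) (hM : M ≠ ⊤)
    (hK : K * (3 * M ^ 2) ≤ 2⁻¹) (hφ : wN s p ρ (fun n => ‖φ n‖ₑ) ≤ M / 2) (n : ℤ) {t : ℝ}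
    (ht : t ∈ Set.Icc 0 T) : Tendsto (fun k => pic φ k n t) atTop (𝓝 (sol φ n t)) := by
  refine CauchySeq.tendsto_limUnder ?_
  refine cauchySeq_of_edist_le_geometric_two (2 * M) (by finiteness) fun k => ?_
  rw [edist_comm, edist_eq_enorm_sub]
  exact (enorm_le_hn (fun t => pic φ (k + 1) n t - pic φ k n t) ht).trans
    ((le_wN h.hs h.hp hρ (fun n => hn T fun t => pic φ (k + 1) n t - pic φ k n t) n).trans
      (h.xN_pic_sub_le hρ hM hK hφ k 1))

theorem xN_sol_le (h : IsTriConst s p T K) (hρ : IsWeight ρ) (hM : M ≠ ⊤)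
    (hK : K * (3 * M ^ 2) ≤ 2⁻¹) (hφ : wN s p ρ (fun n => ‖φ n‖ₑ) ≤ M / 2) :
    xN s p ρ T (sol φ) ≤ M :=
  wN_le_of_le_liminf h.hp hρ
    (fun n => hn_le_of_tendsto fun _ ht => h.tendsto_pic hρ hM hK hφ n ht)
    (Eventually.of_forall fun k => h.xN_pic_le hρ hM hK hφ k)

theorem xN_sol_sub_pic_le (h : IsTriConst s p T K) (hρ : IsWeight ρ) (hM : M ≠ ⊤)
    (hK : K * (3 * M ^ 2) ≤ 2⁻¹) (hφ : wN s p ρ (fun n => ‖φ n‖ₑ) ≤ M / 2) (k : ℕ) :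
    xN s p ρ T (fun n t => sol φ n t - pic φ k n t) ≤ 2 * M / 2 ^ k := by
  refine wN_le_of_le_liminf h.hp hρ
    (B := fun m n => hn T fun t => pic φ (k + m) n t - pic φ k n t)
    (fun n => hn_le_of_tendsto fun t ht => ?_)
    (Eventually.of_forall fun m => h.xN_pic_sub_le hρ hM hK hφ k m)
  refine Tendsto.sub_const ?_ _
  have := (tendsto_add_atTop_iff_nat k).2 (h.tendsto_pic hρ hM hK hφ n ht)
  simpa [add_comm] using this

theorem sol_eq (h : IsTriConst s p T K) (hρ : IsWeight ρ) (hM : M ≠ ⊤)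
    (hK : K * (3 * M ^ 2) ≤ 2⁻¹) (hφ : wN s p ρ (fun n => ‖φ n‖ₑ) ≤ M / 2) (n : ℤ) {t : ℝ}
    (ht : t ∈ Set.Icc 0 T) :
    sol φ n t = φ n + duh (sol φ) (sol φ) (sol φ) n t := by
  refine tendsto_nhds_unique ((tendsto_add_atTop_iff_nat 1).2 (h.tendsto_pic hρ hM hK hφ n ht)) ?_
  simp only [pic]
  refine Tendsto.const_add _ ?_
  rw [tendsto_iff_edist_tendsto_0]
  have h0 : Tendsto (fun k : ℕ => 2 * M / 2 ^ k) atTop (𝓝 0) := by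
    have h1 : Tendsto (fun k : ℕ => (2 * M) * (2⁻¹ : ℝ≥0∞) ^ k) atTop (𝓝 (2 * M * 0)) :=
      ENNReal.Tendsto.const_mul
        (ENNReal.tendsto_pow_atTop_nhds_zero_of_lt_one (by simp)) (Or.inr (by finiteness))
    simpa [div_eq_mul_inv, ENNReal.inv_pow] using h1
  refine tendsto_of_tendsto_of_tendsto_of_le_of_le tendsto_const_nhds h0 (fun _ => zero_le)
    fun k => ?_
  have h2 := h.xN_duh_sub_le hρ hM hK (h.xN_sol_le hρ hM hK hφ) (h.xN_pic_le hρ hM hK hφ k)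
  rw [edist_comm, edist_eq_enorm_sub]
  calc _ ≤ _ := enorm_le_hn (fun t => duh (sol φ) (sol φ) (sol φ) n t
        - duh (pic φ k) (pic φ k) (pic φ k) n t) ht
    _ ≤ _ := le_wN h.hs h.hp hρ (fun n => hn T fun t => duh (sol φ) (sol φ) (sol φ) n t
        - duh (pic φ k) (pic φ k) (pic φ k) n t) n
    _ ≤ 2⁻¹ * (2 * M / 2 ^ k) := h2.trans (by gcongr; exact h.xN_sol_sub_pic_le hρ hM hK hφ k)
    _ ≤ _ := mul_le_of_le_one_left zero_le (by norm_num)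

/-- The contraction gives `d ≤ ‖φ - χ‖ + d/2`, and `d` can be absorbed because it is already known
to be finite. -/
theorem xN_sol_sub_le (h : IsTriConst s p T K) (hρ : IsWeight ρ) (hM : M ≠ ⊤)
    (hK : K * (3 * M ^ 2) ≤ 2⁻¹) {χ : ℤ → ℂ} (hφ : wN s p ρ (fun n => ‖φ n‖ₑ) ≤ M / 2)
    (hχ : wN s p ρ (fun n => ‖χ n‖ₑ) ≤ M / 2) :
    xN s p ρ T (fun n t => sol φ n t - sol χ n t) ≤ 2 * wN s p ρ fun n => ‖φ n - χ n‖ₑ := by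
  set d := xN s p ρ T (fun n t => sol φ n t - sol χ n t) with hd
  have b1 := h.xN_sol_le hρ hM hK hφ
  have b2 := h.xN_sol_le hρ hM hK hχ
  have hdt : d ≠ ⊤ := ne_top_of_le_ne_top (by finiteness) ((h.xN_sub_le _ _).trans (add_le_add b1 b2))
  have h1 : d ≤ (wN s p ρ fun n => ‖φ n - χ n‖ₑ) + 2⁻¹ * d := by
    calc d ≤ xN s p ρ T (fun n t => (φ n - χ n) +
          (duh (sol φ) (sol φ) (sol φ) n t - duh (sol χ) (sol χ) (sol χ) n t)) := by
          refine wN_mono fun n => (hn_congr fun t ht => ?_).le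
          beta_reduce
          rw [h.sol_eq hρ hM hK hφ n ht, h.sol_eq hρ hM hK hχ n ht]; ring
      _ ≤ _ := (h.xN_add_le _ _).trans
          (add_le_add (xN_const_le _) (h.xN_duh_sub_le hρ hM hK b1 b2))
  have h2 : 2⁻¹ * d ≤ wN s p ρ fun n => ‖φ n - χ n‖ₑ := by
    have h3 : 2⁻¹ * d + 2⁻¹ * d = d := by
      rw [← add_mul, ENNReal.inv_two_add_inv_two, one_mul]
    have h4 : 2⁻¹ * d ≠ ⊤ := by finiteness
    rw [← ENNReal.add_le_add_iff_right h4]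
    rwa [h3]
  calc d = 2 * (2⁻¹ * d) := by
        rw [← mul_assoc, ENNReal.mul_inv_cancel (by simp) (by simp), one_mul]
    _ ≤ _ := by gcongr

end IsTriConst

theorem exists_isTriConst {s : ℝ} {p p' : ℝ≥0∞} (hs : 1 / 2 ≤ s) (hp : 1 ≤ p)
    (hpp' : p⁻¹ + p'⁻¹ = 1) (hsp : 1 < p' * ENNReal.ofReal (s + 1 / 4)) {M : ℝ≥0∞} (hM : M ≠ ⊤) :
    ∃ T K, IsTriConst s p T K ∧ K * (3 * M ^ 2) ≤ 2⁻¹ := by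
  obtain ⟨C, hC, hb⟩ := exists_lpN_tri_le hs hp hpp' hsp
  set L : ℝ := 12 * C.toReal * (3 * M.toReal ^ 2) with hL
  have hL0 : 0 ≤ L := by positivity
  -- Chosen so that `L √T = L / (2L + 1) ≤ 1/2` and at the same time `T ≤ 1`.
  set T : ℝ := (1 / (2 * L + 1)) ^ 2 with hT
  have hTs : √T = 1 / (2 * L + 1) := Real.sqrt_sq (by positivity)
  have h1 : 1 / (2 * L + 1) ≤ 1 := by
    rw [div_le_one (by positivity)]; linarith
  refine ⟨T, ENNReal.ofReal (12 * √T) * C,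
    ⟨by linarith, hp, by positivity, pow_le_one₀ (by positivity) h1, C, hC, le_rfl, hb⟩, ?_⟩
  rw [← ENNReal.ofReal_toReal hC, ← ENNReal.ofReal_toReal hM, ← ENNReal.ofReal_mul (by positivity),
    ← ENNReal.ofReal_pow ENNReal.toReal_nonneg, ← ENNReal.ofReal_ofNat 3,
    ← ENNReal.ofReal_mul (by norm_num), ← ENNReal.ofReal_mul (by positivity),
    ← ENNReal.ofReal_ofNat 2, ← ENNReal.ofReal_inv_of_pos (by norm_num)]
  refine ENNReal.ofReal_le_ofReal ?_
  rw [hTs]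
  calc _ = L / (2 * L + 1) := by rw [hL]; ring
    _ ≤ 2⁻¹ := by rw [div_le_iff₀ (by positivity)]; linarith

/-! ### Fourier series of test functions and of periodic distributions -/

/-- The Fourier coefficients of a test function. -/
noncomputable def tc (ψ : TestSpace) (n : ℤ) : ℂ :=
  (2 * Real.pi : ℂ)⁻¹ * ∫ x in (0 : ℝ)..(2 * Real.pi), (ψ : ℝ → ℂ) x * (char (-n) : ℝ → ℂ) x

theorem two_pi_ne_zero' : (2 * Real.pi : ℂ) ≠ 0 := by
  exact_mod_cast Real.two_pi_pos.ne'

theorem char_apply (n : ℤ) (x : ℝ) : (char n : ℝ → ℂ) x = Complex.exp (Complex.I * n * x) := rfl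

theorem norm_char (n : ℤ) (x : ℝ) : ‖(char n : ℝ → ℂ) x‖ = 1 := by
  have := norm_exp_phase n x
  rw [char_apply]
  exact_mod_cast this

theorem char_mul (m n : ℤ) (x : ℝ) :
    (char m : ℝ → ℂ) x * (char n : ℝ → ℂ) x = (char (m + n) : ℝ → ℂ) x := by
  simp only [char_apply, ← Complex.exp_add]
  congr 1; push_cast; ring

theorem continuous_test (ψ : TestSpace) : Continuous (ψ : ℝ → ℂ) := ψ.2.1.continuous

theorem continuous_char (n : ℤ) : Continuous (char n : ℝ → ℂ) := continuous_test _

/-- The derivative of a test function. -/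
noncomputable def der (ψ : TestSpace) : TestSpace :=
  ⟨deriv (ψ : ℝ → ℂ), by
    refine ⟨?_, fun x => ?_⟩
    · simpa using ψ.2.1.iterate_deriv 1
    · have h := deriv_comp_add_const (ψ : ℝ → ℂ) (2 * Real.pi) x
      rw [← h]
      exact congrArg (fun f : ℝ → ℂ => deriv f x) (funext ψ.2.2)⟩

theorem hasDerivAt_test (ψ : TestSpace) (x : ℝ) :
    HasDerivAt (ψ : ℝ → ℂ) ((der ψ : ℝ → ℂ) x) x :=
  ((ψ.2.1.differentiable (by simp)) x).hasDerivAt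

theorem coe_der (ψ : TestSpace) : (der ψ : ℝ → ℂ) = deriv (ψ : ℝ → ℂ) := rfl

theorem iterate_der (k : ℕ) (ψ : TestSpace) : (der^[k] ψ : ℝ → ℂ) = iteratedDeriv k (ψ : ℝ → ℂ) := by
  induction k with
  | zero => simp
  | succ k ih => rw [Function.iterate_succ_apply', coe_der, ih, iteratedDeriv_succ]

/-- The product of two test functions. -/
def mulT (a b : TestSpace) : TestSpace :=
  ⟨fun x => (a : ℝ → ℂ) x * (b : ℝ → ℂ) x, a.2.1.mul b.2.1, fun x => by
    simp only [a.2.2 x, b.2.2 x]⟩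

theorem mulT_apply (a b : TestSpace) (x : ℝ) :
    (mulT a b : ℝ → ℂ) x = (a : ℝ → ℂ) x * (b : ℝ → ℂ) x := rfl

theorem norm_tc_le {ψ : TestSpace} {M : ℝ} (h : ∀ x, ‖(ψ : ℝ → ℂ) x‖ ≤ M) (n : ℤ) :
    ‖tc ψ n‖ ≤ M := by
  have h1 := intervalIntegral.norm_integral_le_of_norm_le_const (a := 0) (b := 2 * Real.pi)
    (C := M) (f := fun x => (ψ : ℝ → ℂ) x * (char (-n) : ℝ → ℂ) x)
    (fun x _ => by rw [norm_mul, norm_char, mul_one]; exact h x)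
  rw [sub_zero, abs_of_pos Real.two_pi_pos] at h1
  have h2 : ‖(2 * Real.pi : ℂ)⁻¹‖ = (2 * Real.pi)⁻¹ := by
    rw [norm_inv, norm_mul, Complex.norm_real, Real.norm_eq_abs, abs_of_pos Real.pi_pos]; simp
  rw [tc, norm_mul, h2, inv_mul_le_iff₀ Real.two_pi_pos]
  linarith

theorem tc_der (ψ : TestSpace) (n : ℤ) : tc (der ψ) n = Complex.I * n * tc ψ n := by
  have h := intervalIntegral.integral_mul_deriv_eq_deriv_mul (a := 0) (b := 2 * Real.pi)
    (u := (char (-n) : ℝ → ℂ)) (v := (ψ : ℝ → ℂ)) (u' := fun x => (der (char (-n)) : ℝ → ℂ) x)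
    (v' := fun x => (der ψ : ℝ → ℂ) x) (fun x _ => hasDerivAt_test _ x)
    (fun x _ => hasDerivAt_test _ x) ((continuous_test _).intervalIntegrable _ _)
    ((continuous_test _).intervalIntegrable _ _)
  have e1 : ∀ x, (der (char (-n)) : ℝ → ℂ) x = -(Complex.I * n) * (char (-n) : ℝ → ℂ) x := by
    intro x
    have h1 : HasDerivAt (fun x : ℝ => Complex.I * ((-n : ℤ) : ℂ) * (x : ℂ))
        (Complex.I * ((-n : ℤ) : ℂ)) x := by
      simpa using (Complex.ofRealCLM.hasDerivAt (x := x)).const_mul (Complex.I * ((-n : ℤ) : ℂ))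
    have h2 := (hasDerivAt_test (char (-n)) x).unique h1.cexp
    rw [h2, char_apply]; push_cast; ring
  have e2 : (ψ : ℝ → ℂ) (2 * Real.pi) = (ψ : ℝ → ℂ) 0 := by simpa using ψ.2.2 0
  have e3 : (char (-n) : ℝ → ℂ) (2 * Real.pi) = (char (-n) : ℝ → ℂ) 0 := by
    simpa using (char (-n)).2.2 0
  rw [e2, e3, sub_self, zero_sub] at h
  have e4 : ∫ x in (0 : ℝ)..(2 * Real.pi), (der (char (-n)) : ℝ → ℂ) x * (ψ : ℝ → ℂ) x
      = -(Complex.I * n) * ∫ x in (0 : ℝ)..(2 * Real.pi),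
        (ψ : ℝ → ℂ) x * (char (-n) : ℝ → ℂ) x := by
    rw [← intervalIntegral.integral_const_mul]
    refine intervalIntegral.integral_congr fun x _ => ?_
    simp only [e1]; ring
  have e5 : ∫ x in (0 : ℝ)..(2 * Real.pi), (der ψ : ℝ → ℂ) x * (char (-n) : ℝ → ℂ) x
      = ∫ x in (0 : ℝ)..(2 * Real.pi), (char (-n) : ℝ → ℂ) x * (der ψ : ℝ → ℂ) x :=
    intervalIntegral.integral_congr fun x _ => mul_comm _ _
  rw [tc, tc, e5, h, e4]
  ring

theorem tc_iterate_der (k : ℕ) (ψ : TestSpace) (n : ℤ) :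
    tc (der^[k] ψ) n = (Complex.I * n) ^ k * tc ψ n := by
  induction k with
  | zero => simp
  | succ k ih => rw [Function.iterate_succ_apply', tc_der, ih]; ring

theorem abs_pow_mul_norm_tc_le {ψ : TestSpace} {k : ℕ} {M : ℝ}
    (h : ∀ x, ‖iteratedDeriv k (ψ : ℝ → ℂ) x‖ ≤ M) (n : ℤ) :
    |(n : ℝ)| ^ k * ‖tc ψ n‖ ≤ M := by
  have h1 := norm_tc_le (ψ := der^[k] ψ) (by rw [iterate_der]; exact h) n
  rw [tc_iterate_der, norm_mul, norm_pow, norm_mul, Complex.norm_I, one_mul,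
    Complex.norm_intCast] at h1
  exact h1

theorem exists_bound_test (ψ : TestSpace) : ∃ M, ∀ x, ‖(ψ : ℝ → ℂ) x‖ ≤ M := by
  obtain ⟨M, hM⟩ := (isCompact_Icc (a := (0 : ℝ)) (b := 2 * Real.pi)).exists_bound_of_continuousOn
    (continuous_test ψ).continuousOn
  refine ⟨M, fun x => ?_⟩
  obtain ⟨y, hy, hxy⟩ := ψ.2.2.exists_mem_Ico₀ Real.two_pi_pos x
  rw [hxy]
  exact hM y ⟨hy.1, hy.2.le⟩

theorem exists_bound_iteratedDeriv (ψ : TestSpace) (k : ℕ) :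
    ∃ M, ∀ x, ‖iteratedDeriv k (ψ : ℝ → ℂ) x‖ ≤ M := by
  rw [← iterate_der]; exact exists_bound_test _

theorem summable_inv_one_add_sq : Summable fun n : ℤ => (1 + (n : ℝ) ^ 2)⁻¹ := by
  have := tsum_jp_ne_top (γ := 1) (by norm_num)
  have h2 := ENNReal.summable_toReal this
  refine h2.congr fun n => ?_
  rw [jp, ENNReal.toReal_ofReal (by positivity), Real.rpow_neg_one]

/-- `∑ (1 + n²)⁻¹`. -/
noncomputable def sumInv : ℝ := ∑' n : ℤ, (1 + (n : ℝ) ^ 2)⁻¹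

theorem abs_pow_mul_norm_tc_le_inv {ψ : TestSpace} {k : ℕ} {M : ℝ}
    (h : ∀ j ≤ k + 2, ∀ x, ‖iteratedDeriv j (ψ : ℝ → ℂ) x‖ ≤ M) (n : ℤ) :
    |(n : ℝ)| ^ k * ‖tc ψ n‖ ≤ 2 * M * (1 + (n : ℝ) ^ 2)⁻¹ := by
  have h1 := abs_pow_mul_norm_tc_le (h k (by omega)) n
  have h2 := abs_pow_mul_norm_tc_le (h (k + 2) le_rfl) n
  rw [← div_eq_mul_inv, le_div_iff₀ (one_add_sq_pos n)]
  rw [pow_add, sq_abs] at h2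
  linarith

theorem summable_abs_pow_mul_norm_tc (ψ : TestSpace) (k : ℕ) :
    Summable fun n : ℤ => |(n : ℝ)| ^ k * ‖tc ψ n‖ := by
  choose M hM using exists_bound_iteratedDeriv ψ
  refine Summable.of_nonneg_of_le (fun n => by positivity)
    (fun n => abs_pow_mul_norm_tc_le_inv (M := ∑ j ∈ Finset.range (k + 3), |M j|)
      (fun j hj x => (hM j x).trans ((le_abs_self _).trans ?_)) n)
    (summable_inv_one_add_sq.mul_left _)
  exact Finset.single_le_sum (f := fun j => |M j|) (fun _ _ => abs_nonneg _)
    (Finset.mem_range.2 (by omega))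

theorem summable_norm_tc (ψ : TestSpace) : Summable fun n : ℤ => ‖tc ψ n‖ := by
  simpa using summable_abs_pow_mul_norm_tc ψ 0

theorem tsum_abs_pow_mul_norm_tc_le {ψ : TestSpace} {k : ℕ} {M : ℝ}
    (h : ∀ j ≤ k + 2, ∀ x, ‖iteratedDeriv j (ψ : ℝ → ℂ) x‖ ≤ M) :
    ∑' n : ℤ, |(n : ℝ)| ^ k * ‖tc ψ n‖ ≤ 2 * M * sumInv := by
  rw [sumInv, ← tsum_mul_left]
  exact (summable_abs_pow_mul_norm_tc ψ k).tsum_le_tsum (abs_pow_mul_norm_tc_le_inv h)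
    (summable_inv_one_add_sq.mul_left _)

theorem hasSum_tc (ψ : TestSpace) (x : ℝ) :
    HasSum (fun n => tc ψ n * (char n : ℝ → ℂ) x) ((ψ : ℝ → ℂ) x) := by
  have : Fact (0 < 2 * Real.pi) := ⟨Real.two_pi_pos⟩
  let F : C(AddCircle (2 * Real.pi), ℂ) :=
    ⟨ψ.2.2.lift, continuous_coinduced_dom.2 (continuous_test ψ)⟩
  have h1 : ∀ n, fourierCoeff F n = tc ψ n := by
    intro n
    rw [fourierCoeff_eq_intervalIntegral F n 0, tc, zero_add]
    rw [Complex.real_smul]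
    congr 1
    · push_cast; rw [one_div]
    · refine intervalIntegral.integral_congr fun y _ => ?_
      simp only [fourier_coe_apply, smul_eq_mul, char_apply, mul_comm (Complex.exp _)]
      congr 2
      push_cast
      field_simp
  have h2 : Summable (fourierCoeff F) := by
    refine Summable.of_norm ((summable_norm_tc ψ).congr fun n => ?_)
    rw [h1]
  have h3 := has_pointwise_sum_fourier_series_of_summable h2 (x : AddCircle (2 * Real.pi))
  convert h3 using 2 with n
  · rw [h1, fourier_coe_apply, smul_eq_mul, char_apply]
    congr 2
    push_cast
    field_simp
  · rfl

theorem tc_add (a b : TestSpace) (n : ℤ) : tc (a + b) n = tc a n + tc b n := by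
  rw [tc, tc, tc, ← mul_add, ← intervalIntegral.integral_add]
  · congr 1
    refine intervalIntegral.integral_congr fun x _ => ?_
    simp [add_mul]
  · exact ((continuous_test a).mul (continuous_char _)).intervalIntegrable _ _
  · exact ((continuous_test b).mul (continuous_char _)).intervalIntegrable _ _

theorem tc_smul (c : ℂ) (a : TestSpace) (n : ℤ) : tc (c • a) n = c * tc a n := by
  have : ∫ x in (0 : ℝ)..(2 * Real.pi), ((c • a : TestSpace) : ℝ → ℂ) x * (char (-n) : ℝ → ℂ) x
      = c * ∫ x in (0 : ℝ)..(2 * Real.pi), (a : ℝ → ℂ) x * (char (-n) : ℝ → ℂ) x := by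
    rw [← intervalIntegral.integral_const_mul]
    refine intervalIntegral.integral_congr fun x _ => ?_
    simp [mul_assoc]
  rw [tc, tc, this, mul_left_comm]

/-- `tc · n` as a linear functional. -/
noncomputable def tcL (n : ℤ) : TestSpace →ₗ[ℂ] ℂ where
  toFun ψ := tc ψ n
  map_add' a b := tc_add a b n
  map_smul' c a := tc_smul c a n

theorem tc_sub (a b : TestSpace) (n : ℤ) : tc (a - b) n = tc a n - tc b n := map_sub (tcL n) a b

theorem tc_sum {ι : Type*} (S : Finset ι) (a : ι → TestSpace) (n : ℤ) :
    tc (∑ i ∈ S, a i) n = ∑ i ∈ S, tc (a i) n := map_sum (tcL n) a S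

theorem tc_mulT_char (a : TestSpace) (m n : ℤ) : tc (mulT a (char m)) n = tc a (n - m) := by
  rw [tc, tc]
  congr 1
  refine intervalIntegral.integral_congr fun x _ => ?_
  simp only [mulT_apply, mul_assoc, char_mul]
  rw [show m + -n = -(n - m) by ring]

theorem integral_eq_tc (a : TestSpace) :
    ∫ x in (0 : ℝ)..(2 * Real.pi), (a : ℝ → ℂ) x = 2 * Real.pi * tc a 0 := by
  rw [tc, mul_inv_cancel_left₀ two_pi_ne_zero']
  refine intervalIntegral.integral_congr fun x _ => ?_
  simp [char_apply]

theorem tc_char (m n : ℤ) : tc (char m) n = if m = n then 1 else 0 := by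
  split_ifs with h
  · subst h
    rw [tc]
    simp only [char_mul, add_neg_cancel]
    simp only [char_apply]
    simp
    field_simp
  · have h1 := tc_der (char m) n
    have h2 : der (char m) = (Complex.I * m) • char m := by
      ext x
      have h3 : HasDerivAt (fun x : ℝ => Complex.I * (m : ℂ) * (x : ℂ)) (Complex.I * m) x := by
        simpa using (Complex.ofRealCLM.hasDerivAt (x := x)).const_mul (Complex.I * (m : ℂ))
      have h4 := (hasDerivAt_test (char m) x).unique h3.cexp
      rw [h4]
      simp [char_apply, mul_comm]
    rw [h2, tc_smul, ← sub_eq_zero, ← sub_mul, mul_eq_zero] at h1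
    refine h1.resolve_left fun h3 => h ?_
    rw [← mul_sub, mul_eq_zero, or_iff_right Complex.I_ne_zero, sub_eq_zero] at h3
    exact_mod_cast h3

theorem norm_test_le_tsum (ψ : TestSpace) (x : ℝ) : ‖(ψ : ℝ → ℂ) x‖ ≤ ∑' n, ‖tc ψ n‖ := by
  rw [← (hasSum_tc ψ x).tsum_eq]
  have e : ∀ n, ‖tc ψ n * (char n : ℝ → ℂ) x‖ = ‖tc ψ n‖ := fun n => by
    rw [norm_mul, norm_char, mul_one]
  refine (norm_tsum_le_tsum_norm ?_).trans_eq (tsum_congr e)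
  simpa only [e] using summable_norm_tc ψ

theorem norm_iteratedDeriv_le_tsum (ψ : TestSpace) (k : ℕ) (x : ℝ) :
    ‖iteratedDeriv k (ψ : ℝ → ℂ) x‖ ≤ ∑' n : ℤ, |(n : ℝ)| ^ k * ‖tc ψ n‖ := by
  rw [← iterate_der]
  refine (norm_test_le_tsum _ x).trans_eq (tsum_congr fun n => ?_)
  rw [tc_iterate_der, norm_mul, norm_pow, norm_mul, Complex.norm_I, one_mul, Complex.norm_intCast]

/-- A partial Fourier sum. -/
noncomputable def partialSum (c : ℤ → ℂ) (S : Finset ℤ) : TestSpace := ∑ n ∈ S, c n • char n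

theorem tc_partialSum (c : ℤ → ℂ) (S : Finset ℤ) (n : ℤ) :
    tc (partialSum c S) n = if n ∈ S then c n else 0 := by
  rw [partialSum, tc_sum]
  simp only [tc_smul, tc_char, mul_ite, mul_one, mul_zero, Finset.sum_ite_eq']

/-- A distribution of order `k` is controlled by derivatives up to order `k`. The corresponding norm
of the remainder of a partial Fourier sum is bounded by a tail of `∑ |n|^j |ψ̂(n)|`, `j ≤ k`, which
tends to zero. Thus distributions are determined by their coefficients. -/
theorem hasSum_distrib (f : Distrib) (ψ : TestSpace) :
    HasSum (fun n => tc ψ n * (f : Module.Dual ℂ TestSpace) (char n))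
      ((f : Module.Dual ℂ TestSpace) ψ) := by
  obtain ⟨C, k, hf⟩ := f.2
  set a : ℤ → ℝ := fun n => ∑ j ∈ Finset.range (k + 1), |(n : ℝ)| ^ j * ‖tc ψ n‖ with ha
  have has : Summable a := summable_sum fun j _ => summable_abs_pow_mul_norm_tc ψ j
  have h0 := tendsto_tsum_compl_atTop_zero a
  rw [HasSum, tendsto_iff_norm_sub_tendsto_zero]
  have h1 : Tendsto (fun S : Finset ℤ => C * ∑' n : { n // n ∉ S }, a n) atTop (𝓝 0) := by
    simpa using h0.const_mul C
  refine squeeze_zero (fun _ => norm_nonneg _) (fun S => ?_) h1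
  have e1 : ∑ n ∈ S, tc ψ n * (f : Module.Dual ℂ TestSpace) (char n)
      = (f : Module.Dual ℂ TestSpace) (partialSum (tc ψ) S) := by
    simp [partialSum, map_sum]
  rw [e1, norm_sub_rev, ← map_sub]
  refine hf _ _ fun j hj x => (norm_iteratedDeriv_le_tsum _ j x).trans ?_
  have e2 : ∀ n, tc (ψ - partialSum (tc ψ) S) n = if n ∈ S then 0 else tc ψ n := fun n => by
    rw [tc_sub, tc_partialSum]; split_ifs <;> simp
  rw [show ∑' n : { n // n ∉ S }, a n = ∑' n, Set.indicator {n | n ∉ S} a n from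
    tsum_subtype {n | n ∉ S} a]
  have hind : Summable (Set.indicator {n | n ∉ S} a) := has.indicator _
  have hle : ∀ n : ℤ, |(n : ℝ)| ^ j * ‖tc (ψ - partialSum (tc ψ) S) n‖
      ≤ Set.indicator {n | n ∉ S} a n := by
    intro n
    rw [e2]
    by_cases hn : n ∈ S
    · simp [hn]
    · simp only [hn, if_false, Set.indicator, Set.mem_ofPred_eq, not_false_eq_true, if_true, ha]
      exact Finset.single_le_sum (f := fun j => |(n : ℝ)| ^ j * ‖tc ψ n‖)
        (fun _ _ => by positivity) (Finset.mem_range.2 (by omega))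
  exact (Summable.of_nonneg_of_le (fun n => by positivity) hle hind).tsum_le_tsum hle hind

theorem distrib_char (f : Distrib) (n : ℤ) :
    (f : Module.Dual ℂ TestSpace) (char n) = 2 * Real.pi * fourierCoef f (-n) := by
  rw [fourierCoef, neg_neg, mul_inv_cancel_left₀ two_pi_ne_zero']

theorem hasSum_distrib_coef (f : Distrib) (ψ : TestSpace) :
    HasSum (fun n => 2 * Real.pi * (fourierCoef f n * tc ψ (-n)))
      ((f : Module.Dual ℂ TestSpace) ψ) := by
  have h := hasSum_distrib f ψ
  rw [← (Equiv.neg ℤ).hasSum_iff] at h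
  convert h using 2 with n
  simp only [Function.comp_apply, Equiv.neg_apply, distrib_char, neg_neg]
  ring

theorem distrib_ext {f g : Distrib} (h : ∀ n, fourierCoef f n = fourierCoef g n) : f = g := by
  refine Subtype.ext (LinearMap.ext fun ψ => ?_)
  refine (hasSum_distrib_coef f ψ).unique ?_
  simp only [h]
  exact hasSum_distrib_coef g ψ

/-- The distribution given by a test function. -/
noncomputable def ofFun (a : TestSpace) : Distrib :=
  ⟨{ toFun := fun ψ => ∫ x in (0 : ℝ)..(2 * Real.pi), (a : ℝ → ℂ) x * (ψ : ℝ → ℂ) x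
     map_add' := fun ψ χ => by
      have hi : ∀ ψ : TestSpace, IntervalIntegrable (fun x => (a : ℝ → ℂ) x * (ψ : ℝ → ℂ) x)
          volume 0 (2 * Real.pi) := fun ψ =>
        ((continuous_test a).mul (continuous_test ψ)).intervalIntegrable _ _
      rw [← intervalIntegral.integral_add (hi ψ) (hi χ)]
      refine intervalIntegral.integral_congr fun x _ => ?_
      simp [mul_add]
     map_smul' := fun c ψ => by
      rw [RingHom.id_apply, smul_eq_mul, ← intervalIntegral.integral_const_mul]
      refine intervalIntegral.integral_congr fun x _ => ?_
      simp [mul_left_comm] }, by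
    obtain ⟨B, hB⟩ := exists_bound_test a
    refine ⟨B * (2 * Real.pi), 0, fun ψ M h => ?_⟩
    have hB0 : 0 ≤ B := (norm_nonneg _).trans (hB 0)
    have := intervalIntegral.norm_integral_le_of_norm_le_const (a := 0) (b := 2 * Real.pi)
      (C := B * M) (f := fun x => (a : ℝ → ℂ) x * (ψ : ℝ → ℂ) x)
      (fun x _ => by
        rw [norm_mul]
        have h1 := h 0 le_rfl x
        rw [iteratedDeriv_zero] at h1
        exact mul_le_mul (hB x) h1 (norm_nonneg _) hB0)
    rw [sub_zero, abs_of_pos Real.two_pi_pos] at this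
    refine this.trans_eq ?_
    ring⟩

theorem ofFun_apply (a ψ : TestSpace) : (ofFun a : Module.Dual ℂ TestSpace) ψ
    = ∫ x in (0 : ℝ)..(2 * Real.pi), (a : ℝ → ℂ) x * (ψ : ℝ → ℂ) x := rfl

theorem fourierCoef_ofFun (a : TestSpace) (n : ℤ) : fourierCoef (ofFun a) n = tc a n := rfl

theorem represents_iff (a : TestSpace) (f : Distrib) :
    Represents (a : ℝ → ℂ) f ↔ f = ofFun a := by
  refine ⟨fun h => Subtype.ext (LinearMap.ext h), ?_⟩
  rintro rfl
  exact fun ψ => rfl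

/-- Parseval's identity. -/
theorem hasSum_parseval (a b : TestSpace) :
    HasSum (fun n => 2 * Real.pi * (tc a n * tc b (-n)))
      (∫ x in (0 : ℝ)..(2 * Real.pi), (a : ℝ → ℂ) x * (b : ℝ → ℂ) x) :=
  hasSum_distrib_coef (ofFun a) b

theorem hasSum_tc_mul (a b : TestSpace) (n : ℤ) :
    HasSum (fun m => tc a m * tc b (n - m)) (tc (mulT a b) n) := by
  have h := (hasSum_parseval a (mulT b (char (-n)))).mul_left (2 * Real.pi : ℂ)⁻¹
  have e : tc (mulT a b) n = (2 * Real.pi : ℂ)⁻¹ *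
      ∫ x in (0 : ℝ)..(2 * Real.pi), (a : ℝ → ℂ) x * (mulT b (char (-n)) : ℝ → ℂ) x := by
    rw [tc]
    congr 1
    refine intervalIntegral.integral_congr fun x _ => ?_
    simp only [mulT_apply]; ring
  have e' : ∀ m : ℤ, -m - -n = n - m := fun m => by ring
  simp only [inv_mul_cancel_left₀ two_pi_ne_zero', tc_mulT_char, e'] at h
  rwa [e]

theorem summable_norm_tc3 (a b d : TestSpace) (n : ℤ) :
    Summable fun q : ℤ × ℤ => ‖tc a q.1 * tc b q.2 * tc d (n - q.1 - q.2)‖ := by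
  obtain ⟨M, hM⟩ := exists_bound_test d
  have h1 := (summable_norm_tc a).mul_of_nonneg (summable_norm_tc b) (fun _ => norm_nonneg _)
    fun _ => norm_nonneg _
  refine Summable.of_nonneg_of_le (fun _ => norm_nonneg _) (fun q => ?_) (h1.mul_right M)
  rw [norm_mul, norm_mul]
  gcongr
  exact norm_tc_le hM _

theorem hasSum_tc_mul3 (a b d : TestSpace) (n : ℤ) :
    HasSum (fun q : ℤ × ℤ => tc a q.1 * tc b q.2 * tc d (n - q.1 - q.2))
      (tc (mulT (mulT a b) d) n) := by
  have hs := (summable_norm_tc3 a b d n).of_norm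
  let e : ℤ × ℤ ≃ ℤ × ℤ :=
    { toFun := fun q => (q.2, q.1 - q.2), invFun := fun q => (q.1 + q.2, q.1)
      left_inv := fun q => by ext <;> simp
      right_inv := fun q => by ext <;> simp }
  have h1 := (e.hasSum_iff (f := fun q : ℤ × ℤ => tc a q.1 * tc b q.2 * tc d (n - q.1 - q.2))
    (a := tc (mulT (mulT a b) d) n)).1
  refine h1 ?_
  have hse := e.summable_iff.2 hs
  have h2 : ∀ m, HasSum (fun k => ((fun q : ℤ × ℤ => tc a q.1 * tc b q.2 * tc d (n - q.1 - q.2)) ∘ e)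
      (m, k)) (tc (mulT a b) m * tc d (n - m)) := by
    intro m
    have e4 : (fun k => ((fun q : ℤ × ℤ => tc a q.1 * tc b q.2 * tc d (n - q.1 - q.2)) ∘ e)
        (m, k)) = fun k => tc a k * tc b (m - k) * tc d (n - m) := by
      ext k
      simp only [Function.comp_apply, e, Equiv.coe_fn_mk]
      congr 2; ring
    rw [e4]
    exact (hasSum_tc_mul a b m).mul_right (tc d (n - m))
  have h3 := hse.hasSum.prod_fiberwise h2
  rw [← h3.unique (hasSum_tc_mul (mulT a b) d n)]
  exact hse.hasSum

theorem summable_ofSeq_bound (ψ : TestSpace) (B : ℝ) :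
    Summable fun n : ℤ => 2 * Real.pi * (B * ((1 + |(n : ℝ)|) * ‖tc ψ n‖)) := by
  have hs1 := summable_abs_pow_mul_norm_tc ψ 1
  simp only [pow_one] at hs1
  refine ((((summable_norm_tc ψ).add hs1).mul_left B).mul_left (2 * Real.pi)).congr fun n => ?_
  ring

theorem norm_ofSeq_term_le {c : ℤ → ℂ} {B : ℝ} (hB : ∀ n : ℤ, ‖c n‖ ≤ B * (1 + |(n : ℝ)|))
    (ψ : TestSpace) (n : ℤ) : ‖2 * Real.pi * (c n * tc ψ (-n))‖
      ≤ ((fun n : ℤ => 2 * Real.pi * (B * ((1 + |(n : ℝ)|) * ‖tc ψ n‖))) ∘ Equiv.neg ℤ) n := by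
  rw [norm_mul, norm_mul, norm_mul, Complex.norm_real, Real.norm_eq_abs, abs_of_pos Real.pi_pos,
    Function.comp_apply, Equiv.neg_apply, ← mul_assoc B]
  simp only [Complex.norm_ofNat, Int.cast_neg, abs_neg]
  gcongr
  exact hB n

/-- The distribution with given Fourier coefficients of at most linear growth. -/
noncomputable def ofSeq (c : ℤ → ℂ) : Distrib := by
  classical
  exact if h : ∃ B, ∀ n, ‖c n‖ ≤ B * (1 + |(n : ℝ)|) then
    ⟨{ toFun := fun ψ => ∑' n, 2 * Real.pi * (c n * tc ψ (-n))
       map_add' := fun ψ χ => by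
        obtain ⟨B, hB⟩ := h
        have hs : ∀ ψ : TestSpace, Summable fun n => 2 * Real.pi * (c n * tc ψ (-n)) := fun ψ =>
          Summable.of_norm_bounded ((Equiv.neg ℤ).summable_iff.2 (summable_ofSeq_bound ψ B))
            (norm_ofSeq_term_le hB ψ)
        rw [← (hs ψ).tsum_add (hs χ)]
        exact tsum_congr fun n => by rw [tc_add]; ring
       map_smul' := fun a ψ => by
        rw [RingHom.id_apply, smul_eq_mul, ← tsum_mul_left]
        exact tsum_congr fun n => by rw [tc_smul]; ring }, by
      obtain ⟨B, hB⟩ := h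
      have hB0 : 0 ≤ B := by simpa using (norm_nonneg _).trans (hB 0)
      refine ⟨2 * Real.pi * B * (4 * sumInv), 3, fun ψ M hM => ?_⟩
      have h0 := tsum_abs_pow_mul_norm_tc_le (k := 0) fun j hj => hM j (by omega)
      have h1 := tsum_abs_pow_mul_norm_tc_le (k := 1) hM
      simp only [pow_zero, one_mul, pow_one] at h0 h1
      have hs1 := summable_abs_pow_mul_norm_tc ψ 1
      simp only [pow_one] at hs1
      calc ‖∑' n, 2 * Real.pi * (c n * tc ψ (-n))‖
          ≤ ∑' n : ℤ, ((fun n : ℤ => 2 * Real.pi * (B * ((1 + |(n : ℝ)|) * ‖tc ψ n‖)))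
              ∘ Equiv.neg ℤ) n :=
            tsum_of_norm_bounded ((Equiv.neg ℤ).summable_iff.2 (summable_ofSeq_bound ψ B)).hasSum
              (norm_ofSeq_term_le hB ψ)
        _ = 2 * Real.pi * B * (∑' n, ‖tc ψ n‖ + ∑' n : ℤ, |(n : ℝ)| * ‖tc ψ n‖) := by
            rw [← (summable_norm_tc ψ).tsum_add hs1, ← tsum_mul_left]
            refine ((Equiv.neg ℤ).tsum_eq fun n : ℤ => 2 * Real.pi * (B * ((1 + |(n : ℝ)|) *
              ‖tc ψ n‖))).trans (tsum_congr fun n => by ring)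
        _ ≤ 2 * Real.pi * B * (2 * M * sumInv + 2 * M * sumInv) := by gcongr
        _ = _ := by ring⟩
  -- A junk value: the sequences used below are bounded for solutions and of linear growth for the
  -- nonlinearity.
  else 0

theorem ofSeq_apply {c : ℤ → ℂ} (h : ∃ B, ∀ n : ℤ, ‖c n‖ ≤ B * (1 + |(n : ℝ)|)) (ψ : TestSpace) :
    (ofSeq c : Module.Dual ℂ TestSpace) ψ = ∑' n, 2 * Real.pi * (c n * tc ψ (-n)) := by
  rw [ofSeq, dif_pos h]; rfl

theorem fourierCoef_ofSeq {c : ℤ → ℂ} (h : ∃ B, ∀ n : ℤ, ‖c n‖ ≤ B * (1 + |(n : ℝ)|)) (n : ℤ) :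
    fourierCoef (ofSeq c) n = c n := by
  rw [fourierCoef, ofSeq_apply h, tsum_eq_single n]
  · rw [tc_char, if_pos rfl, mul_one, inv_mul_cancel_left₀ two_pi_ne_zero']
  · intro m hm
    rw [tc_char, if_neg (by simpa using hm.symm)]; simp

theorem conj_intervalIntegral (f : ℝ → ℂ) (a b : ℝ) :
    starRingEnd ℂ (∫ x in a..b, f x) = ∫ x in a..b, starRingEnd ℂ (f x) := by
  simp only [intervalIntegral, map_sub, integral_conj]

theorem tc_neg_of_real {ψ : TestSpace} (h : ∀ x, ((ψ : ℝ → ℂ) x).im = 0) (n : ℤ) :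
    tc ψ (-n) = starRingEnd ℂ (tc ψ n) := by
  rw [tc, tc, map_mul, conj_intervalIntegral]
  congr 1
  · simp [map_ofNat]
  · refine intervalIntegral.integral_congr fun x _ => ?_
    simp only [map_mul, Complex.conj_eq_iff_im.2 (h x), char_apply, ← Complex.exp_conj]
    congr 2
    simp

/-- Testing on the real functions `2 cos nx` and `-2 sin nx` yields the symmetry of the
coefficients. Conversely, the symmetry makes the Parseval sum invariant under conjugation. -/
theorem isReal_iff {f : Distrib} :
    IsReal f ↔ ∀ n, fourierCoef f (-n) = starRingEnd ℂ (fourierCoef f n) := by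
  constructor
  · intro hf n
    have hconj : ∀ x, (char (-n) : ℝ → ℂ) x = starRingEnd ℂ ((char n : ℝ → ℂ) x) := fun x => by
      rw [char_apply, char_apply, ← Complex.exp_conj]; simp
    have h1 := hf (char n + char (-n)) (fun x => by
      simp only [Submodule.coe_add, Pi.add_apply, hconj, Complex.add_im, Complex.conj_im,
        add_neg_cancel])
    have h2 := hf (Complex.I • (char n - char (-n))) (fun x => by
      simp [hconj])
    simp only [map_add, map_smul, map_sub, smul_eq_mul, Complex.add_im, Complex.mul_im,
      Complex.I_re, Complex.I_im, zero_mul, one_mul, zero_add, Complex.sub_re] at h1 h2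
    rw [fourierCoef, fourierCoef, neg_neg, map_mul]
    congr 1
    · simp [map_ofNat]
    · apply Complex.ext
      · rw [Complex.conj_re]; linarith
      · rw [Complex.conj_im]; linarith
  · intro h ψ hψ
    have h1 := hasSum_distrib_coef f ψ
    have h2 := (h1.map (starRingEnd ℂ) Complex.continuous_conj)
    rw [← (Equiv.neg ℤ).hasSum_iff] at h2
    refine Complex.conj_eq_iff_im.1 (h2.unique ?_)
    convert h1 using 2 with n
    simp only [Function.comp_apply, Equiv.neg_apply, map_mul, neg_neg]
    rw [h n, ← tc_neg_of_real hψ]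
    simp [map_ofNat]

theorem flNorm_eq (s : ℝ) (p : ℝ≥0∞) (f : Distrib) :
    flNorm s p f = wN s p (fun _ => 1) fun n => ‖fourierCoef f n‖ₑ := by
  rw [flNorm, wN, lpN]
  refine eLpNorm_congr_enorm_ae (Eventually.of_forall fun n => ?_)
  rw [enorm_mul, one_mul, enorm_eq_self]
  congr 1
  rw [jp, ← ofReal_norm, Complex.norm_real, Real.norm_of_nonneg (by positivity)]

theorem fourierCoef_sub (f g : Distrib) (n : ℤ) :
    fourierCoef (f - g) n = fourierCoef f n - fourierCoef g n := by
  simp [fourierCoef, mul_sub]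

theorem flNorm_sub_le {s : ℝ} {p : ℝ≥0∞} (hp : 1 ≤ p) (f g h : Distrib) :
    flNorm s p (f - h) ≤ flNorm s p (f - g) + flNorm s p (g - h) := by
  simp only [flNorm_eq]
  refine (wN_mono fun n => ?_).trans (wN_add_le hp _ _)
  simp only [fourierCoef_sub]
  rw [← sub_add_sub_cancel _ (fourierCoef g n)]
  exact enorm_add_le _ _

theorem flNorm_le_add {s : ℝ} {p : ℝ≥0∞} (hp : 1 ≤ p) (f g : Distrib) :
    flNorm s p f ≤ flNorm s p (f - g) + flNorm s p g := by
  have := flNorm_sub_le (s := s) hp f g 0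
  simpa using this

theorem flNorm_sub_comm (s : ℝ) (p : ℝ≥0∞) (f g : Distrib) :
    flNorm s p (f - g) = flNorm s p (g - f) := by
  simp only [flNorm_eq, fourierCoef_sub]
  congr 1; ext n; rw [enorm_sub_rev]

theorem enorm_fourierCoef_le {s : ℝ} {p : ℝ≥0∞} (hs : 0 ≤ s) (hp : 1 ≤ p) (f : Distrib) (n : ℤ) :
    ‖fourierCoef f n‖ₑ ≤ flNorm s p f := by
  rw [flNorm_eq]
  exact le_wN hs hp isWeight_one (fun n => ‖fourierCoef f n‖ₑ) n

/-! ### Fourier coefficients of the nonlinearity and resonant cancellation -/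

/-- The nonlinearity as a test function. -/
noncomputable def nonT (v : TestSpace) : TestSpace :=
  mulT (mulT v v) (der v) - tc (mulT v v) 0 • der v

theorem nonlin_eq_nonT (v : TestSpace) (x : ℝ) :
    nonlin (v : ℝ → ℂ) x = (nonT v : ℝ → ℂ) x := by
  have h : ((2 * Real.pi)⁻¹ : ℝ) • ∫ y in (0 : ℝ)..(2 * Real.pi), (v : ℝ → ℂ) y ^ 2
      = tc (mulT v v) 0 := by
    have := integral_eq_tc (mulT v v)
    simp only [mulT_apply, ← sq] at this
    rw [this, Complex.real_smul]
    push_cast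
    rw [inv_mul_cancel_left₀ two_pi_ne_zero']
  rw [nonlin, h]
  simp only [nonT, Submodule.coe_sub, Submodule.coe_smul, Pi.sub_apply, Pi.smul_apply, mulT_apply,
    coe_der, smul_eq_mul]
  ring

/-- `v² v'` is one third of `(v³)'`; this is the origin of the factor `1/3` in `coef`. -/
theorem tc_mul_mul_der (v : TestSpace) (n : ℤ) :
    tc (mulT (mulT v v) (der v)) n = Complex.I * n / 3 * tc (mulT (mulT v v) v) n := by
  have h : der (mulT (mulT v v) v) = (3 : ℂ) • mulT (mulT v v) (der v) := by
    ext x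
    have h1 := hasDerivAt_test v x
    have h2 := (hasDerivAt_test (mulT (mulT v v) v) x).unique ((h1.mul h1).mul h1)
    rw [h2]
    simp only [Submodule.coe_smul, Pi.smul_apply, mulT_apply, smul_eq_mul, Pi.mul_apply]
    ring
  have h3 := tc_der (mulT (mulT v v) v) n
  rw [h, tc_smul] at h3
  rw [eq_comm, div_mul_eq_mul_div, div_eq_iff (by norm_num), ← h3]
  ring

theorem tc_nonT (v : TestSpace) (n : ℤ) : tc (nonT v) n
    = Complex.I * n / 3 * tc (mulT (mulT v v) v) n - tc (mulT v v) 0 * (Complex.I * n * tc v n) := by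
  rw [nonT, tc_sub, tc_smul, tc_der, tc_mul_mul_der]

/-- Inclusion–exclusion for the complement of the three resonant lines `n₁ = n`, `n₂ = n`, `n₃ = n`,
the last of which is `n₁ + n₂ = 0`. Pairwise intersections are single points, and no point lies on
all three lines because `n ≠ 0`. The final summand is the diagonal coefficient. -/
theorem coef_eq {n : ℤ} (hn : n ≠ 0) (q : ℤ × ℤ) : coef q.1 q.2 (n - q.1 - q.2)
    = -(Complex.I * n / 3) * (1 - (if q.1 = n then 1 else 0) - (if q.2 = n then 1 else 0)
        - (if q.1 + q.2 = 0 then 1 else 0) + (if q = (n, n) then 1 else 0)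
        + (if q = (n, -n) then 1 else 0) + (if q = (-n, n) then 1 else 0))
      + Complex.I * n * (if q = (n, n) then 1 else 0) := by
  obtain ⟨a, b⟩ := q
  simp only [coef, Prod.mk.injEq]
  have hr : res a b (n - a - b) = (n - a) * (n - b) * (a + b) := by rw [res]; ring
  rw [show a + b + (n - a - b) = n by ring, hr]
  by_cases ha : a = n
  · subst ha
    by_cases hb : b = a
    · subst hb
      have h1 : b + b ≠ 0 := by omega
      have h2 : b ≠ -b := by omega
      have h3 : b - b - b = -b := by ring
      simp [h1, h2]
    · by_cases hb' : b = -a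
      · subst hb'
        simp [hb, Ne.symm hb]
      · have h1 : a + b ≠ 0 := by omega
        simp [hb, hb', h1, Ne.symm hb]
  · by_cases hb : b = n
    · subst hb
      by_cases ha' : a = -b
      · subst ha'
        simp [ha]
      · have h1 : a + b ≠ 0 := by omega
        simp [ha, ha', h1]
    · by_cases hab : a + b = 0
      · have h1 : ¬(a = b ∧ n - a - b = -a) := by omega
        have h2 : a ≠ n ∧ b ≠ n := ⟨ha, hb⟩
        simp [ha, hb, hab, h1]
      · have h1 : n - a ≠ 0 := by omega
        have h2 : n - b ≠ 0 := by omega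
        simp [ha, hb, hab, h1, h2]

theorem hasSum_of_eq {ι : Type*} {f g : ι → ℂ} {a b : ℂ} (h : HasSum f a) (hf : ∀ i, g i = f i)
    (hb : b = a) : HasSum g b := by
  rw [hb, show g = f from funext hf]; exact h

/-- The Fourier coefficients of the nonlinearity. -/
theorem hasSum_nonT (v : TestSpace) (n : ℤ) :
    HasSum (fun q : ℤ × ℤ => coef q.1 q.2 (n - q.1 - q.2)
      * (tc v q.1 * tc v q.2 * tc v (n - q.1 - q.2))) (-tc (nonT v) n) := by
  by_cases hn : n = 0
  · subst hn
    have h1 : ∀ q : ℤ × ℤ, coef q.1 q.2 (0 - q.1 - q.2) = 0 := by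
      intro q
      rw [coef]
      split_ifs with h1 h2
      · rw [show q.1 + q.2 + (0 - q.1 - q.2) = 0 by ring]; simp
      · have : q.1 = 0 := by omega
        simp [this]
      · rfl
    simp only [h1, zero_mul, tc_nonT]
    simp
  set P : ℤ × ℤ → ℂ := fun q => tc v q.1 * tc v q.2 * tc v (n - q.1 - q.2) with hP
  have hall : HasSum P (tc (mulT (mulT v v) v) n) := hasSum_tc_mul3 v v v n
  have hS := (hasSum_tc_mul v v 0).mul_left (tc v n)
  have h1 : HasSum (fun q : ℤ × ℤ => if q.1 = n then P q else 0) (tc v n * tc (mulT v v) 0) := by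
    rw [← Function.Injective.hasSum_iff (g := fun m : ℤ => (n, m))
      (fun a b h => by simpa using h)]
    · refine hasSum_of_eq hS (fun m => ?_) rfl
      simp [hP, mul_assoc]
    · rintro ⟨a, b⟩ h
      refine if_neg fun h' => h ⟨b, ?_⟩
      simp at h'; simp [h']
  have h2 : HasSum (fun q : ℤ × ℤ => if q.2 = n then P q else 0) (tc v n * tc (mulT v v) 0) := by
    rw [← Function.Injective.hasSum_iff (g := fun m : ℤ => (m, n))
      (fun a b h => by simpa using h)]
    · refine hasSum_of_eq hS (fun m => ?_) rfl
      simp only [Function.comp_apply, if_true, hP]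
      rw [show n - m - n = 0 - m by ring]; ring
    · rintro ⟨a, b⟩ h
      refine if_neg fun h' => h ⟨a, ?_⟩
      simp at h'; simp [h']
  have h3 : HasSum (fun q : ℤ × ℤ => if q.1 + q.2 = 0 then P q else 0)
      (tc v n * tc (mulT v v) 0) := by
    rw [← Function.Injective.hasSum_iff (g := fun m : ℤ => (m, -m))
      (fun a b h => by simpa using (Prod.ext_iff.1 h).1)]
    · refine hasSum_of_eq hS (fun m => ?_) rfl
      simp only [Function.comp_apply, add_neg_cancel, if_true, hP]
      rw [show n - m - -m = n by ring, zero_sub]; ring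
    · rintro ⟨a, b⟩ h
      refine if_neg fun h' => h ⟨a, ?_⟩
      simp only [Prod.mk.injEq, true_and]
      simp only at h'
      omega
  have hsingle : ∀ q₀ : ℤ × ℤ, HasSum (fun q : ℤ × ℤ => if q = q₀ then P q else 0) (P q₀) := by
    intro q₀
    refine hasSum_of_eq (hasSum_single (f := fun q : ℤ × ℤ => if q = q₀ then P q else 0) q₀
      (fun q hq => if_neg hq)) (fun _ => rfl) ?_
    simp
  -- Each resonant line sums to `v̂(n)` times the mean of `v²`, and the three together reproduce the
  -- subtracted mean term. The three intersection points contribute `-i n v̂(n)² v̂(-n)`, which the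
  -- diagonal coefficient cancels.
  have key := ((((((hall.sub h1).sub h2).sub h3).add (hsingle (n, n))).add (hsingle (n, -n))).add
    (hsingle (-n, n))).mul_left (-(Complex.I * n / 3)) |>.add
    ((hsingle (n, n)).mul_left (Complex.I * n))
  refine hasSum_of_eq key (fun q => ?_) ?_
  · rw [coef_eq hn]
    simp only [mul_ite, mul_zero]
    split_ifs <;> ring
  · rw [tc_nonT]
    simp only [hP]
    rw [show n - n - n = -n by ring, show n - n - -n = n by ring, show n - -n - n = n by ring]
    ring

/-! ### Rapidly decreasing coefficients and smooth real functions -/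

/-- Uniformly rapidly decreasing families of sequences. -/
def Rapid {ι : Type*} (S : Set ι) (c : ℤ → ι → ℂ) : Prop :=
  ∀ k : ℕ, ∃ B : ℝ, 0 ≤ B ∧ ∀ n : ℤ, ∀ t ∈ S, (1 + |(n : ℝ)|) ^ k * ‖c n t‖ ≤ B

theorem abs_pow_mul_le_inv {k : ℕ} {B y : ℝ} (n : ℤ) (hy : 0 ≤ y)
    (h : (1 + |(n : ℝ)|) ^ (k + 2) * y ≤ B) :
    (1 + |(n : ℝ)|) ^ k * y ≤ B * (1 + (n : ℝ) ^ 2)⁻¹ := by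
  rw [← div_eq_mul_inv, le_div_iff₀ (one_add_sq_pos n)]
  refine le_trans ?_ h
  have h1 : 1 + (n : ℝ) ^ 2 ≤ (1 + |(n : ℝ)|) ^ 2 := by
    nlinarith [abs_nonneg (n : ℝ), sq_abs (n : ℝ)]
  calc (1 + |(n : ℝ)|) ^ k * y * (1 + (n : ℝ) ^ 2)
      ≤ (1 + |(n : ℝ)|) ^ k * y * (1 + |(n : ℝ)|) ^ 2 := by gcongr
    _ = _ := by ring

theorem Rapid.exists_le_inv {ι : Type*} {S : Set ι} {c : ℤ → ι → ℂ} (h : Rapid S c) (k : ℕ) :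
    ∃ B : ℝ, 0 ≤ B ∧ ∀ n : ℤ, ∀ t ∈ S,
      (1 + |(n : ℝ)|) ^ k * ‖c n t‖ ≤ B * (1 + (n : ℝ) ^ 2)⁻¹ := by
  obtain ⟨B, hB0, hB⟩ := h (k + 2)
  exact ⟨B, hB0, fun n t ht => abs_pow_mul_le_inv n (norm_nonneg _) (hB n t ht)⟩

theorem rapid_tc (ψ : TestSpace) : Rapid Set.univ fun n (_ : Unit) => tc ψ n := by
  intro k
  choose M hM using exists_bound_iteratedDeriv ψ
  refine ⟨2 ^ k * (|M 0| + |M k|), by positivity, fun n t _ => ?_⟩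
  have h0 := abs_pow_mul_norm_tc_le (hM 0) n
  have h1 := abs_pow_mul_norm_tc_le (hM k) n
  rw [pow_zero, one_mul] at h0
  calc (1 + |(n : ℝ)|) ^ k * ‖tc ψ n‖ ≤ 2 ^ k * (1 + |(n : ℝ)| ^ k) * ‖tc ψ n‖ := by
        gcongr
        refine (add_pow_le zero_le_one (abs_nonneg _) k).trans ?_
        rw [one_pow]
        gcongr
        · norm_num
        · omega
    _ = 2 ^ k * (‖tc ψ n‖ + |(n : ℝ)| ^ k * ‖tc ψ n‖) := by ring
    _ ≤ _ := by
        gcongr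
        · exact h0.trans (le_abs_self _)
        · exact h1.trans (le_abs_self _)

theorem der_smul_char (c : ℂ) (n : ℤ) : der (c • char n) = (c * (Complex.I * n)) • char n := by
  ext x
  refine (hasDerivAt_test (c • char n) x).unique ?_
  have h : HasDerivAt (fun x : ℝ => Complex.exp (Complex.I * n * x))
      (Complex.exp (Complex.I * n * x) * (Complex.I * n * 1)) x :=
    ((Complex.ofRealCLM.hasDerivAt (x := x)).const_mul (Complex.I * n)).cexp
  have h2 := h.const_mul c
  refine (h2.congr_deriv ?_ : HasDerivAt (fun x : ℝ => c * Complex.exp (Complex.I * n * x)) _ x)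
  change _ = c * (Complex.I * n) * Complex.exp (Complex.I * n * x)
  ring

theorem iterate_der_smul_char (k : ℕ) (c : ℂ) (n : ℤ) :
    der^[k] (c • char n) = (c * (Complex.I * n) ^ k) • char n := by
  induction k with
  | zero => simp
  | succ k ih => rw [Function.iterate_succ_apply', ih, der_smul_char, pow_succ, mul_assoc]

theorem exists_test_of_rapid {c : ℤ → ℂ} (h : Rapid Set.univ fun n (_ : Unit) => c n) :
    ∃ ψ : TestSpace, ∀ n, tc ψ n = c n := by
  have hb : ∀ k : ℕ, ∃ B : ℝ, ∀ n : ℤ, |(n : ℝ)| ^ k * ‖c n‖ ≤ B * (1 + (n : ℝ) ^ 2)⁻¹ := by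
    intro k
    obtain ⟨B, -, hB⟩ := h.exists_le_inv k
    refine ⟨B, fun n => le_trans ?_ (hB n () trivial)⟩
    gcongr
    linarith
  choose B hB using hb
  set F : ℝ → ℂ := fun x => ∑' n : ℤ, ((c n • char n : TestSpace) : ℝ → ℂ) x with hF
  have hsum : ∀ k : ℕ, Summable fun n : ℤ => B k * (1 + (n : ℝ) ^ 2)⁻¹ := fun k =>
    summable_inv_one_add_sq.mul_left _
  have hFs : ContDiff ℝ ∞ F := by
    refine contDiff_tsum (v := fun k (n : ℤ) => B k * (1 + (n : ℝ) ^ 2)⁻¹)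
      (fun n => (c n • char n : TestSpace).2.1) (fun k _ => hsum k) fun k (n : ℤ) x _ => ?_
    rw [norm_iteratedFDeriv_eq_norm_iteratedDeriv, ← iterate_der, iterate_der_smul_char]
    refine le_trans (le_of_eq ?_) (hB k n)
    rw [Submodule.coe_smul, Pi.smul_apply, norm_smul, norm_char, mul_one, norm_mul, norm_pow,
      norm_mul, Complex.norm_I, one_mul, Complex.norm_intCast, mul_comm]
  refine ⟨⟨F, hFs, fun x => tsum_congr fun n => (c n • char n : TestSpace).2.2 x⟩, fun n => ?_⟩
  have hs := intervalIntegral.hasSum_integral_of_dominated_convergence (μ := volume)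
    (a := 0) (b := 2 * Real.pi)
    (F := fun m x => ((c m • char m : TestSpace) : ℝ → ℂ) x * (char (-n) : ℝ → ℂ) x)
    (f := fun x => F x * (char (-n) : ℝ → ℂ) x) (fun m _ => B 0 * (1 + (m : ℝ) ^ 2)⁻¹)
    (fun m => ((continuous_test _).mul (continuous_test _)).aestronglyMeasurable)
    (fun m => Eventually.of_forall fun x _ => by
      have := hB 0 m
      rw [pow_zero, one_mul] at this
      rwa [norm_mul, norm_char, mul_one, Submodule.coe_smul, Pi.smul_apply, norm_smul, norm_char,
        mul_one])
    (Eventually.of_forall fun x _ => hsum 0) intervalIntegrable_const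
    (Eventually.of_forall fun x _ => by
      refine HasSum.mul_right _ (Summable.hasSum ?_)
      refine Summable.of_norm_bounded (hsum 0) fun m => ?_
      have := hB 0 m
      rw [pow_zero, one_mul] at this
      rwa [Submodule.coe_smul, Pi.smul_apply, norm_smul, norm_char, mul_one])
  have hs2 := hs.mul_left (2 * Real.pi : ℂ)⁻¹
  refine hs2.unique (hasSum_of_eq (hasSum_ite_eq n (c n)) (fun m => ?_) rfl)
  have := tc_smul (c m) (char m) n
  rw [tc] at this
  rw [this, tc_char]
  split_ifs with h1 <;> simp [h1]

theorem iteratedDeriv_ofReal {g : ℝ → ℝ} (hg : ContDiff ℝ ∞ g) (k : ℕ) (x : ℝ) :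
    iteratedDeriv k (fun x => (g x : ℂ)) x = (iteratedDeriv k g x : ℝ) := by
  induction k generalizing x with
  | zero => simp
  | succ k ih =>
    rw [iteratedDeriv_succ, iteratedDeriv_succ, show iteratedDeriv k (fun x => (g x : ℂ))
      = fun x => ((iteratedDeriv k g x : ℝ) : ℂ) from funext ih]
    have h : DifferentiableAt ℝ (iteratedDeriv k g) x :=
      (hg.differentiable_iteratedDeriv k (by exact_mod_cast ENat.natCast_lt_top k)) x
    exact h.hasDerivAt.ofReal_comp.deriv

theorem nonlin_ofReal {g : ℝ → ℝ} (hg : ContDiff ℝ ∞ g) (x : ℝ) :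
    nonlin (fun x => (g x : ℂ)) x = (nonlin g x : ℝ) := by
  have h := iteratedDeriv_ofReal hg 1 x
  rw [iteratedDeriv_one, iteratedDeriv_one] at h
  simp only [nonlin, h, ← Complex.ofReal_pow, intervalIntegral.integral_ofReal]
  push_cast [Complex.real_smul, smul_eq_mul]
  rfl

theorem exists_test_of_real {g : ℝ → ℝ} (hg : ContDiff ℝ ∞ g)
    (hp : Function.Periodic g (2 * Real.pi)) :
    ∃ ψ : TestSpace, (ψ : ℝ → ℂ) = fun x => (g x : ℂ) :=
  ⟨⟨fun x => (g x : ℂ), Complex.ofRealCLM.contDiff.comp hg, fun x => by simp only [hp x]⟩, rfl⟩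

theorem real_of_tc {ψ : TestSpace} (h : ∀ n, tc ψ (-n) = starRingEnd ℂ (tc ψ n)) (x : ℝ) :
    (((ψ : ℝ → ℂ) x).re : ℂ) = (ψ : ℝ → ℂ) x := by
  rw [← Complex.conj_eq_iff_re]
  have h1 := hasSum_tc ψ x
  have h2 := Complex.hasSum_conj'.2 h1
  have h3 := (Equiv.neg ℤ).hasSum_iff.2 h1
  refine HasSum.unique ?_ h3
  refine hasSum_of_eq h2 (fun n => ?_) rfl
  simp only [Function.comp_apply, Equiv.neg_apply, h, map_mul]
  congr 1
  rw [char_apply, char_apply, ← Complex.exp_conj]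
  simp

theorem norm_coef_le (n : ℤ) (q : ℤ × ℤ) : ‖coef q.1 q.2 (n - q.1 - q.2)‖ ≤ |(n : ℝ)| := by
  rw [coef]
  split_ifs with h1 h2
  · rw [norm_neg, norm_div, norm_mul, Complex.norm_I, one_mul, Complex.norm_intCast]
    rw [show q.1 + q.2 + (n - q.1 - q.2) = n by ring]
    have := abs_nonneg (n : ℝ)
    norm_num
    linarith
  · rw [norm_mul, Complex.norm_I, one_mul, Complex.norm_intCast, show n = q.1 by omega]
  · simp

/-! ### From rapidly decreasing profiles to classical solutions -/

/-- The propagator of the Airy equation on the `n`-th mode. -/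
noncomputable def airy (n : ℤ) (t : ℝ) : ℂ := Complex.exp (Complex.I * ((n : ℝ) ^ 3 : ℝ) * t)

theorem norm_airy (n : ℤ) (t : ℝ) : ‖airy n t‖ = 1 := norm_exp_phase _ t

theorem airy_zero (n : ℤ) : airy n 0 = 1 := by simp [airy]

theorem hasDerivAt_airy (n : ℤ) (t : ℝ) :
    HasDerivAt (airy n) (Complex.I * (n : ℂ) ^ 3 * airy n t) t := by
  have h : HasDerivAt (fun t : ℝ => Complex.exp (Complex.I * ((n : ℝ) ^ 3 : ℝ) * t))
      (Complex.exp (Complex.I * ((n : ℝ) ^ 3 : ℝ) * t) * (Complex.I * ((n : ℝ) ^ 3 : ℝ) * 1)) t :=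
    ((Complex.ofRealCLM.hasDerivAt (x := t)).const_mul (Complex.I * ((n : ℝ) ^ 3 : ℝ))).cexp
  refine h.congr_deriv ?_
  rw [airy]; push_cast; ring

theorem continuous_airy (n : ℤ) : Continuous (airy n) :=
  continuous_iff_continuousAt.2 fun t => (hasDerivAt_airy n t).continuousAt

theorem airy_neg (n : ℤ) (t : ℝ) : airy (-n) t = starRingEnd ℂ (airy n t) := by
  rw [airy, airy, ← Complex.exp_conj]
  congr 1
  simp [Odd.neg_pow (by decide : Odd 3)]

theorem airy_mul_phase (n : ℤ) (q : ℤ × ℤ) (t : ℝ) :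
    airy n t * Complex.exp (Complex.I * phase q.1 q.2 (n - q.1 - q.2) * t)
      = airy q.1 t * airy q.2 t * airy (n - q.1 - q.2) t := by
  simp only [airy, ← Complex.exp_add, phase, res]
  congr 1
  push_cast
  ring

/-- A smooth solution in the interaction picture. -/
structure IsProfile (T : ℝ) (v : ℤ → ℝ → ℂ) : Prop where
  pos : 0 < T
  cont : ∀ n, ContinuousOn (v n) (Set.Icc 0 T)
  rapid : Rapid (Set.Icc 0 T) v
  real : ∀ n, ∀ t ∈ Set.Icc 0 T, v (-n) t = starRingEnd ℂ (v n t)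
  eqn : ∀ n, ∀ t ∈ Set.Icc 0 T, v n t = v n 0 + duh v v v n t

/-- `1 + |n|` is at most the product of the `1 + |n_i|`, so three powers on each input pay for the
factor `(1 + n²)|n|`. The majorant is summable and independent of `n` and of time, which justifies
integrating and differentiating term by term. -/
theorem Rapid.exists_cubic_bound {ι : Type*} {S : Set ι} {v : ℤ → ι → ℂ} (h : Rapid S v) :
    ∃ s : ℤ × ℤ → ℝ, Summable s ∧ ∀ (n : ℤ) q, ∀ t ∈ S, (1 + (n : ℝ) ^ 2) *
      (|(n : ℝ)| * ‖v q.1 t * v q.2 t * v (n - q.1 - q.2) t‖) ≤ s q := by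
  obtain ⟨B, hB0, hB⟩ := h.exists_le_inv 3
  obtain ⟨C, hC0, hC⟩ := h 3
  refine ⟨fun q => (B * (1 + (q.1 : ℝ) ^ 2)⁻¹) * (B * (1 + (q.2 : ℝ) ^ 2)⁻¹) * C, ?_, ?_⟩
  · exact ((summable_inv_one_add_sq.mul_left B).mul_of_nonneg (summable_inv_one_add_sq.mul_left B)
      (fun _ => by positivity) fun _ => by positivity).mul_right C
  · intro n q t ht
    set a := q.1
    set b := q.2
    set c := n - a - b with hc
    have h1 : (1 + (n : ℝ) ^ 2) * |(n : ℝ)| ≤ (1 + |(n : ℝ)|) ^ 3 := by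
      nlinarith [abs_nonneg (n : ℝ), sq_abs (n : ℝ), sq_nonneg (n : ℝ)]
    have h2 : 1 + |(n : ℝ)| ≤ (1 + |(a : ℝ)|) * (1 + |(b : ℝ)|) * (1 + |(c : ℝ)|) := by
      have e : (n : ℝ) = a + b + c := by rw [hc]; push_cast; ring
      have h3 : |(n : ℝ)| ≤ |(a : ℝ)| + |(b : ℝ)| + |(c : ℝ)| := by
        rw [e]; exact abs_add_three _ _ _
      have ha := abs_nonneg (a : ℝ)
      have hb := abs_nonneg (b : ℝ)
      have hc := abs_nonneg (c : ℝ)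
      nlinarith [mul_nonneg ha hb, mul_nonneg hb hc, mul_nonneg ha hc,
        mul_nonneg (mul_nonneg ha hb) hc]
    rw [norm_mul, norm_mul, ← mul_assoc]
    calc (1 + (n : ℝ) ^ 2) * |(n : ℝ)| * (‖v a t‖ * ‖v b t‖ * ‖v c t‖)
        ≤ ((1 + |(a : ℝ)|) * (1 + |(b : ℝ)|) * (1 + |(c : ℝ)|)) ^ 3 *
          (‖v a t‖ * ‖v b t‖ * ‖v c t‖) := by
          gcongr
          exact h1.trans (by gcongr)
      _ = ((1 + |(a : ℝ)|) ^ 3 * ‖v a t‖) * ((1 + |(b : ℝ)|) ^ 3 * ‖v b t‖) *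
          ((1 + |(c : ℝ)|) ^ 3 * ‖v c t‖) := by ring
      _ ≤ _ := by
          exact mul_le_mul (mul_le_mul (hB _ _ ht) (hB _ _ ht) (by positivity) (by positivity))
            (hC _ _ ht) (by positivity) (by positivity)

/-- Clamping the time variable extends continuous functions on `[0,T]` to the whole line. Calculus
theorems with two-sided derivatives then apply, and the result is restricted to `[0,T]` afterwards.
-/
theorem clamp_mem {T : ℝ} (hT : 0 < T) (t : ℝ) : max 0 (min T t) ∈ Set.Icc 0 T :=
  ⟨le_max_left _ _, max_le hT.le (min_le_left _ _)⟩

theorem clamp_of_mem {T t : ℝ} (ht : t ∈ Set.Icc 0 T) : max 0 (min T t) = t := by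
  rw [min_eq_right ht.2, max_eq_right ht.1]

theorem continuous_comp_clamp {T : ℝ} (hT : 0 < T) {f : ℝ → ℂ} (hf : ContinuousOn f (Set.Icc 0 T)) :
    Continuous fun t => f (max 0 (min T t)) :=
  hf.comp_continuous (by fun_prop) fun t => clamp_mem hT t

theorem hasDerivAt_integral_clamp {T : ℝ} (hT : 0 < T) {f : ℝ → ℂ}
    (hf : ContinuousOn f (Set.Icc 0 T)) (t : ℝ) :
    HasDerivAt (fun t => ∫ τ in (0 : ℝ)..t, f (max 0 (min T τ))) (f (max 0 (min T t))) t :=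
  (continuous_comp_clamp hT hf).integral_hasStrictDerivAt 0 t |>.hasDerivAt

theorem integral_clamp {T t : ℝ} (f : ℝ → ℂ) (ht : t ∈ Set.Icc 0 T) :
    ∫ τ in (0 : ℝ)..t, f (max 0 (min T τ)) = ∫ τ in (0 : ℝ)..t, f τ := by
  refine intervalIntegral.integral_congr fun τ hτ => ?_
  rw [Set.uIcc_of_le ht.1] at hτ
  simp only [clamp_of_mem ⟨hτ.1, hτ.2.trans ht.2⟩]

/-- The time derivative in the interaction picture. -/
noncomputable def profileDeriv (v : ℤ → ℝ → ℂ) (n : ℤ) (t : ℝ) : ℂ :=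
  ∑' q : ℤ × ℤ, coef q.1 q.2 (n - q.1 - q.2) *
    (Complex.exp (Complex.I * phase q.1 q.2 (n - q.1 - q.2) * t)
      * (v q.1 t * v q.2 t * v (n - q.1 - q.2) t))

namespace IsProfile

variable {T : ℝ} {v : ℤ → ℝ → ℂ}

theorem exists_bound (h : IsProfile T v) :
    ∃ s : ℤ × ℤ → ℝ, Summable s ∧ ∀ n q, ∀ t ∈ Set.Icc 0 T,
      ‖coef q.1 q.2 (n - q.1 - q.2) * (Complex.exp (Complex.I * phase q.1 q.2 (n - q.1 - q.2) * t)
        * (v q.1 t * v q.2 t * v (n - q.1 - q.2) t))‖ ≤ (1 + (n : ℝ) ^ 2)⁻¹ * s q := by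
  obtain ⟨s, hs, hb⟩ := h.rapid.exists_cubic_bound
  refine ⟨s, hs, fun n q t ht => ?_⟩
  rw [mul_comm _ (s q), ← div_eq_mul_inv, le_div_iff₀ (one_add_sq_pos n), mul_comm]
  refine le_trans ?_ (hb n q t ht)
  have := one_add_sq_pos n
  rw [norm_mul _ (_ * _), norm_mul (Complex.exp _), norm_exp_phase, one_mul]
  gcongr
  exact norm_coef_le n q

theorem continuousOn_term (h : IsProfile T v) (n : ℤ) (q : ℤ × ℤ) :
    ContinuousOn (fun t : ℝ => Complex.exp (Complex.I * phase q.1 q.2 (n - q.1 - q.2) * t)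
        * (v q.1 t * v q.2 t * v (n - q.1 - q.2) t)) (Set.Icc 0 T) :=
  (by fun_prop : Continuous fun t : ℝ =>
    Complex.exp (Complex.I * phase q.1 q.2 (n - q.1 - q.2) * t)).continuousOn.mul
    (((h.cont _).mul (h.cont _)).mul (h.cont _))

theorem continuousOn_profileDeriv (h : IsProfile T v) (n : ℤ) :
    ContinuousOn (profileDeriv v n) (Set.Icc 0 T) := by
  obtain ⟨s, hs, hb⟩ := h.exists_bound
  exact continuousOn_tsum (fun q => (h.continuousOn_term n q).const_mul _)
    (hs.mul_left ((1 + (n : ℝ) ^ 2)⁻¹)) fun q t ht => hb n q t ht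

theorem exists_profileDeriv_le (h : IsProfile T v) : ∃ B : ℝ, ∀ n, ∀ t ∈ Set.Icc 0 T,
    ‖profileDeriv v n t‖ ≤ B * (1 + (n : ℝ) ^ 2)⁻¹ := by
  obtain ⟨s, hs, hb⟩ := h.exists_bound
  refine ⟨∑' q, s q, fun n t ht => ?_⟩
  rw [mul_comm, ← tsum_mul_left]
  exact tsum_of_norm_bounded (hs.mul_left _).hasSum fun q => hb n q t ht

theorem eq_integral (h : IsProfile T v) (n : ℤ) {t : ℝ} (ht : t ∈ Set.Icc 0 T) :
    v n t = v n 0 + ∫ τ in (0 : ℝ)..t, profileDeriv v n τ := by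
  obtain ⟨s, hs, hb⟩ := h.exists_bound
  rw [h.eqn n t ht]
  congr 1
  have hI : ∀ τ ∈ Set.uIoc 0 t, τ ∈ Set.Icc 0 T := fun τ hτ => by
    rw [Set.uIoc_of_le ht.1] at hτ
    exact ⟨hτ.1.le, hτ.2.trans ht.2⟩
  have := intervalIntegral.hasSum_integral_of_dominated_convergence (μ := volume)
    (a := 0) (b := t)
    (F := fun (q : ℤ × ℤ) τ => coef q.1 q.2 (n - q.1 - q.2) *
      (Complex.exp (Complex.I * phase q.1 q.2 (n - q.1 - q.2) * τ)
        * (v q.1 τ * v q.2 τ * v (n - q.1 - q.2) τ)))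
    (f := profileDeriv v n) (fun q _ => (1 + (n : ℝ) ^ 2)⁻¹ * s q)
    (fun q => (((h.continuousOn_term n q).const_mul _).mono hI).aestronglyMeasurable
      measurableSet_uIoc)
    (fun q => Eventually.of_forall fun τ hτ => hb n q τ (hI τ hτ))
    (Eventually.of_forall fun τ hτ => hs.mul_left _) intervalIntegrable_const
    (Eventually.of_forall fun τ hτ => (Summable.of_norm_bounded (hs.mul_left _)
      fun q => hb n q τ (hI τ hτ)).hasSum)
  simp only [intervalIntegral.integral_const_mul] at this
  exact this.tsum_eq

theorem exists_test (h : IsProfile T v) {t : ℝ} (ht : t ∈ Set.Icc 0 T) :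
    ∃ ψ : TestSpace, (∀ n, tc ψ n = airy n t * v n t) ∧
      ∀ x, (((ψ : ℝ → ℂ) x).re : ℂ) = (ψ : ℝ → ℂ) x := by
  obtain ⟨ψ, hψ⟩ := exists_test_of_rapid (c := fun n => airy n t * v n t) fun k => by
    obtain ⟨B, h0, hB⟩ := h.rapid k
    refine ⟨B, h0, fun n _ _ => ?_⟩
    rw [norm_mul, norm_airy, one_mul]
    exact hB n t ht
  refine ⟨ψ, hψ, real_of_tc fun n => ?_⟩
  rw [hψ, hψ, map_mul, airy_neg, h.real n t ht]

/-- The propagator of the output mode and the phase recombine into the propagators of the three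
inputs, so the interaction picture is undone. -/
theorem airy_mul_profileDeriv {t : ℝ} {ψ : TestSpace} (hψ : ∀ n, tc ψ n = airy n t * v n t)
    (n : ℤ) : airy n t * profileDeriv v n t = -tc (nonT ψ) n := by
  rw [profileDeriv, ← tsum_mul_left, ← (hasSum_nonT ψ n).tsum_eq]
  refine tsum_congr fun q => ?_
  have := airy_mul_phase n q t
  rw [hψ, hψ, hψ]
  linear_combination coef q.1 q.2 (n - q.1 - q.2) * (v q.1 t * v q.2 t * v (n - q.1 - q.2) t) * this

/-- The time derivative of the Fourier coefficients. -/
theorem hasDerivAt_mode (h : IsProfile T v) (n : ℤ) (t : ℝ) :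
    HasDerivAt (fun t => airy n t * (v n 0 + ∫ τ in (0 : ℝ)..t, profileDeriv v n (max 0 (min T τ))))
      (Complex.I * (n : ℂ) ^ 3 * airy n t *
        (v n 0 + ∫ τ in (0 : ℝ)..t, profileDeriv v n (max 0 (min T τ)))
        + airy n t * profileDeriv v n (max 0 (min T t))) t :=
  (hasDerivAt_airy n t).mul
    ((hasDerivAt_integral_clamp h.pos (h.continuousOn_profileDeriv n) t).const_add (v n 0))

/-- The right hand side of the equation for the Fourier coefficients. -/
noncomputable def modeDeriv (v : ℤ → ℝ → ℂ) (n : ℤ) (t : ℝ) : ℂ :=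
  Complex.I * (n : ℂ) ^ 3 * airy n t * v n t + airy n t * profileDeriv v n t

theorem continuousOn_modeDeriv (h : IsProfile T v) (n : ℤ) :
    ContinuousOn (modeDeriv v n) (Set.Icc 0 T) :=
  ((continuousOn_const.mul (continuous_airy n).continuousOn).mul (h.cont n)).add
    ((continuous_airy n).continuousOn.mul (h.continuousOn_profileDeriv n))

/-- The clamped integral defines the mode for all real times with a uniformly bounded derivative, as
termwise differentiation of the Fourier series requires. -/
theorem mode_eq_integral (h : IsProfile T v) (n : ℤ) {t : ℝ} (ht : t ∈ Set.Icc 0 T) :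
    v n 0 + ∫ τ in (0 : ℝ)..t, modeDeriv v n (max 0 (min T τ)) = airy n t * v n t := by
  have hI : ∀ τ ∈ Set.uIcc 0 t, τ ∈ Set.Icc 0 T := fun τ hτ => by
    rw [Set.uIcc_of_le ht.1] at hτ
    exact ⟨hτ.1, hτ.2.trans ht.2⟩
  have hv : ∀ τ ∈ Set.Icc 0 T,
      v n 0 + ∫ τ in (0 : ℝ)..τ, profileDeriv v n (max 0 (min T τ)) = v n τ := fun τ hτ => by
    rw [integral_clamp _ hτ, h.eq_integral n hτ]
  have h1 := intervalIntegral.integral_eq_sub_of_hasDerivAt (a := 0) (b := t)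
    (f' := fun τ => modeDeriv v n (max 0 (min T τ)))
    (fun τ hτ => (h.hasDerivAt_mode n τ).congr_deriv (by
      rw [hv τ (hI τ hτ), clamp_of_mem (hI τ hτ), modeDeriv]))
    ((continuous_comp_clamp h.pos (h.continuousOn_modeDeriv n)).intervalIntegrable _ _)
  rw [h1, hv t ht, hv 0 ⟨le_rfl, h.pos.le⟩, airy_zero]
  ring

theorem exists_modeDeriv_le (h : IsProfile T v) : ∃ B : ℝ, ∀ n, ∀ t ∈ Set.Icc 0 T,
    ‖modeDeriv v n t‖ ≤ B * (1 + (n : ℝ) ^ 2)⁻¹ := by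
  obtain ⟨B, hB⟩ := h.exists_profileDeriv_le
  obtain ⟨C, -, hC⟩ := h.rapid.exists_le_inv 3
  refine ⟨C + B, fun n t ht => (norm_add_le _ _).trans ?_⟩
  rw [add_mul]
  refine add_le_add (le_trans ?_ (hC n t ht)) ?_
  · rw [norm_mul, norm_mul, norm_mul, norm_airy, Complex.norm_I, one_mul, mul_one, norm_pow,
      Complex.norm_intCast]
    gcongr
    linarith
  · rw [norm_mul, norm_airy, one_mul]; exact hB n t ht

/-- The clamped modes are differentiated term by term on the whole line. On `[0,T]` the series of
derivatives is the Fourier series of the right-hand side of the equation. -/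
theorem hasDerivWithinAt (h : IsProfile T v) {u : ℝ → TestSpace}
    (hu : ∀ t ∈ Set.Icc 0 T, ∀ n, tc (u t) n = airy n t * v n t) {t : ℝ} (ht : t ∈ Set.Icc 0 T)
    (x : ℝ) : HasDerivWithinAt (fun τ => (u τ : ℝ → ℂ) x)
      (-(iteratedDeriv 3 (u t : ℝ → ℂ) x + nonlin (u t : ℝ → ℂ) x)) (Set.Icc 0 T) t := by
  obtain ⟨B, hB⟩ := h.exists_modeDeriv_le
  have hD := hasDerivAt_tsum (𝕜 := ℝ) (F := ℂ) (α := ℤ)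
    (u := fun n : ℤ => B * (1 + (n : ℝ) ^ 2)⁻¹)
    (g := fun n t => (v n 0 + ∫ τ in (0 : ℝ)..t, modeDeriv v n (max 0 (min T τ))) *
      (char n : ℝ → ℂ) x)
    (g' := fun n t => modeDeriv v n (max 0 (min T t)) * (char n : ℝ → ℂ) x)
    (summable_inv_one_add_sq.mul_left B)
    (fun n t => ((hasDerivAt_integral_clamp h.pos (h.continuousOn_modeDeriv n) t).const_add
      (v n 0)).mul_const _)
    (fun n t => by rw [norm_mul, norm_char, mul_one]; exact hB n _ (clamp_mem h.pos t))
    (y₀ := t) (by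
      simp only [h.mode_eq_integral _ ht, ← hu t ht]
      exact (hasSum_tc (u t) x).summable) t
  have hval : ∑' n, modeDeriv v n (max 0 (min T t)) * (char n : ℝ → ℂ) x
      = -(iteratedDeriv 3 (u t : ℝ → ℂ) x + nonlin (u t : ℝ → ℂ) x) := by
    have h1 := hasSum_tc (der^[3] (u t)) x
    have h2 := hasSum_tc (nonT (u t)) x
    rw [iterate_der] at h1
    rw [← nonlin_eq_nonT] at h2
    refine (hasSum_of_eq (h1.add h2).neg (fun n => ?_) rfl).tsum_eq
    rw [clamp_of_mem ht, modeDeriv, airy_mul_profileDeriv (hu t ht), tc_iterate_der, hu t ht]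
    rw [mul_pow, Complex.I_pow_three]
    ring
  rw [hval] at hD
  refine hD.hasDerivWithinAt.congr (fun τ hτ => ?_) ?_
  · simp only [h.mode_eq_integral _ hτ, ← hu τ hτ]
    exact (hasSum_tc (u τ) x).tsum_eq.symm
  · simp only [h.mode_eq_integral _ ht, ← hu t ht]
    exact (hasSum_tc (u t) x).tsum_eq.symm

theorem continuousOn_iteratedDeriv (h : IsProfile T v) {u : ℝ → TestSpace}
    (hu : ∀ t ∈ Set.Icc 0 T, ∀ n, tc (u t) n = airy n t * v n t) (k : ℕ) :
    ContinuousOn (fun q : ℝ × ℝ => iteratedDeriv k (u q.1 : ℝ → ℂ) q.2)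
      (Set.Icc 0 T ×ˢ Set.univ) := by
  obtain ⟨B, -, hB⟩ := h.rapid.exists_le_inv k
  have h1 : ContinuousOn (fun q : ℝ × ℝ => ∑' n : ℤ,
      (Complex.I * n) ^ k * (airy n q.1 * v n q.1) * (char n : ℝ → ℂ) q.2)
      (Set.Icc 0 T ×ˢ Set.univ) := by
    refine continuousOn_tsum (u := fun n : ℤ => B * (1 + (n : ℝ) ^ 2)⁻¹) (fun n => ?_)
      (summable_inv_one_add_sq.mul_left B) fun n q hq => ?_
    · refine (continuousOn_const.mul (ContinuousOn.mul ?_ ?_)).mul ?_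
      · exact ((continuous_airy n).comp continuous_fst).continuousOn
      · exact (h.cont n).comp continuousOn_fst fun q hq => hq.1
      · exact ((continuous_char n).comp continuous_snd).continuousOn
    · refine le_trans (le_of_eq ?_) (le_trans (?_ : |(n : ℝ)| ^ k * ‖v n q.1‖ ≤ _) (hB n q.1 hq.1))
      · rw [norm_mul, norm_char, norm_mul, norm_mul, norm_airy, norm_pow, norm_mul,
          Complex.norm_I, Complex.norm_intCast]
        ring
      · gcongr
        linarith
  refine h1.congr fun q hq => ?_
  have h2 := hasSum_tc (der^[k] (u q.1)) q.2
  rw [iterate_der] at h2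
  simp only [tc_iterate_der, hu q.1 hq.1] at h2
  exact h2.tsum_eq.symm

theorem exists_classicalSolution (h : IsProfile T v) :
    ∃ w : ℝ → ℝ → ℝ, IsClassicalSolution T w ∧ ∀ t ∈ Set.Icc 0 T, ∃ ψ : TestSpace,
      (ψ : ℝ → ℂ) = (fun x => (w t x : ℂ)) ∧ ∀ n, tc ψ n = airy n t * v n t := by
  have hex : ∀ t, ∃ ψ : TestSpace, t ∈ Set.Icc 0 T → (∀ n, tc ψ n = airy n t * v n t) ∧
      ∀ x, (((ψ : ℝ → ℂ) x).re : ℂ) = (ψ : ℝ → ℂ) x := fun t => by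
    by_cases ht : t ∈ Set.Icc 0 T
    · obtain ⟨ψ, hψ⟩ := h.exists_test ht
      exact ⟨ψ, fun _ => hψ⟩
    · exact ⟨0, fun h => absurd h ht⟩
  choose u hu using hex
  have hu1 := fun t ht => (hu t ht).1
  have hu2 := fun t ht => (hu t ht).2
  have hcoe : ∀ t ∈ Set.Icc 0 T,
      (u t : ℝ → ℂ) = fun x => (((u t : ℝ → ℂ) x).re : ℂ) := fun t ht =>
    funext fun x => (hu2 t ht x).symm
  have hsm : ∀ t, ContDiff ℝ ∞ fun x => ((u t : ℝ → ℂ) x).re := fun t =>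
    Complex.reCLM.contDiff.comp (u t).2.1
  have hder : ∀ k, ∀ t ∈ Set.Icc 0 T, ∀ x, iteratedDeriv k (u t : ℝ → ℂ) x
      = (iteratedDeriv k (fun x => ((u t : ℝ → ℂ) x).re) x : ℝ) := fun k t ht x => by
    rw [← iteratedDeriv_ofReal (hsm t), ← hcoe t ht]
  refine ⟨fun t x => ((u t : ℝ → ℂ) x).re, ⟨?_, fun t _ => hsm t, fun k => ?_, ?_⟩,
    fun t ht => ⟨u t, hcoe t ht, hu1 t ht⟩⟩
  · exact fun t _ x => congrArg Complex.re ((u t).2.2 x)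
  · refine (Complex.continuous_re.comp_continuousOn (h.continuousOn_iteratedDeriv hu1 k)).congr
      fun q hq => ?_
    simp only [Function.comp_apply, hder k q.1 hq.1, Complex.ofReal_re]
  · intro t ht x
    have h1 := h.hasDerivWithinAt hu1 ht x
    have h2 := Complex.reCLM.hasFDerivAt.comp_hasDerivWithinAt t h1
    refine h2.congr_deriv ?_
    rw [hder 3 t ht, hcoe t ht, nonlin_ofReal (hsm t)]
    simp

end IsProfile

/-! ### Persistence of regularity through slowly growing weights -/

theorem lpN_le_tsum {ι : Type*} [MeasurableSpace ι] [DiscreteMeasurableSpace ι] {p : ℝ≥0∞}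
    (hp : 1 ≤ p) (A : ι → ℝ≥0∞) : lpN p A ≤ ∑' i, A i := by
  by_cases hS : ∑' i, A i = ⊤
  · rw [hS]; exact le_top
  have h0 : p ≠ 0 := (zero_lt_one.trans_le hp).ne'
  by_cases ht : p = ⊤
  · subst ht; rw [lpN_top]; exact iSup_le fun i => ENNReal.le_tsum i
  have hr := ENNReal.toReal_pos h0 ht
  have hr1 : 1 ≤ p.toReal := by simpa using ENNReal.toReal_mono ht hp
  rw [← ENNReal.rpow_le_rpow_iff hr, lpN_rpow h0 ht]
  have e : ∀ x : ℝ≥0∞, x ^ p.toReal = x * x ^ (p.toReal - 1) := fun x => by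
    conv_lhs => rw [show p.toReal = 1 + (p.toReal - 1) by ring]
    rw [ENNReal.rpow_add_of_nonneg _ _ zero_le_one (by linarith), ENNReal.rpow_one]
  rw [e (∑' i, A i), ← ENNReal.tsum_mul_right]
  refine ENNReal.tsum_le_tsum fun i => ?_
  rw [e]
  gcongr
  exact ENNReal.le_tsum i

theorem jp_le_pow (s : ℝ) (n : ℤ) : jp (s / 2) n ≤ ENNReal.ofReal ((1 + |(n : ℝ)|) ^ ⌈s⌉₊) := by
  refine ENNReal.ofReal_le_ofReal ?_
  have h0 := abs_nonneg (n : ℝ)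
  calc (1 + (n : ℝ) ^ 2) ^ (s / 2) ≤ (1 + (n : ℝ) ^ 2) ^ ((⌈s⌉₊ : ℝ) / 2) :=
        Real.rpow_le_rpow_of_exponent_le (by nlinarith) (by linarith [Nat.le_ceil s])
    _ ≤ ((1 + |(n : ℝ)|) ^ 2) ^ ((⌈s⌉₊ : ℝ) / 2) := by
        gcongr
        nlinarith [sq_abs (n : ℝ)]
    _ = _ := by
        rw [← Real.rpow_natCast (1 + |(n : ℝ)|) 2, ← Real.rpow_mul (by positivity),
          ← Real.rpow_natCast]
        congr 1
        push_cast; ring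

theorem Rapid.exists_majorant {ι : Type*} {S : Set ι} {c : ℤ → ι → ℂ} (h : Rapid S c) (s : ℝ)
    (k : ℕ) : ∃ b : ℤ → ℝ≥0∞, ∑' n, b n ≠ ⊤ ∧ ∀ n, ∀ t ∈ S,
      jp (s / 2) n * (ENNReal.ofReal ((1 + |(n : ℝ)|) ^ k) * ‖c n t‖ₑ) ≤ b n := by
  obtain ⟨B, hB0, hB⟩ := h.exists_le_inv (⌈s⌉₊ + k)
  refine ⟨fun n => ENNReal.ofReal (B * (1 + (n : ℝ) ^ 2)⁻¹),
    (summable_inv_one_add_sq.mul_left B).tsum_ofReal_ne_top, fun n t ht => ?_⟩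
  calc _ ≤ ENNReal.ofReal ((1 + |(n : ℝ)|) ^ ⌈s⌉₊) *
        (ENNReal.ofReal ((1 + |(n : ℝ)|) ^ k) * ‖c n t‖ₑ) := by
        gcongr; exact jp_le_pow s n
    _ = ENNReal.ofReal ((1 + |(n : ℝ)|) ^ (⌈s⌉₊ + k) * ‖c n t‖) := by
        rw [← ofReal_norm, ← ENNReal.ofReal_mul (by positivity),
          ← ENNReal.ofReal_mul (by positivity), pow_add, mul_assoc]
    _ ≤ _ := ENNReal.ofReal_le_ofReal (hB n t ht)

/-- `1 + εx` is the convex combination `(1 - ε) · 1 + ε (1 + x)`, and the power is convex. -/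
theorem one_add_mul_pow_le {ε x : ℝ} (h0 : 0 ≤ ε) (h1 : ε ≤ 1) (hx : 0 ≤ x) (k : ℕ) :
    (1 + ε * x) ^ k ≤ 1 + ε * (1 + x) ^ k := by
  have := (convexOn_pow (𝕜 := ℝ) k).2 (Set.mem_Ici.2 zero_le_one)
    (Set.mem_Ici.2 (by linarith : 0 ≤ 1 + x)) (sub_nonneg.2 h1) h0 (sub_add_cancel 1 ε)
  simp only [smul_eq_mul, mul_one, one_pow] at this
  rw [show 1 - ε + ε * (1 + x) = 1 + ε * x by ring] at this
  linarith

/-- The weights `(1 + ε |n|)^k`. -/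
noncomputable def polyWeight (ε : ℝ) (k : ℕ) (n : ℤ) : ℝ≥0∞ :=
  ENNReal.ofReal ((1 + ε * |(n : ℝ)|) ^ k)

theorem isWeight_polyWeight {ε : ℝ} (hε : 0 ≤ ε) (k : ℕ) : IsWeight (polyWeight ε k) := by
  refine ⟨fun n => ?_, fun n => ENNReal.ofReal_ne_top, fun a b c => ?_⟩
  · rw [polyWeight, ENNReal.one_le_ofReal]
    exact one_le_pow₀ (by have := abs_nonneg (n : ℝ); nlinarith)
  · rw [polyWeight, polyWeight, polyWeight, polyWeight, ← ENNReal.ofReal_mul (by positivity),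
      ← ENNReal.ofReal_mul (by positivity), ← mul_pow, ← mul_pow]
    refine ENNReal.ofReal_le_ofReal (pow_le_pow_left₀ (by positivity) ?_ k)
    have ha := mul_nonneg hε (abs_nonneg (a : ℝ))
    have hb := mul_nonneg hε (abs_nonneg (b : ℝ))
    have hc := mul_nonneg hε (abs_nonneg (c : ℝ))
    have : ε * |((a + b + c : ℤ) : ℝ)| ≤ ε * |(a : ℝ)| + ε * |(b : ℝ)| + ε * |(c : ℝ)| := by
      rw [← mul_add, ← mul_add]
      gcongr
      push_cast
      exact abs_add_three _ _ _
    nlinarith [mul_nonneg ha hb, mul_nonneg hb hc, mul_nonneg ha hc,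
        mul_nonneg (mul_nonneg ha hb) hc]

/-- As `ε → 0` the weighted norm of rapidly decreasing data comes within `O(ε)` of the unweighted
one, so a strict bound survives for small `ε`. For each fixed `ε > 0` the weight is still equivalent
to `(1 + |n|)^k`. -/
theorem exists_polyWeight_le {s : ℝ} {p L : ℝ≥0∞} (hp : 1 ≤ p) {c : ℤ → ℂ}
    (hc : Rapid Set.univ fun n (_ : Unit) => c n) (hL : wN s p (fun _ => 1) (fun n => ‖c n‖ₑ) < L)
    (k : ℕ) : ∃ ε > 0, wN s p (polyWeight ε k) (fun n => ‖c n‖ₑ) ≤ L := by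
  obtain ⟨b, hb, hbc⟩ := hc.exists_majorant s k
  set D : ℝ≥0∞ := ∑' n, b n
  obtain ⟨η, hη0, hη⟩ : ∃ η : ℝ, 0 < η ∧
      wN s p (fun _ => 1) (fun n => ‖c n‖ₑ) + ENNReal.ofReal η * D ≤ L := by
    have h1 : Tendsto (fun η : ℝ => wN s p (fun _ => 1) (fun n => ‖c n‖ₑ) + ENNReal.ofReal η * D)
        (𝓝 0) (𝓝 (wN s p (fun _ => 1) (fun n => ‖c n‖ₑ) + ENNReal.ofReal 0 * D)) :=
      (ENNReal.Tendsto.mul_const (ENNReal.continuous_ofReal.tendsto 0) (Or.inr hb)).const_add _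
    rw [ENNReal.ofReal_zero, zero_mul, add_zero] at h1
    have h2 := (h1.eventually (gt_mem_nhds hL)).filter_mono
      (nhdsWithin_le_nhds (s := Set.Ioi 0))
    obtain ⟨η, h3, h4⟩ := (h2.and self_mem_nhdsWithin).exists
    exact ⟨η, h4, h3.le⟩
  refine ⟨min η 1, by positivity, le_trans ?_ hη⟩
  calc wN s p (polyWeight (min η 1) k) (fun n => ‖c n‖ₑ)
      ≤ lpN p (fun n => jp (s / 2) n * (1 * ‖c n‖ₑ) + ENNReal.ofReal η * b n) := by
        refine lpN_mono fun n => ?_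
        have h1 : polyWeight (min η 1) k n
            ≤ 1 + ENNReal.ofReal η * ENNReal.ofReal ((1 + |(n : ℝ)|) ^ k) := by
          rw [polyWeight, ← ENNReal.ofReal_mul hη0.le, ← ENNReal.ofReal_one,
            ← ENNReal.ofReal_add zero_le_one (by positivity)]
          refine ENNReal.ofReal_le_ofReal ((one_add_mul_pow_le (by positivity) (min_le_right _ _)
            (abs_nonneg _) k).trans ?_)
          gcongr
          exact min_le_left _ _
        calc jp (s / 2) n * (polyWeight (min η 1) k n * ‖c n‖ₑ)
            ≤ jp (s / 2) n * ((1 + ENNReal.ofReal η * ENNReal.ofReal ((1 + |(n : ℝ)|) ^ k)) *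
              ‖c n‖ₑ) := by gcongr
          _ = jp (s / 2) n * (1 * ‖c n‖ₑ) + ENNReal.ofReal η *
              (jp (s / 2) n * (ENNReal.ofReal ((1 + |(n : ℝ)|) ^ k) * ‖c n‖ₑ)) := by ring
          _ ≤ _ := by gcongr; exact hbc n () trivial
    _ ≤ _ := by
        refine (lpN_add_le hp _ _).trans ?_
        rw [lpN_const_mul (zero_lt_one.trans_le hp).ne', wN]
        gcongr
        exact lpN_le_tsum hp b

theorem coef_neg (a b c : ℤ) : coef (-a) (-b) (-c) = starRingEnd ℂ (coef a b c) := by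
  have h1 : res (-a) (-b) (-c) = -res a b c := by simp only [res]; ring
  simp only [coef, h1, neg_ne_zero, neg_inj]
  split_ifs
  · simp [map_ofNat]; ring
  · simp
  · simp

theorem duh_neg {v : ℤ → ℝ → ℂ} (hv : ∀ n t, v (-n) t = starRingEnd ℂ (v n t)) (n : ℤ) (t : ℝ) :
    duh v v v (-n) t = starRingEnd ℂ (duh v v v n t) := by
  rw [duh, duh, Complex.conj_tsum, ← (Equiv.neg (ℤ × ℤ)).tsum_eq]
  refine tsum_congr fun q => ?_
  simp only [duhTerm, map_mul, conj_intervalIntegral, Equiv.neg_apply, Prod.fst_neg, Prod.snd_neg]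
  rw [show -n - -q.1 - -q.2 = -(n - q.1 - q.2) by ring, coef_neg]
  congr 1
  refine intervalIntegral.integral_congr fun τ _ => ?_
  have h1 : phase (-q.1) (-q.2) (-(n - q.1 - q.2)) = -phase q.1 q.2 (n - q.1 - q.2) := by
    simp only [phase, res]; push_cast; ring
  simp only [hv, h1, ← Complex.exp_conj]
  congr 2
  simp

theorem pic_neg {c : ℤ → ℂ} (hc : ∀ n, c (-n) = starRingEnd ℂ (c n)) (k : ℕ) (n : ℤ) (t : ℝ) :
    pic c k (-n) t = starRingEnd ℂ (pic c k n t) := by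
  induction k generalizing n t with
  | zero => exact hc n
  | succ k ih => simp only [pic, map_add, hc, duh_neg ih]

theorem duh_zero (u v z : ℤ → ℝ → ℂ) (n : ℤ) : duh u v z n 0 = 0 := by
  simp [duh, duhTerm]

namespace IsTriConst

variable {s : ℝ} {p : ℝ≥0∞} {T : ℝ} {K M : ℝ≥0∞} {c : ℤ → ℂ}

theorem sol_neg (h : IsTriConst s p T K) (hM : M ≠ ⊤) (hK : K * (3 * M ^ 2) ≤ 2⁻¹)
    (hc : wN s p (fun _ => 1) (fun n => ‖c n‖ₑ) ≤ M / 2)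
    (hr : ∀ n, c (-n) = starRingEnd ℂ (c n)) (n : ℤ) {t : ℝ} (ht : t ∈ Set.Icc 0 T) :
    sol c (-n) t = starRingEnd ℂ (sol c n t) := by
  have h1 := h.tendsto_pic isWeight_one hM hK hc (-n) ht
  simp only [pic_neg hr] at h1
  exact tendsto_nhds_unique h1 ((Complex.continuous_conj.tendsto _).comp
    (h.tendsto_pic isWeight_one hM hK hc n ht))

theorem sol_zero (h : IsTriConst s p T K) (hM : M ≠ ⊤) (hK : K * (3 * M ^ 2) ≤ 2⁻¹)
    (hc : wN s p (fun _ => 1) (fun n => ‖c n‖ₑ) ≤ M / 2) (n : ℤ) : sol c n 0 = c n := by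
  rw [h.sol_eq isWeight_one hM hK hc n ⟨le_rfl, h.hT.le⟩, duh_zero, add_zero]

/-- Smoothness persists on the full interval: for each `k` a small `ε` keeps the data in the
contraction ball of the weighted norm, where the same `T`, `K` and `M` apply. The strict inequality
for the data leaves room for this `ε`. -/
theorem isProfile_sol (h : IsTriConst s p T K) (hM : M ≠ ⊤) (hK : K * (3 * M ^ 2) ≤ 2⁻¹)
    (hc : wN s p (fun _ => 1) (fun n => ‖c n‖ₑ) < M / 2)
    (hrap : Rapid Set.univ fun n (_ : Unit) => c n)
    (hr : ∀ n, c (-n) = starRingEnd ℂ (c n)) : IsProfile T (sol c) := by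
  have hx := h.xN_sol_le isWeight_one hM hK hc.le
  refine ⟨h.hT, fun n => continuousOn_of_hn_ne_top h.hT (h.hn_ne_top isWeight_one
    (ne_top_of_le_ne_top hM hx) n), fun k => ?_, fun n t ht => h.sol_neg hM hK hc.le hr n ht,
    fun n t ht => ?_⟩
  · obtain ⟨ε, hε, hle⟩ := exists_polyWeight_le h.hp hrap hc k
    have h1 := h.xN_sol_le (isWeight_polyWeight hε.le k) hM hK hle
    refine ⟨(1 + ε⁻¹) ^ k * M.toReal, by positivity, fun n t ht => ?_⟩
    have h2 : polyWeight ε k n * ‖sol c n t‖ₑ ≤ M := by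
      refine le_trans ?_ ((le_lpN (zero_lt_one.trans_le h.hp).ne' _ n).trans h1)
      refine le_trans ?_ (le_mul_of_one_le_left zero_le (one_le_jp (by linarith [h.hs]) n))
      gcongr
      exact enorm_le_hn _ ht
    have h3 : (1 + ε * |(n : ℝ)|) ^ k * ‖sol c n t‖ ≤ M.toReal := by
      rw [← ENNReal.ofReal_le_iff_le_toReal hM, ENNReal.ofReal_mul (by positivity), ofReal_norm]
      exact h2
    -- The weight is undone by `1 + |n| ≤ (1 + ε⁻¹)(1 + ε|n|)`.
    calc (1 + |(n : ℝ)|) ^ k * ‖sol c n t‖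
        ≤ ((1 + ε⁻¹) * (1 + ε * |(n : ℝ)|)) ^ k * ‖sol c n t‖ := by
          gcongr
          have : ε⁻¹ * (ε * |(n : ℝ)|) = |(n : ℝ)| := by field_simp
          have h4 : 0 ≤ ε * |(n : ℝ)| := by positivity
          have h5 : 0 < ε⁻¹ := by positivity
          nlinarith
      _ = (1 + ε⁻¹) ^ k * ((1 + ε * |(n : ℝ)|) ^ k * ‖sol c n t‖) := by rw [mul_pow]; ring
      _ ≤ _ := by gcongr
  · rw [h.sol_zero hM hK hc.le]
    exact h.sol_eq isWeight_one hM hK hc.le n ht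

end IsTriConst

/-! ### Density of smooth data and the solution map of part (a) -/

theorem IsSmoothData.exists_test {φ : Distrib} {g : ℝ → ℝ} (h : IsSmoothData φ g) :
    ∃ ψ : TestSpace, (ψ : ℝ → ℂ) = (fun x => (g x : ℂ)) ∧ φ = ofFun ψ := by
  obtain ⟨ψ, hψ⟩ := exists_test_of_real h.1 h.2.1
  exact ⟨ψ, hψ, (represents_iff ψ φ).1 (hψ ▸ h.2.2)⟩

theorem IsSmoothData.isReal {φ : Distrib} {g : ℝ → ℝ} (h : IsSmoothData φ g) : IsReal φ := by
  obtain ⟨ψ, hψ, rfl⟩ := h.exists_test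
  exact isReal_iff.2 (tc_neg_of_real fun x => by simp [hψ])

theorem IsSmoothData.rapid {φ : Distrib} {g : ℝ → ℝ} (h : IsSmoothData φ g) :
    Rapid Set.univ fun n (_ : Unit) => fourierCoef φ n := by
  obtain ⟨ψ, -, rfl⟩ := h.exists_test
  exact rapid_tc ψ

theorem isSmoothData_ofFun {ψ : TestSpace} (h : ∀ n, tc ψ (-n) = starRingEnd ℂ (tc ψ n)) :
    IsSmoothData (ofFun ψ) fun x => ((ψ : ℝ → ℂ) x).re := by
  refine ⟨Complex.reCLM.contDiff.comp ψ.2.1, fun x => congrArg Complex.re (ψ.2.2 x), ?_⟩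
  simp only [real_of_tc h]
  exact (represents_iff ψ _).2 rfl

theorem flNorm_self_sub (s : ℝ) (p : ℝ≥0∞) (f : Distrib) : flNorm s p (f - f) = 0 := by
  simp only [flNorm_eq, fourierCoef_sub]
  simp only [sub_self, enorm_zero, wN, mul_zero, lpN_zero]

theorem exists_lpN_tail_le {p : ℝ≥0∞} (hp : 1 ≤ p) (ht : p ≠ ⊤) {A : ℤ → ℝ≥0∞}
    (hA : lpN p A ≠ ⊤) {ε : ℝ≥0∞} (hε : 0 < ε) :
    ∃ N : ℕ, lpN p (fun n => if n ∈ Finset.Icc (-(N : ℤ)) N then 0 else A n) ≤ ε := by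
  have h0 : p ≠ 0 := (zero_lt_one.trans_le hp).ne'
  have hr := ENNReal.toReal_pos h0 ht
  have h1 : ∑' n, A n ^ p.toReal ≠ ⊤ := by
    rw [← lpN_rpow h0 ht]; exact ENNReal.rpow_ne_top_of_nonneg hr.le hA
  have h2 := ENNReal.tendsto_tsum_compl_atTop_zero h1
  obtain ⟨S, hS⟩ := (h2.eventually (gt_mem_nhds (ENNReal.rpow_pos_of_nonneg hε hr.le))).exists
  obtain ⟨N, hN⟩ : ∃ N : ℕ, S ⊆ Finset.Icc (-(N : ℤ)) N := by
    refine ⟨S.sup Int.natAbs, fun n hn => ?_⟩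
    have := Finset.le_sup (f := Int.natAbs) hn
    rw [Finset.mem_Icc]; omega
  refine ⟨N, ?_⟩
  rw [← ENNReal.rpow_le_rpow_iff hr, lpN_rpow h0 ht]
  refine le_trans ?_ hS.le
  rw [show ∑' b : { n // n ∉ S }, A b ^ p.toReal = _ from
    tsum_subtype {n | n ∉ S} fun n => A n ^ p.toReal]
  refine ENNReal.tsum_le_tsum fun n => ?_
  by_cases hn : n ∈ S
  · rw [if_pos (hN hn), ENNReal.zero_rpow_of_pos hr]; exact zero_le
  · rw [Set.indicator_of_mem (show n ∈ {n | n ∉ S} from hn)]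
    split_ifs
    · rw [ENNReal.zero_rpow_of_pos hr]; exact zero_le
    · exact le_rfl

/-- Smooth data are dense in the ball. -/
theorem exists_smooth_near {s : ℝ} {p : ℝ≥0∞} {R : ℝ} (hp : 1 ≤ p) {φ : Distrib}
    (hφ : φ ∈ ball s p R) {ε : ℝ≥0∞} (hε : 0 < ε) :
    ∃ (χ : Distrib) (g : ℝ → ℝ), χ ∈ ball s p R ∧ IsSmoothData χ g ∧ flNorm s p (φ - χ) < ε := by
  by_cases ht : p = ⊤
  -- For `p = ∞` the definition of the ball provides approximants; a distance below the gap to `R`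
  -- keeps them in the open ball. For `p < ∞` truncations serve, and they do not increase the norm.
  · have hd : 0 < ENNReal.ofReal R - flNorm s p φ := tsub_pos_of_lt hφ.2.1
    obtain ⟨χ, g, hχ, hlt⟩ := hφ.2.2 ht _ (lt_min hε hd)
    refine ⟨χ, g, ⟨hχ.isReal, ?_, fun _ ε hε => ⟨χ, g, hχ, by rwa [flNorm_self_sub]⟩⟩, hχ,
      hlt.trans_le (min_le_left _ _)⟩
    refine (flNorm_le_add hp χ φ).trans_lt ?_
    rw [flNorm_sub_comm]
    exact lt_tsub_iff_right.1 (hlt.trans_le (min_le_right _ _))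
  · obtain ⟨δ, hδ0, hδ⟩ := exists_between hε
    have hfin : flNorm s p φ ≠ ⊤ := hφ.2.1.ne_top
    rw [flNorm_eq, wN] at hfin
    obtain ⟨N, hN⟩ := exists_lpN_tail_le hp ht hfin hδ0
    set ψ := partialSum (fourierCoef φ) (Finset.Icc (-(N : ℤ)) N) with hψ
    have hr := isReal_iff.1 hφ.1
    have hψr : ∀ n, tc ψ (-n) = starRingEnd ℂ (tc ψ n) := fun n => by
      have : -n ∈ Finset.Icc (-(N : ℤ)) N ↔ n ∈ Finset.Icc (-(N : ℤ)) N := by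
        simp only [Finset.mem_Icc]; omega
      simp only [hψ, tc_partialSum, this]
      split_ifs
      · exact hr n
      · simp
    have hs := isSmoothData_ofFun hψr
    refine ⟨ofFun ψ, _, ⟨hs.isReal, lt_of_le_of_lt ?_ hφ.2.1, fun h => absurd h ht⟩, hs, ?_⟩
    · rw [flNorm_eq, flNorm_eq]
      refine wN_mono fun n => ?_
      rw [fourierCoef_ofFun, hψ, tc_partialSum]
      split_ifs <;> simp
    · refine lt_of_le_of_lt (le_trans (le_of_eq ?_) hN) hδ
      rw [flNorm_eq, wN]
      congr 1
      ext n
      rw [fourierCoef_sub, fourierCoef_ofFun, hψ, tc_partialSum]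
      split_ifs <;> simp

/-- The `ℓ^p` norm is dominated by the `ℓ^1` norm, and the resulting series of continuous functions
converges uniformly. -/
theorem tendsto_wN_of_rapid {s T : ℝ} {p : ℝ≥0∞} (hp : 1 ≤ p) {c : ℤ → ℝ → ℂ}
    (hc : Rapid (Set.Icc 0 T) c) (hcont : ∀ n, ContinuousOn (c n) (Set.Icc 0 T)) {t : ℝ}
    (ht : t ∈ Set.Icc 0 T) :
    Tendsto (fun τ => wN s p (fun _ => 1) fun n => ‖c n τ - c n t‖ₑ) (𝓝[Set.Icc 0 T] t) (𝓝 0) := by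
  obtain ⟨B, hB0, hB⟩ := hc.exists_le_inv ⌈s⌉₊
  have hbd : ∀ n : ℤ, ∀ τ ∈ Set.Icc 0 T, ‖(1 + |(n : ℝ)|) ^ ⌈s⌉₊ * ‖c n τ - c n t‖‖
      ≤ 2 * (B * (1 + (n : ℝ) ^ 2)⁻¹) := fun n τ hτ => by
    rw [Real.norm_of_nonneg (by positivity)]
    have := norm_sub_le (c n τ) (c n t)
    calc _ ≤ (1 + |(n : ℝ)|) ^ ⌈s⌉₊ * (‖c n τ‖ + ‖c n t‖) := by gcongr
      _ ≤ _ := by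
        rw [mul_add]
        linarith [hB n τ hτ, hB n t ht]
  have hsum := (summable_inv_one_add_sq.mul_left B).mul_left 2
  have h1 : ContinuousOn (fun τ => ∑' n : ℤ, (1 + |(n : ℝ)|) ^ ⌈s⌉₊ * ‖c n τ - c n t‖)
      (Set.Icc 0 T) :=
    continuousOn_tsum (fun n => continuousOn_const.mul ((hcont n).sub continuousOn_const).norm)
      hsum hbd
  have h2 := (ENNReal.continuous_ofReal.tendsto _).comp (h1 t ht)
  simp only [sub_self, norm_zero, mul_zero, tsum_zero, ENNReal.ofReal_zero] at h2
  refine tendsto_of_tendsto_of_tendsto_of_le_of_le' tendsto_const_nhds h2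
    (Eventually.of_forall fun _ => zero_le) ?_
  filter_upwards [self_mem_nhdsWithin] with τ hτ
  simp only [Function.comp_apply]
  rw [ENNReal.ofReal_tsum_of_nonneg (fun n => by positivity)
    (Summable.of_norm_bounded hsum fun n => hbd n τ hτ)]
  refine (lpN_le_tsum hp _).trans (ENNReal.tsum_le_tsum fun n => ?_)
  rw [one_mul, ENNReal.ofReal_mul (by positivity), ofReal_norm]
  gcongr
  exact jp_le_pow s n

/-- The solution map. -/
noncomputable def solMap (φ : Distrib) (t : ℝ) : Distrib :=
  ofSeq fun n => airy n t * sol (fourierCoef φ) n t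

namespace IsTriConst

variable {s : ℝ} {p : ℝ≥0∞} {T R : ℝ} {K M : ℝ≥0∞} {φ χ : Distrib} {t : ℝ}

theorem fourierCoef_solMap (h : IsTriConst s p T K) (hM : M ≠ ⊤) (hK : K * (3 * M ^ 2) ≤ 2⁻¹)
    (hφ : flNorm s p φ ≤ M / 2) (ht : t ∈ Set.Icc 0 T) (n : ℤ) :
    fourierCoef (solMap φ t) n = airy n t * sol (fourierCoef φ) n t := by
  rw [flNorm_eq] at hφ
  refine fourierCoef_ofSeq ⟨M.toReal, fun n => ?_⟩ n
  refine le_trans ?_ (le_mul_of_one_le_right ENNReal.toReal_nonneg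
    (le_add_of_nonneg_right (abs_nonneg _)))
  rw [norm_mul, norm_airy, one_mul, ← ENNReal.ofReal_le_iff_le_toReal hM, ofReal_norm]
  exact (enorm_le_hn _ ht).trans ((le_wN h.hs h.hp isWeight_one
    (fun n => hn T (sol (fourierCoef φ) n)) n).trans (h.xN_sol_le isWeight_one hM hK hφ))

theorem flNorm_solMap_le (h : IsTriConst s p T K) (hM : M ≠ ⊤) (hK : K * (3 * M ^ 2) ≤ 2⁻¹)
    (hφ : flNorm s p φ ≤ M / 2) (ht : t ∈ Set.Icc 0 T) : flNorm s p (solMap φ t) ≤ M := by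
  have hφ' := hφ
  rw [flNorm_eq] at hφ'
  rw [flNorm_eq]
  refine (wN_mono fun n => ?_).trans (h.xN_sol_le isWeight_one hM hK hφ')
  rw [h.fourierCoef_solMap hM hK hφ ht, enorm_mul, ← ofReal_norm (airy n t), norm_airy,
    ENNReal.ofReal_one, one_mul]
  exact enorm_le_hn _ ht

theorem flNorm_solMap_sub_le (h : IsTriConst s p T K) (hM : M ≠ ⊤) (hK : K * (3 * M ^ 2) ≤ 2⁻¹)
    (hφ : flNorm s p φ ≤ M / 2) (hχ : flNorm s p χ ≤ M / 2) (ht : t ∈ Set.Icc 0 T) :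
    flNorm s p (solMap φ t - solMap χ t) ≤ 2 * flNorm s p (φ - χ) := by
  have hφ' := hφ
  have hχ' := hχ
  rw [flNorm_eq] at hφ' hχ'
  rw [flNorm_eq, flNorm_eq]
  simp only [fourierCoef_sub]
  refine (wN_mono fun n => ?_).trans (h.xN_sol_sub_le isWeight_one hM hK hφ' hχ')
  rw [h.fourierCoef_solMap hM hK hφ ht, h.fourierCoef_solMap hM hK hχ ht, ← mul_sub, enorm_mul,
    ← ofReal_norm (airy n t), norm_airy, ENNReal.ofReal_one, one_mul]
  exact enorm_le_hn (fun t => sol (fourierCoef φ) n t - sol (fourierCoef χ) n t) ht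

theorem isProfile_solMap (h : IsTriConst s p T K) (hM : M ≠ ⊤) (hK : K * (3 * M ^ 2) ≤ 2⁻¹)
    {g : ℝ → ℝ} (hφ : flNorm s p φ < M / 2) (hg : IsSmoothData φ g) :
    IsProfile T (sol (fourierCoef φ)) :=
  h.isProfile_sol hM hK (flNorm_eq s p φ ▸ hφ) hg.rapid (isReal_iff.1 hg.isReal)

theorem tendsto_solMap_of_smooth (h : IsTriConst s p T K) (hM : M ≠ ⊤)
    (hK : K * (3 * M ^ 2) ≤ 2⁻¹) {g : ℝ → ℝ} (hφ : flNorm s p φ < M / 2) (hg : IsSmoothData φ g)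
    (ht : t ∈ Set.Icc 0 T) :
    Tendsto (fun τ => flNorm s p (solMap φ τ - solMap φ t)) (𝓝[Set.Icc 0 T] t) (𝓝 0) := by
  have hP := h.isProfile_solMap hM hK hφ hg
  refine (tendsto_wN_of_rapid (s := s) h.hp (c := fun n t => airy n t * sol (fourierCoef φ) n t)
    (fun k => ?_) (fun n => (continuous_airy n).continuousOn.mul (hP.cont n)) ht).congr' ?_
  · obtain ⟨B, h0, hB⟩ := hP.rapid k
    refine ⟨B, h0, fun n t ht => ?_⟩
    rw [norm_mul, norm_airy, one_mul]
    exact hB n t ht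
  · filter_upwards [self_mem_nhdsWithin] with τ hτ
    rw [flNorm_eq]
    simp only [fourierCoef_sub, h.fourierCoef_solMap hM hK hφ.le hτ,
      h.fourierCoef_solMap hM hK hφ.le ht]

/-- For `p = ∞`, continuity of the individual modes does not give continuity in norm. It is
inherited from smooth data by approximation, and the Lipschitz constant 2 accounts for the fifths `2
+ 1 + 2`. -/
theorem tendsto_solMap (h : IsTriConst s p T K) (hM : M ≠ ⊤) (hK : K * (3 * M ^ 2) ≤ 2⁻¹)
    (hR : ENNReal.ofReal R = M / 2) (hφ : φ ∈ ball s p R) (ht : t ∈ Set.Icc 0 T) :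
    Tendsto (fun τ => flNorm s p (solMap φ τ - solMap φ t)) (𝓝[Set.Icc 0 T] t) (𝓝 0) := by
  refine ENNReal.tendsto_nhds_zero.2 fun ε hε => ?_
  have hδ : 0 < ε / 5 := ENNReal.div_pos hε.ne' (by simp)
  obtain ⟨χ, g, hχ, hg, hlt⟩ := exists_smooth_near h.hp hφ hδ
  have h1 := hφ.2.1.le.trans hR.le
  have h2 := hχ.2.1.trans_le hR.le
  filter_upwards [(h.tendsto_solMap_of_smooth hM hK h2 hg ht).eventually (ge_mem_nhds hδ),
    self_mem_nhdsWithin] with τ hle hτ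
  calc flNorm s p (solMap φ τ - solMap φ t)
      ≤ flNorm s p (solMap φ τ - solMap χ τ) + (flNorm s p (solMap χ τ - solMap χ t) +
        flNorm s p (solMap χ t - solMap φ t)) :=
        (flNorm_sub_le h.hp _ (solMap χ τ) _).trans
          (by gcongr; exact flNorm_sub_le h.hp _ _ _)
    _ ≤ 2 * (ε / 5) + (ε / 5 + 2 * (ε / 5)) := by
        gcongr
        · exact (h.flNorm_solMap_sub_le hM hK h1 h2.le hτ).trans (by gcongr)
        · rw [flNorm_sub_comm]
          exact (h.flNorm_solMap_sub_le hM hK h1 h2.le ht).trans (by gcongr)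
    _ = 5 * (ε / 5) := by ring
    _ = ε := ENNReal.mul_div_cancel (by simp) (by simp)

theorem isSolutionMap (h : IsTriConst s p T K) (hM : M ≠ ⊤) (hK : K * (3 * M ^ 2) ≤ 2⁻¹)
    (hR : ENNReal.ofReal R = M / 2) : IsSolutionMap s p R T solMap := by
  refine ⟨fun φ hφ t ht => ⟨?_, ?_, h.tendsto_solMap hM hK hR hφ ht⟩, fun ε hε => ?_,
    fun φ hφ g hg => ?_⟩
  · have h1 := hφ.2.1.le.trans hR.le
    refine isReal_iff.2 fun n => ?_
    rw [h.fourierCoef_solMap hM hK h1 ht, h.fourierCoef_solMap hM hK h1 ht, map_mul, airy_neg,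
      h.sol_neg hM hK (flNorm_eq s p φ ▸ h1) (isReal_iff.1 hφ.1) n ht]
  · exact (h.flNorm_solMap_le hM hK (hφ.2.1.le.trans hR.le) ht).trans_lt hM.lt_top
  · refine ⟨ε / 2, ENNReal.div_pos hε.ne' (by simp), fun φ hφ χ hχ hlt t ht => ?_⟩
    refine (h.flNorm_solMap_sub_le hM hK (hφ.2.1.le.trans hR.le) (hχ.2.1.le.trans hR.le)
      ht).trans_lt ?_
    rwa [mul_comm, ← ENNReal.lt_div_iff_mul_lt (by simp) (by simp)]
  · have h1 := hφ.2.1.trans_le hR.le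
    have hP := h.isProfile_solMap hM hK h1 hg
    obtain ⟨w, hw, hψ⟩ := hP.exists_classicalSolution
    obtain ⟨ψ₀, hψ₀, hφ₀⟩ := hg.exists_test
    refine ⟨w, hw, ?_, fun t ht => ?_⟩
    · obtain ⟨ψ, e1, e2⟩ := hψ 0 ⟨le_rfl, h.hT.le⟩
      have : ψ = ψ₀ := by
        have h2 : ofFun ψ = ofFun ψ₀ := distrib_ext fun n => by
          rw [fourierCoef_ofFun, e2, airy_zero, one_mul,
            h.sol_zero hM hK (flNorm_eq s p φ ▸ h1.le), hφ₀]
        ext x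
        rw [← (hasSum_tc ψ x).tsum_eq, ← (hasSum_tc ψ₀ x).tsum_eq]
        simp only [← fourierCoef_ofFun, h2]
      rw [this, hψ₀] at e1
      funext x
      exact_mod_cast (congrFun e1 x).symm
    · obtain ⟨ψ, e1, e2⟩ := hψ t ht
      rw [← e1, represents_iff]
      refine distrib_ext fun n => ?_
      rw [fourierCoef_ofFun, e2, h.fourierCoef_solMap hM hK h1.le ht]

end IsTriConst

theorem exists_isSolutionMap {s : ℝ} {p p' : ℝ≥0∞} (hs : 1 / 2 ≤ s) (hp : 1 ≤ p)
    (hpp' : p⁻¹ + p'⁻¹ = 1) (hsp : 1 < p' * ENNReal.ofReal (s + 1 / 4)) (R : ℝ) :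
    ∃ T : ℝ, 0 < T ∧ ∃ W, IsSolutionMap s p R T W := by
  -- With `M = 2R`, data in `B(0,R)` are strictly below the bound `M / 2` of the Picard scheme.
  obtain ⟨T, K, h, hK⟩ := exists_isTriConst hs hp hpp' hsp (M := 2 * ENNReal.ofReal R)
    (by finiteness)
  refine ⟨T, h.hT, solMap, h.isSolutionMap (by finiteness) hK ?_⟩
  rw [ENNReal.mul_div_right_comm, ENNReal.div_self (by simp) (by simp), one_mul]

/-! ### The nonlinearity on `ℱL^{s,p}` as a distribution -/

/-- The Fourier coefficients of the nonlinearity. -/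
noncomputable def nlc (c : ℤ → ℂ) (n : ℤ) : ℂ :=
  -∑' q : ℤ × ℤ, coef q.1 q.2 (n - q.1 - q.2) * (c q.1 * c q.2 * c (n - q.1 - q.2))

/-- The nonlinearity of a distribution. -/
noncomputable def NL (f : Distrib) : Distrib := ofSeq (nlc (fourierCoef f))

theorem tc_nonT_eq_nlc (v : TestSpace) (n : ℤ) : tc (nonT v) n = nlc (tc v) n := by
  rw [nlc, (hasSum_nonT v n).tsum_eq, neg_neg]

/-- `D` is an admissible constant in the estimates of the cubic nonlinearity. -/
structure IsCubicConst (s : ℝ) (p D : ℝ≥0∞) : Prop where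
  hs : 0 ≤ s
  hp : 1 ≤ p
  ne_top : D ≠ ⊤
  bound : ∀ (A B E : ℤ → ℝ≥0∞) (n : ℤ), ∑' q : ℤ × ℤ, A q.1 * B q.2 * E (n - q.1 - q.2)
    ≤ D * (wN s p (fun _ => 1) A * wN s p (fun _ => 1) B * wN s p (fun _ => 1) E)

/-- The embedding into `H^α` with `α > 1/4` makes the cubic sum without derivative converge
absolutely: the weights `(1 + m²)^{-2α}` are summable. -/
theorem exists_isCubicConst {s : ℝ} {p p' : ℝ≥0∞} (hs : 1 / 2 ≤ s) (hp : 1 ≤ p)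
    (hpp' : p⁻¹ + p'⁻¹ = 1) (hsp : 1 < p' * ENNReal.ofReal (s + 1 / 4)) :
    ∃ D, IsCubicConst s p D := by
  obtain ⟨α, hα, C, hC, hN⟩ := exists_hN_le hs hp hpp' hsp
  have hS := tsum_jp_ne_top (γ := 2 * α) (by linarith)
  refine ⟨(1 + 2 * ∑' m, jp (-(2 * α)) m) * C ^ 3, by linarith, hp, by finiteness,
    fun A B E n => (tsum_trilinear_le (by linarith) A B E n).trans ?_⟩
  simp only [wN, one_mul]
  calc _ ≤ (1 + 2 * ∑' m, jp (-(2 * α)) m) * (C * lpN p (fun n => jp (s / 2) n * A n)) *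
        (C * lpN p (fun n => jp (s / 2) n * B n)) * (C * lpN p (fun n => jp (s / 2) n * E n)) := by
        gcongr
        · exact hN A
        · exact hN B
        · exact hN E
    _ = _ := by ring

theorem enorm_coef_le (n : ℤ) (q : ℤ × ℤ) :
    ‖coef q.1 q.2 (n - q.1 - q.2)‖ₑ ≤ ENNReal.ofReal |(n : ℝ)| := by
  rw [← ofReal_norm]; exact ENNReal.ofReal_le_ofReal (norm_coef_le n q)

namespace IsCubicConst

variable {s : ℝ} {p D : ℝ≥0∞}

theorem summable_terms (h : IsCubicConst s p D) {c : ℤ → ℂ}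
    (hc : wN s p (fun _ => 1) (fun n => ‖c n‖ₑ) ≠ ⊤) (n : ℤ) :
    Summable fun q : ℤ × ℤ =>
      coef q.1 q.2 (n - q.1 - q.2) * (c q.1 * c q.2 * c (n - q.1 - q.2)) := by
  have hD := h.ne_top
  refine Summable.of_enorm (ne_top_of_le_ne_top
    (by finiteness : ENNReal.ofReal |(n : ℝ)| * (D * (wN s p (fun _ => 1) (fun n => ‖c n‖ₑ) *
      wN s p (fun _ => 1) (fun n => ‖c n‖ₑ) * wN s p (fun _ => 1) (fun n => ‖c n‖ₑ))) ≠ ⊤) ?_)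
  refine le_trans ?_ (mul_le_mul_right (h.bound (fun n => ‖c n‖ₑ) (fun n => ‖c n‖ₑ)
    (fun n => ‖c n‖ₑ) n) _)
  rw [← ENNReal.tsum_mul_left]
  refine ENNReal.tsum_le_tsum fun q => ?_
  rw [enorm_mul, enorm_mul, enorm_mul]
  gcongr
  exact enorm_coef_le n q

/-- Telescoping the cubic terms gives a Lipschitz bound on bounded sets at the price of one factor
`|n|`, which the smoothness of the test function absorbs. -/
theorem enorm_nlc_sub_le (h : IsCubicConst s p D) {c d : ℤ → ℂ} {L : ℝ≥0∞} (hL : L ≠ ⊤)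
    (hc : wN s p (fun _ => 1) (fun n => ‖c n‖ₑ) ≤ L)
    (hd : wN s p (fun _ => 1) (fun n => ‖d n‖ₑ) ≤ L) (n : ℤ) :
    ‖nlc c n - nlc d n‖ₑ ≤ ENNReal.ofReal |(n : ℝ)| *
      (3 * D * L ^ 2 * wN s p (fun _ => 1) fun n => ‖c n - d n‖ₑ) := by
  set e : ℤ → ℝ≥0∞ := fun n => ‖c n - d n‖ₑ with he
  have h1 := h.summable_terms (ne_top_of_le_ne_top hL hc) n
  have h2 := h.summable_terms (ne_top_of_le_ne_top hL hd) n
  have h3 : ‖nlc c n - nlc d n‖ₑ ≤ ∑' q : ℤ × ℤ, ENNReal.ofReal |(n : ℝ)| *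
      (e q.1 * ‖c q.2‖ₑ * ‖c (n - q.1 - q.2)‖ₑ + ‖d q.1‖ₑ * e q.2 * ‖c (n - q.1 - q.2)‖ₑ
        + ‖d q.1‖ₑ * ‖d q.2‖ₑ * e (n - q.1 - q.2)) := by
    rw [nlc, nlc, neg_sub_neg, ← enorm_neg, neg_sub, ← h1.tsum_sub h2]
    refine enorm_tsum_le_tsum_enorm.trans (ENNReal.tsum_le_tsum fun q => ?_)
    rw [← mul_sub, enorm_mul]
    gcongr
    · exact enorm_coef_le n q
    · set r := n - q.1 - q.2
      rw [show c q.1 * c q.2 * c r - d q.1 * d q.2 * d r = (c q.1 - d q.1) * c q.2 * c r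
        + d q.1 * (c q.2 - d q.2) * c r + d q.1 * d q.2 * (c r - d r) by ring]
      refine (enorm_add_le _ _).trans (add_le_add ((enorm_add_le _ _).trans ?_) ?_)
      · simp only [enorm_mul, he]; rfl
      · simp only [enorm_mul, he]; rfl
  refine h3.trans ?_
  rw [ENNReal.tsum_mul_left, ENNReal.tsum_add, ENNReal.tsum_add]
  gcongr
  set N := wN s p (fun _ => 1) e
  calc _ ≤ D * (N * L * L) + D * (L * N * L) + D * (L * L * N) := by
        gcongr
        · exact (h.bound e (fun n => ‖c n‖ₑ) (fun n => ‖c n‖ₑ) n).trans (by gcongr)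
        · exact (h.bound (fun n => ‖d n‖ₑ) e (fun n => ‖c n‖ₑ) n).trans (by gcongr)
        · exact (h.bound (fun n => ‖d n‖ₑ) (fun n => ‖d n‖ₑ) e n).trans (by gcongr)
    _ = 3 * D * L ^ 2 * N := by ring

theorem exists_nlc_le (h : IsCubicConst s p D) {c : ℤ → ℂ}
    (hc : wN s p (fun _ => 1) (fun n => ‖c n‖ₑ) ≠ ⊤) :
    ∃ B, ∀ n : ℤ, ‖nlc c n‖ ≤ B * (1 + |(n : ℝ)|) := by
  have hD := h.ne_top
  set L := wN s p (fun _ => 1) (fun n => ‖c n‖ₑ)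
  refine ⟨(3 * D * L ^ 2 * L).toReal, fun n => ?_⟩
  have h1 := h.enorm_nlc_sub_le (d := fun _ => 0) hc le_rfl
    ((wN_mono fun n => by simp).trans le_rfl) n
  simp only [sub_zero] at h1
  have h2 : nlc (fun _ => 0) n = 0 := by simp [nlc]
  rw [h2, sub_zero] at h1
  have h3 : ‖nlc c n‖ ≤ |(n : ℝ)| * (3 * D * L ^ 2 * L).toReal := by
    rw [← ENNReal.toReal_ofReal (abs_nonneg (n : ℝ)), ← ENNReal.toReal_mul,
      ← ENNReal.ofReal_le_iff_le_toReal (by finiteness), ofReal_norm]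
    exact h1
  refine h3.trans ?_
  rw [mul_comm]
  gcongr
  linarith

theorem hasSum_NL (h : IsCubicConst s p D) {f : Distrib} (hf : flNorm s p f ≠ ⊤) (ψ : TestSpace) :
    HasSum (fun n => 2 * Real.pi * (nlc (fourierCoef f) n * tc ψ (-n)))
      ((NL f : Module.Dual ℂ TestSpace) ψ) := by
  rw [flNorm_eq] at hf
  have h1 := hasSum_distrib_coef (NL f) ψ
  simp only [NL, fourierCoef_ofSeq (h.exists_nlc_le hf)] at h1
  exact h1

/-- Consistency with the pointwise nonlinearity. It applies to the truncations in the limit defining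
`𝒩 u` and to the classical approximations. -/
theorem NL_ofFun (h : IsCubicConst s p D) {v : TestSpace} (hv : flNorm s p (ofFun v) ≠ ⊤)
    (ψ : TestSpace) : (NL (ofFun v) : Module.Dual ℂ TestSpace) ψ
      = ∫ x in (0 : ℝ)..(2 * Real.pi), nonlin (v : ℝ → ℂ) x * (ψ : ℝ → ℂ) x := by
  simp only [nonlin_eq_nonT]
  refine (h.hasSum_NL hv ψ).unique (hasSum_of_eq (hasSum_parseval (nonT v) ψ) (fun n => ?_) rfl)
  rw [tc_nonT_eq_nlc]; rfl

end IsCubicConst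

/-! ### Pairing with test functions -/

/-- `2π ∑ |n|^k |ψ̂(n)|`. -/
noncomputable def testNorm (k : ℕ) (ψ : TestSpace) : ℝ≥0∞ :=
  ENNReal.ofReal (2 * Real.pi * ∑' n : ℤ, |(n : ℝ)| ^ k * ‖tc ψ n‖)

theorem testNorm_ne_top (k : ℕ) (ψ : TestSpace) : testNorm k ψ ≠ ⊤ := ENNReal.ofReal_ne_top

theorem testNorm_le {k : ℕ} {ψ : TestSpace} {M : ℝ}
    (h : ∀ j ≤ k + 2, ∀ x, ‖iteratedDeriv j (ψ : ℝ → ℂ) x‖ ≤ M) :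
    testNorm k ψ ≤ ENNReal.ofReal (2 * Real.pi * (2 * M * sumInv)) := by
  refine ENNReal.ofReal_le_ofReal ?_
  gcongr
  exact tsum_abs_pow_mul_norm_tc_le h

/-- Coefficients growing like `|n|^k` are paired with a test function through Parseval's series. The
case `k = 0` serves the linear terms, `k = 1` the nonlinearity. -/
theorem enorm_le_of_hasSum {c : ℤ → ℂ} {ψ : TestSpace} {z : ℂ} {k : ℕ} {B : ℝ≥0∞}
    (hz : HasSum (fun n => 2 * Real.pi * (c n * tc ψ (-n))) z)
    (hc : ∀ n : ℤ, ‖c n‖ₑ ≤ ENNReal.ofReal (|(n : ℝ)| ^ k) * B) : ‖z‖ₑ ≤ testNorm k ψ * B := by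
  rw [← hz.tsum_eq]
  have hs := (summable_abs_pow_mul_norm_tc ψ k).mul_left (2 * Real.pi)
  rw [testNorm, ← tsum_mul_left, ENNReal.ofReal_tsum_of_nonneg (fun n => by positivity) hs,
    ← ENNReal.tsum_mul_right, ← (Equiv.neg ℤ).tsum_eq]
  refine enorm_tsum_le_tsum_enorm.trans (ENNReal.tsum_le_tsum fun n => ?_)
  have h1 : ‖(2 * Real.pi : ℂ)‖ₑ = ENNReal.ofReal (2 * Real.pi) := by
    rw [← ofReal_norm]
    congr 1
    rw [norm_mul, Complex.norm_real, Real.norm_eq_abs, abs_of_pos Real.pi_pos, Complex.norm_ofNat]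
  rw [enorm_mul (2 * Real.pi : ℂ), enorm_mul (c _), h1, Equiv.neg_apply, neg_neg,
    ENNReal.ofReal_mul (q := |(n : ℝ)| ^ k * ‖tc ψ n‖) (by positivity),
    ENNReal.ofReal_mul (q := ‖tc ψ n‖) (by positivity), ofReal_norm]
  calc _ ≤ ENNReal.ofReal (2 * Real.pi) *
        (ENNReal.ofReal (|(n : ℝ)| ^ k) * B * ‖tc ψ n‖ₑ) := by
          gcongr; simpa using hc (-n)
    _ = _ := by ring

theorem enorm_distrib_sub_le {s : ℝ} {p : ℝ≥0∞} (hs : 0 ≤ s) (hp : 1 ≤ p) (f g : Distrib)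
    (ψ : TestSpace) :
    ‖(f : Module.Dual ℂ TestSpace) ψ - (g : Module.Dual ℂ TestSpace) ψ‖ₑ
      ≤ testNorm 0 ψ * flNorm s p (f - g) := by
  refine enorm_le_of_hasSum (hasSum_distrib_coef (f - g) ψ) fun n => ?_
  rw [pow_zero, ENNReal.ofReal_one, one_mul]
  exact enorm_fourierCoef_le hs hp (f - g) n

theorem IsCubicConst.enorm_NL_sub_le {s : ℝ} {p D : ℝ≥0∞} (h : IsCubicConst s p D) {L : ℝ≥0∞}
    (hL : L ≠ ⊤) {f g : Distrib} (hf : flNorm s p f ≤ L) (hg : flNorm s p g ≤ L) (ψ : TestSpace) :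
    ‖(NL f : Module.Dual ℂ TestSpace) ψ - (NL g : Module.Dual ℂ TestSpace) ψ‖ₑ
      ≤ testNorm 1 ψ * (3 * D * L ^ 2 * flNorm s p (f - g)) := by
  refine enorm_le_of_hasSum (hasSum_of_eq
    ((h.hasSum_NL (ne_top_of_le_ne_top hL hf) ψ).sub (h.hasSum_NL (ne_top_of_le_ne_top hL hg) ψ))
    (fun n => ?_) rfl) (c := fun n => nlc (fourierCoef f) n - nlc (fourierCoef g) n) fun n => ?_
  · ring
  · rw [flNorm_eq] at hf hg
    rw [pow_one, flNorm_eq]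
    simp only [fourierCoef_sub]
    exact h.enorm_nlc_sub_le hL hf hg n

theorem exists_pos_mul_lt {C ε : ℝ≥0∞} (hC : C ≠ ⊤) (hε : 0 < ε) : ∃ δ > 0, C * δ < ε := by
  have h1 : min ε 1 ≠ ⊤ := by simp
  have h0 : min ε 1 ≠ 0 := (lt_min hε one_pos).ne'
  refine ⟨min ε 1 / 2 / (C + 1), ENNReal.div_pos (ENNReal.half_pos h0).ne' (by finiteness), ?_⟩
  calc C * (min ε 1 / 2 / (C + 1)) ≤ (C + 1) * (min ε 1 / 2 / (C + 1)) := by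
        gcongr; exact le_self_add
    _ = min ε 1 / 2 := ENNReal.mul_div_cancel (by simp) (by finiteness)
    _ < min ε 1 := ENNReal.half_lt_self h0 h1
    _ ≤ ε := min_le_left _ _

/-! ### Truncations, uniform tails, and the limit defining `𝒩 u` -/

/-- The truncation of a distribution to frequencies at most `N`, as a test function. -/
noncomputable def truncT (N : ℕ) (f : Distrib) : TestSpace :=
  partialSum (fourierCoef f) (Finset.Icc (-(N : ℤ)) N)

theorem coe_truncT (N : ℕ) (f : Distrib) : (truncT N f : ℝ → ℂ) = trunc N f := by
  funext x
  simp [truncT, trunc, partialSum]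

/-- The norm of the frequencies greater than `N`. -/
noncomputable def tail (s : ℝ) (p : ℝ≥0∞) (N : ℕ) (f : Distrib) : ℝ≥0∞ :=
  wN s p (fun _ => 1) fun n => if n ∈ Finset.Icc (-(N : ℤ)) N then 0 else ‖fourierCoef f n‖ₑ

section tail

variable {s : ℝ} {p : ℝ≥0∞}

theorem flNorm_truncT_sub (N : ℕ) (f : Distrib) :
    flNorm s p (ofFun (truncT N f) - f) = tail s p N f := by
  rw [flNorm_eq, tail]
  congr 1; ext n
  rw [fourierCoef_sub, fourierCoef_ofFun, truncT, tc_partialSum]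
  split_ifs <;> simp

theorem flNorm_truncT_le (N : ℕ) (f : Distrib) : flNorm s p (ofFun (truncT N f)) ≤ flNorm s p f := by
  rw [flNorm_eq, flNorm_eq]
  refine wN_mono fun n => ?_
  rw [fourierCoef_ofFun, truncT, tc_partialSum]
  split_ifs <;> simp

theorem tail_anti {M N : ℕ} (h : M ≤ N) (f : Distrib) : tail s p N f ≤ tail s p M f := by
  refine wN_mono fun n => ?_
  simp only [Finset.mem_Icc]
  split_ifs
  · exact le_rfl
  · exact zero_le
  · omega
  · exact le_rfl

theorem tail_le_add (hp : 1 ≤ p) (N : ℕ) (f g : Distrib) :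
    tail s p N f ≤ flNorm s p (f - g) + tail s p N g := by
  rw [flNorm_eq]
  refine (wN_mono fun n => ?_).trans (wN_add_le hp _ _)
  rw [fourierCoef_sub]
  split_ifs
  · exact zero_le
  · calc ‖fourierCoef f n‖ₑ = ‖fourierCoef f n - fourierCoef g n + fourierCoef g n‖ₑ := by
          rw [sub_add_cancel]
      _ ≤ _ := enorm_add_le _ _

theorem exists_tail_ofFun_le (hp : 1 ≤ p) (ψ : TestSpace) {ε : ℝ≥0∞} (hε : 0 < ε) :
    ∃ N, tail s p N (ofFun ψ) ≤ ε := by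
  obtain ⟨b, hb, hle⟩ := (rapid_tc ψ).exists_majorant s 0
  obtain ⟨N, hN⟩ := exists_lpN_tail_le (p := 1) le_rfl (by simp) (A := b) (by rwa [lpN_one]) hε
  rw [lpN_one] at hN
  refine ⟨N, (lpN_le_tsum hp _).trans (le_trans (ENNReal.tsum_le_tsum fun n => ?_) hN)⟩
  have := hle n () trivial
  beta_reduce
  split_ifs
  · simp
  · rw [fourierCoef_ofFun]; simpa using this

end tail

namespace IsContFL

variable {s T : ℝ} {p : ℝ≥0∞} {u : ℝ → Distrib}

/-- Norm continuity gives local bounds, and compactness of `[0,T]` makes them global. -/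
theorem exists_bound (hp : 1 ≤ p) (hu : IsContFL s p T u) :
    ∃ L ≠ ⊤, ∀ t ∈ Set.Icc 0 T, flNorm s p (u t) ≤ L := by
  refine isCompact_Icc.induction_on (p := fun S => ∃ L ≠ ⊤, ∀ t ∈ S, flNorm s p (u t) ≤ L)
    ⟨0, by simp, by simp⟩ (fun S S' h ⟨L, h1, h2⟩ => ⟨L, h1, fun t ht => h2 t (h ht)⟩)
    (fun S S' ⟨L, h1, h2⟩ ⟨L', h1', h2'⟩ => ⟨max L L', by simp [h1, h1'], ?_⟩) fun t ht => ?_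
  · rintro t (ht | ht)
    · exact (h2 t ht).trans (le_max_left _ _)
    · exact (h2' t ht).trans (le_max_right _ _)
  · obtain ⟨-, h1, h2⟩ := hu t ht
    refine ⟨_, h2.eventually (ge_mem_nhds one_pos), 1 + flNorm s p (u t), by finiteness,
      fun τ hτ => ?_⟩
    exact (flNorm_le_add hp (u τ) (u t)).trans (add_le_add_left hτ _)

/-- Near each time the curve is close to one smooth function, whose tail is small. Compactness
leaves finitely many cut-offs, and tails decrease in `N`. For `p = ∞` approximability by smooth
functions is essential, as tails need not vanish otherwise. -/
theorem exists_tail_le (hp : 1 ≤ p) (hu : IsContFL s p T u)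
    (h : ∀ t ∈ Set.Icc 0 T, ∀ ε > 0, ∃ ψ : TestSpace, flNorm s p (u t - ofFun ψ) < ε)
    {ε : ℝ≥0∞} (hε : 0 < ε) : ∃ N, ∀ t ∈ Set.Icc 0 T, tail s p N (u t) ≤ ε := by
  refine isCompact_Icc.induction_on (p := fun S => ∃ N, ∀ t ∈ S, tail s p N (u t) ≤ ε)
    ⟨0, by simp⟩ (fun S S' h ⟨L, h2⟩ => ⟨L, fun t ht => h2 t (h ht)⟩)
    (fun S S' ⟨L, h2⟩ ⟨L', h2'⟩ => ⟨max L L', ?_⟩) fun t ht => ?_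
  · rintro t (ht | ht)
    · exact (tail_anti (le_max_left _ _) _).trans (h2 t ht)
    · exact (tail_anti (le_max_right _ _) _).trans (h2' t ht)
  · have hε3 : 0 < ε / 3 := ENNReal.div_pos hε.ne' (by simp)
    obtain ⟨ψ, hψ⟩ := h t ht _ hε3
    obtain ⟨N, hN⟩ := exists_tail_ofFun_le (s := s) hp ψ hε3
    refine ⟨_, (hu t ht).2.2.eventually (ge_mem_nhds hε3), N, fun τ hτ => ?_⟩
    calc tail s p N (u τ) ≤ flNorm s p (u τ - u t) +
          (flNorm s p (u t - ofFun ψ) + tail s p N (ofFun ψ)) :=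
          (tail_le_add hp N _ (u t)).trans (by gcongr; exact tail_le_add hp N _ _)
      _ ≤ ε / 3 + (ε / 3 + ε / 3) := by gcongr; exact hτ
      _ = 3 * (ε / 3) := by ring
      _ = ε := ENNReal.mul_div_cancel (by simp) (by simp)

/-- The local Lipschitz bound for `NL` turns norm continuity of `u` into weak continuity, and
uniformly small tails into uniform convergence along truncations. -/
theorem isNonlinearity_NL {D : ℝ≥0∞} (hD : IsCubicConst s p D) (hu : IsContFL s p T u)
    (h : ∀ t ∈ Set.Icc 0 T, ∀ ε > 0, ∃ ψ : TestSpace, flNorm s p (u t - ofFun ψ) < ε) :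
    IsNonlinearity T u fun t => NL (u t) := by
  obtain ⟨L, hL, hb⟩ := hu.exists_bound hD.hp
  intro ψ
  have hC : testNorm 1 ψ * (3 * D * L ^ 2) ≠ ⊤ := by
    have h1 := testNorm_ne_top 1 ψ
    have h2 := hD.ne_top
    finiteness
  refine ⟨fun t ht => tendsto_iff_edist_tendsto_0.2 ?_,
    EMetric.tendstoUniformlyOn_iff.2 fun ε hε => ?_⟩
  · have h1 := ENNReal.Tendsto.const_mul (hu t ht).2.2 (Or.inr hC)
    rw [mul_zero] at h1
    refine tendsto_of_tendsto_of_tendsto_of_le_of_le' tendsto_const_nhds h1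
      (Eventually.of_forall fun _ => zero_le) ?_
    filter_upwards [self_mem_nhdsWithin] with τ hτ
    rw [edist_eq_enorm_sub, mul_assoc]
    exact hD.enorm_NL_sub_le hL (hb τ hτ) (hb t ht) ψ
  · obtain ⟨δ, hδ, hlt⟩ := exists_pos_mul_lt hC hε
    obtain ⟨N₀, hN₀⟩ := hu.exists_tail_le hD.hp h hδ
    filter_upwards [eventually_ge_atTop N₀] with N hN t ht
    have h1 := (flNorm_truncT_le N (u t)).trans (hb t ht)
    rw [← coe_truncT, ← hD.NL_ofFun (ne_top_of_le_ne_top hL h1), edist_comm, edist_eq_enorm_sub]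
    refine (hD.enorm_NL_sub_le hL h1 (hb t ht) ψ).trans_lt (lt_of_le_of_lt ?_ hlt)
    rw [flNorm_truncT_sub, ← mul_assoc]
    gcongr
    exact (tail_anti hN _).trans (hN₀ t ht)

end IsContFL

/-! ### Approximation of an arbitrary extended solution map -/

theorem IsClassicalSolution.exists_test {T : ℝ} {v : ℝ → ℝ → ℝ} (hv : IsClassicalSolution T v)
    {t : ℝ} (ht : t ∈ Set.Icc 0 T) : ∃ ψ : TestSpace, (ψ : ℝ → ℂ) = fun x => (v t x : ℂ) :=
  exists_test_of_real (hv.smooth t ht) (hv.periodic t ht)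

namespace IsSolutionMap

variable {s R T : ℝ} {p : ℝ≥0∞} {W : Distrib → ℝ → Distrib} {φ : Distrib}

/-- The link to classical solutions for an arbitrary `W`: density of smooth data in the ball and
uniform continuity give a classical solution near `W φ`, uniformly in time. -/
theorem exists_classical_near (hp : 1 ≤ p) (hW : IsSolutionMap s p R T W) (hφ : φ ∈ ball s p R)
    {ε : ℝ≥0∞} (hε : 0 < ε) : ∃ χ ∈ ball s p R, flNorm s p (φ - χ) < ε ∧
      (∀ t ∈ Set.Icc 0 T, flNorm s p (W φ t - W χ t) < ε) ∧ ∃ v, IsClassicalSolution T v ∧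
        Represents (fun x => (v 0 x : ℂ)) χ ∧
        ∀ t ∈ Set.Icc 0 T, Represents (fun x => (v t x : ℂ)) (W χ t) := by
  obtain ⟨δ, hδ, hlt⟩ := hW.unifCont ε hε
  obtain ⟨χ, g, hχ, hg, hφχ⟩ := exists_smooth_near hp hφ (lt_min hε hδ)
  obtain ⟨v, hv, h0, hr⟩ := hW.extends_smooth χ hχ g hg
  exact ⟨χ, hχ, hφχ.trans_le (min_le_left _ _),
    hlt φ hφ χ hχ (hφχ.trans_le (min_le_right _ _)), v, hv, h0 ▸ hg.2.2, hr⟩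

theorem exists_test_near (hp : 1 ≤ p) (hW : IsSolutionMap s p R T W) (hφ : φ ∈ ball s p R)
    {t : ℝ} (ht : t ∈ Set.Icc 0 T) {ε : ℝ≥0∞} (hε : 0 < ε) :
    ∃ ψ : TestSpace, flNorm s p (W φ t - ofFun ψ) < ε := by
  obtain ⟨χ, -, -, h1, v, hv, -, hr⟩ := hW.exists_classical_near hp hφ hε
  obtain ⟨ψ, hψ⟩ := hv.exists_test ht
  refine ⟨ψ, ?_⟩
  rw [← (represents_iff ψ _).1 (hψ ▸ hr t ht)]
  exact h1 t ht

theorem apply_zero (hs : 0 ≤ s) (hp : 1 ≤ p) (hT : 0 ≤ T) (hW : IsSolutionMap s p R T W)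
    (hφ : φ ∈ ball s p R) : W φ 0 = φ := by
  have h0 : (0 : ℝ) ∈ Set.Icc 0 T := ⟨le_rfl, hT⟩
  refine distrib_ext fun n => ?_
  have h1 : ∀ ε > 0, ‖fourierCoef (W φ 0 - φ) n‖ₑ ≤ ε := by
    intro ε hε
    obtain ⟨χ, -, h1, h2, v, hv, hχ, hr⟩ := hW.exists_classical_near hp hφ (ENNReal.half_pos hε.ne')
    obtain ⟨ψ, hψ⟩ := hv.exists_test h0
    have e : W χ 0 = χ := by
      rw [(represents_iff ψ (W χ 0)).1 (hψ ▸ hr 0 h0), (represents_iff ψ χ).1 (hψ ▸ hχ)]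
    have h3 := h2 0 h0
    rw [e] at h3
    calc _ ≤ flNorm s p (W φ 0 - φ) := enorm_fourierCoef_le hs hp _ n
      _ ≤ flNorm s p (W φ 0 - χ) + flNorm s p (χ - φ) := flNorm_sub_le hp _ _ _
      _ ≤ ε / 2 + ε / 2 := by rw [flNorm_sub_comm s p χ]; gcongr
      _ = ε := ENNReal.add_halves ε
  have h2 : ‖fourierCoef (W φ 0 - φ) n‖ₑ = 0 := by
    by_contra h
    obtain ⟨δ, h3, h4⟩ := exists_between (pos_iff_ne_zero.2 h)
    exact (h1 δ h3).not_gt h4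
  rwa [enorm_eq_zero, fourierCoef_sub, sub_eq_zero] at h2

end IsSolutionMap

/-! ### The weak equation for classical solutions -/

section jointly_smooth

variable {F : ℝ → ℝ → ℂ}

theorem contDiff_deriv_right (hF : ContDiff ℝ ∞ fun q : ℝ × ℝ => F q.1 q.2) :
    ContDiff ℝ ∞ fun q : ℝ × ℝ => deriv (F q.1) q.2 := by
  have h : (fun q : ℝ × ℝ => deriv (F q.1) q.2)
      = fun q => fderiv ℝ (fun q : ℝ × ℝ => F q.1 q.2) q (0, 1) := by
    funext q
    have h1 := (hF.differentiable (by simp) q).hasFDerivAt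
    have h2 : HasDerivAt (fun y : ℝ => (q.1, y)) ((0 : ℝ), (1 : ℝ)) q.2 :=
      (hasDerivAt_const q.2 q.1).prodMk (hasDerivAt_id q.2)
    exact (h1.comp_hasDerivAt q.2 h2).deriv
  rw [h]
  exact (hF.fderiv_right (m := ∞) (by simp)).clm_apply contDiff_const

theorem hasDerivAt_left (hF : ContDiff ℝ ∞ fun q : ℝ × ℝ => F q.1 q.2) (t x : ℝ) :
    HasDerivAt (fun τ => F τ x) (fderiv ℝ (fun q : ℝ × ℝ => F q.1 q.2) (t, x) (1, 0)) t := by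
  have h1 := (hF.differentiable (by simp) (t, x)).hasFDerivAt
  have h2 : HasDerivAt (fun τ : ℝ => (τ, x)) ((1 : ℝ), (0 : ℝ)) t :=
    (hasDerivAt_id t).prodMk (hasDerivAt_const t x)
  have h3 := h1.comp_hasDerivAt t h2
  exact h3

theorem contDiff_deriv_left (hF : ContDiff ℝ ∞ fun q : ℝ × ℝ => F q.1 q.2) :
    ContDiff ℝ ∞ fun q : ℝ × ℝ => deriv (fun τ => F τ q.2) q.1 := by
  simp only [fun q : ℝ × ℝ => (hasDerivAt_left hF q.1 q.2).deriv]
  exact (hF.fderiv_right (m := ∞) (by simp)).clm_apply contDiff_const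

theorem contDiff_iteratedDeriv_right (hF : ContDiff ℝ ∞ fun q : ℝ × ℝ => F q.1 q.2) (k : ℕ) :
    ContDiff ℝ ∞ fun q : ℝ × ℝ => iteratedDeriv k (F q.1) q.2 := by
  induction k with
  | zero => simpa using hF
  | succ k ih =>
    simp only [iteratedDeriv_succ]
    exact contDiff_deriv_right (F := fun t => iteratedDeriv k (F t)) ih

theorem exists_bound_iteratedDeriv_slices {ψ : ℝ → TestSpace}
    (hψ : ContDiff ℝ ∞ fun q : ℝ × ℝ => (ψ q.1 : ℝ → ℂ) q.2) (T : ℝ) (k : ℕ) :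
    ∃ M, ∀ t ∈ Set.Icc 0 T, ∀ j ≤ k, ∀ x, ‖iteratedDeriv j (ψ t : ℝ → ℂ) x‖ ≤ M := by
  have h1 : ∀ j, ∃ M, ∀ t ∈ Set.Icc 0 T, ∀ x, ‖iteratedDeriv j (ψ t : ℝ → ℂ) x‖ ≤ M := by
    intro j
    obtain ⟨M, hM⟩ := (isCompact_Icc.prod isCompact_Icc :
      IsCompact (Set.Icc 0 T ×ˢ Set.Icc 0 (2 * Real.pi))).exists_bound_of_continuousOn
      (contDiff_iteratedDeriv_right (F := fun t => (ψ t : ℝ → ℂ)) hψ j).continuous.continuousOn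
    refine ⟨M, fun t ht x => ?_⟩
    rw [← iterate_der]
    obtain ⟨y, hy, hxy⟩ := (der^[j] (ψ t)).2.2.exists_mem_Ico₀ Real.two_pi_pos x
    rw [hxy, iterate_der]
    exact hM (t, y) ⟨ht, hy.1, hy.2.le⟩
  choose M hM using h1
  refine ⟨∑ j ∈ Finset.range (k + 1), |M j|, fun t ht j hj x => (hM j t ht x).trans
    ((le_abs_self _).trans ?_)⟩
  exact Finset.single_le_sum (f := fun j => |M j|) (fun _ _ => abs_nonneg _)
    (Finset.mem_range.2 (by omega))

theorem exists_testNorm_le {ψ : ℝ → TestSpace}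
    (hψ : ContDiff ℝ ∞ fun q : ℝ × ℝ => (ψ q.1 : ℝ → ℂ) q.2) (T : ℝ) (k : ℕ) :
    ∃ C ≠ ⊤, ∀ t ∈ Set.Icc 0 T, testNorm k (ψ t) ≤ C := by
  obtain ⟨M, hM⟩ := exists_bound_iteratedDeriv_slices hψ T (k + 2)
  exact ⟨_, ENNReal.ofReal_ne_top, fun t ht => testNorm_le (hM t ht)⟩

end jointly_smooth

theorem integral_integral_swap_of_continuous {H : ℝ → ℝ → ℂ}
    (hH : Continuous fun q : ℝ × ℝ => H q.1 q.2) {a b c d : ℝ} (hab : a ≤ b) (hcd : c ≤ d) :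
    ∫ t in a..b, ∫ x in c..d, H t x = ∫ x in c..d, ∫ t in a..b, H t x := by
  simp only [intervalIntegral.integral_of_le hab, intervalIntegral.integral_of_le hcd]
  refine integral_integral_swap ?_
  rw [Measure.prod_restrict]
  exact (hH.continuousOn.integrableOn_compact (isCompact_Icc.prod isCompact_Icc)).mono_set
    (Set.prod_mono Set.Ioc_subset_Icc_self Set.Ioc_subset_Icc_self)

theorem integral_der_mul (a b : TestSpace) :
    ∫ x in (0 : ℝ)..(2 * Real.pi), (der a : ℝ → ℂ) x * (b : ℝ → ℂ) x
      = -∫ x in (0 : ℝ)..(2 * Real.pi), (a : ℝ → ℂ) x * (der b : ℝ → ℂ) x := by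
  refine (hasSum_parseval (der a) b).unique
    (hasSum_of_eq (hasSum_parseval a (der b)).neg (fun n => ?_) rfl)
  rw [tc_der, tc_der]
  push_cast
  ring

theorem integral_mul_der3 (a b : TestSpace) :
    ∫ x in (0 : ℝ)..(2 * Real.pi), (a : ℝ → ℂ) x * iteratedDeriv 3 (b : ℝ → ℂ) x
      = -∫ x in (0 : ℝ)..(2 * Real.pi), iteratedDeriv 3 (a : ℝ → ℂ) x * (b : ℝ → ℂ) x := by
  rw [← iterate_der, ← iterate_der]
  simp only [Function.iterate_succ, Function.iterate_zero, Function.comp_apply, id_eq,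
    integral_der_mul, neg_neg]

namespace IsClassicalSolution

variable {T : ℝ} {v : ℝ → ℝ → ℝ}

theorem continuous_clamp (hv : IsClassicalSolution T v) (hT : 0 < T) (k : ℕ) :
    Continuous fun q : ℝ × ℝ => iteratedDeriv k (v (max 0 (min T q.1))) q.2 :=
  (hv.cont k).comp_continuous (f := fun q : ℝ × ℝ => (max 0 (min T q.1), q.2)) (by fun_prop)
    fun q => ⟨clamp_mem hT q.1, trivial⟩

theorem continuous_clamp_zero (hv : IsClassicalSolution T v) (hT : 0 < T) :
    Continuous fun q : ℝ × ℝ => v (max 0 (min T q.1)) q.2 := by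
  simpa using hv.continuous_clamp hT 0

theorem continuous_nonlin_clamp (hv : IsClassicalSolution T v) (hT : 0 < T) :
    Continuous fun q : ℝ × ℝ => nonlin (v (max 0 (min T q.1))) q.2 := by
  have h0 := hv.continuous_clamp_zero hT
  have h1 := hv.continuous_clamp hT 1
  simp only [iteratedDeriv_one] at h1
  have hp : Continuous fun q : ℝ × ℝ => v (max 0 (min T q.1)) q.2 ^ 2 := h0.pow 2
  have h2 : Continuous fun q : ℝ × ℝ =>
      ∫ y in (0 : ℝ)..(2 * Real.pi), v (max 0 (min T q.1)) y ^ 2 := (intervalIntegral.continuous_parametric_intervalIntegral_of_continuous'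
    (f := fun t y => v (max 0 (min T t)) y ^ 2) hp 0 (2 * Real.pi)).comp continuous_fst
  exact (hp.sub (h2.const_smul ((2 * Real.pi)⁻¹ : ℝ))).mul h1

/-- By the equation the integrand is `∂ₜ(vΨ)` on `(0,T)`, and `Ψ` vanishes at both ends. Clamping
makes the integrand continuous on the whole line. -/
theorem integral_time_eq_zero (hv : IsClassicalSolution T v) (hT : 0 < T) (Ψ : SpaceTimeTest T)
    (x : ℝ) : ∫ t in (0 : ℝ)..T,
      (-(iteratedDeriv 3 (v (max 0 (min T t))) x + nonlin (v (max 0 (min T t))) x : ℝ) * Ψ.toFun t x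
        + v (max 0 (min T t)) x * (Ψ.dt t : ℝ → ℂ) x) = 0 := by
  have hd : ∀ t, HasDerivAt (fun τ => Ψ.toFun τ x) ((Ψ.dt t : ℝ → ℂ) x) t := fun t =>
    (hasDerivAt_left Ψ.smooth t x).differentiableAt.hasDerivAt
  have hΨt : Continuous fun t => (Ψ.dt t : ℝ → ℂ) x :=
    (contDiff_deriv_left Ψ.smooth).continuous.comp (continuous_id.prodMk continuous_const)
  have hΨ : Continuous fun t => Ψ.toFun t x :=
    Ψ.smooth.continuous.comp (continuous_id.prodMk continuous_const)
  have hpair : Continuous fun t : ℝ => (t, x) := continuous_id.prodMk continuous_const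
  obtain ⟨a, b, ha, hb, hab⟩ := Ψ.support
  rw [intervalIntegral.integral_eq_sub_of_hasDerivAt_of_le hT.le
    (f := fun t => (v t x : ℂ) * Ψ.toFun t x)]
  · rw [hab 0 (fun h => ha.not_ge h.1), hab T (fun h => hb.not_ge h.2)]
    simp
  · refine ContinuousOn.mul ?_ hΨ.continuousOn
    exact Complex.continuous_ofReal.comp_continuousOn
      fun t ht => (hv.eqn t ht x).continuousWithinAt
  · intro t ht
    have ht' := Set.Ioo_subset_Icc_self ht
    have h1 := ((hv.eqn t ht' x).hasDerivAt (Icc_mem_nhds ht.1 ht.2)).ofReal_comp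
    refine (h1.mul (hd t)).congr_deriv ?_
    rw [clamp_of_mem ht']
    push_cast
    ring
  · refine Continuous.intervalIntegrable ?_ _ _
    have h3 := (hv.continuous_clamp hT 3).comp hpair
    have h4 := (hv.continuous_nonlin_clamp hT).comp hpair
    have h0 := (hv.continuous_clamp_zero hT).comp hpair
    exact (((Complex.continuous_ofReal.comp (h3.add h4)).neg).mul hΨ).add
      ((Complex.continuous_ofReal.comp h0).mul hΨt)

/-- Classical solutions are distributional solutions. -/
theorem exists_continuous_eq (hv : IsClassicalSolution T v) (hT : 0 < T) (Ψ : SpaceTimeTest T) :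
    ∃ A B : ℝ → ℂ, Continuous A ∧ Continuous B ∧
      (∀ t ∈ Set.Icc 0 T, ∀ ψ : TestSpace, (ψ : ℝ → ℂ) = (fun x => (v t x : ℂ)) →
        (ofFun ψ : Module.Dual ℂ TestSpace) (Ψ.dt t + Ψ.dx3 t) = A t ∧
        ∫ x in (0 : ℝ)..(2 * Real.pi), nonlin (ψ : ℝ → ℂ) x * (Ψ.slice t : ℝ → ℂ) x = B t) ∧
      ∫ t in (0 : ℝ)..T, A t = ∫ t in (0 : ℝ)..T, B t := by
  set c : ℝ → ℝ := fun t => max 0 (min T t) with hc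
  have k0 : Continuous fun q : ℝ × ℝ => (v (c q.1) q.2 : ℂ) :=
    Complex.continuous_ofReal.comp (hv.continuous_clamp_zero hT)
  have k3 : Continuous fun q : ℝ × ℝ => ((iteratedDeriv 3 (v (c q.1)) q.2 : ℝ) : ℂ) :=
    Complex.continuous_ofReal.comp (hv.continuous_clamp hT 3)
  have kn : Continuous fun q : ℝ × ℝ => ((nonlin (v (c q.1)) q.2 : ℝ) : ℂ) :=
    Complex.continuous_ofReal.comp (hv.continuous_nonlin_clamp hT)
  have kΨ : Continuous fun q : ℝ × ℝ => Ψ.toFun q.1 q.2 := Ψ.smooth.continuous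
  have kt : Continuous fun q : ℝ × ℝ => (Ψ.dt q.1 : ℝ → ℂ) q.2 :=
    (contDiff_deriv_left Ψ.smooth).continuous
  have kx : Continuous fun q : ℝ × ℝ => (Ψ.dx3 q.1 : ℝ → ℂ) q.2 :=
    (contDiff_iteratedDeriv_right Ψ.smooth 3).continuous
  -- The clamped space integrals are continuous on all of `ℝ`; they later supply the measurability
  -- needed for dominated convergence.
  have hA := intervalIntegral.continuous_parametric_intervalIntegral_of_continuous' (μ := volume)
    (f := fun t x => (v (c t) x : ℂ) * ((Ψ.dt t : ℝ → ℂ) x + (Ψ.dx3 t : ℝ → ℂ) x))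
    (k0.mul (kt.add kx)) 0 (2 * Real.pi)
  have hB := intervalIntegral.continuous_parametric_intervalIntegral_of_continuous' (μ := volume)
    (f := fun t x => ((nonlin (v (c t)) x : ℝ) : ℂ) * Ψ.toFun t x) (kn.mul kΨ) 0 (2 * Real.pi)
  refine ⟨_, _, hA, hB, fun t ht ψ hψ => ⟨?_, ?_⟩, ?_⟩
  · rw [ofFun_apply]
    simp only [hc, clamp_of_mem ht, hψ]
    rfl
  · simp only [hc, clamp_of_mem ht, hψ, nonlin_ofReal (hv.smooth t ht)]
    rfl
  · rw [← sub_eq_zero, ← intervalIntegral.integral_sub (hA.intervalIntegrable _ _)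
      (hB.intervalIntegrable _ _)]
    have hpair : ∀ t : ℝ, Continuous fun x : ℝ => (t, x) := fun (t : ℝ) =>
      continuous_const.prodMk continuous_id
    -- At fixed time the three space derivatives move from `Ψ` to `v` with one change of sign, which
    -- leaves the integrand of `integral_time_eq_zero`.
    have key : ∀ t, ((∫ x in (0 : ℝ)..(2 * Real.pi), (v (c t) x : ℂ) *
        ((Ψ.dt t : ℝ → ℂ) x + (Ψ.dx3 t : ℝ → ℂ) x)) -
        ∫ x in (0 : ℝ)..(2 * Real.pi), ((nonlin (v (c t)) x : ℝ) : ℂ) * Ψ.toFun t x)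
        = ∫ x in (0 : ℝ)..(2 * Real.pi),
          (-(iteratedDeriv 3 (v (c t)) x + nonlin (v (c t)) x : ℝ) * Ψ.toFun t x
            + v (c t) x * (Ψ.dt t : ℝ → ℂ) x) := by
      intro t
      obtain ⟨ψ, hψ⟩ := hv.exists_test (clamp_mem hT t)
      have h3 := integral_mul_der3 ψ (Ψ.slice t)
      simp only [hψ, iteratedDeriv_ofReal (hv.smooth _ (clamp_mem hT t))] at h3
      have i0 := k0.comp (hpair t)
      have i3 := k3.comp (hpair t)
      have i_n := kn.comp (hpair t)
      have iΨ := kΨ.comp (hpair t)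
      have it := kt.comp (hpair t)
      have ix := kx.comp (hpair t)
      have e1 : ∫ x in (0 : ℝ)..(2 * Real.pi), (v (c t) x : ℂ) *
          ((Ψ.dt t : ℝ → ℂ) x + (Ψ.dx3 t : ℝ → ℂ) x)
          = (∫ x in (0 : ℝ)..(2 * Real.pi), (v (c t) x : ℂ) * (Ψ.dt t : ℝ → ℂ) x)
            + ∫ x in (0 : ℝ)..(2 * Real.pi), (v (c t) x : ℂ) * (Ψ.dx3 t : ℝ → ℂ) x := by
        simp only [mul_add]
        exact intervalIntegral.integral_add ((i0.mul it).intervalIntegrable _ _)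
          ((i0.mul ix).intervalIntegrable _ _)
      have e2 : ∫ x in (0 : ℝ)..(2 * Real.pi),
          (-(iteratedDeriv 3 (v (c t)) x + nonlin (v (c t)) x : ℝ) * Ψ.toFun t x
            + v (c t) x * (Ψ.dt t : ℝ → ℂ) x)
          = -((∫ x in (0 : ℝ)..(2 * Real.pi), ((iteratedDeriv 3 (v (c t)) x : ℝ) : ℂ) * Ψ.toFun t x)
            + ∫ x in (0 : ℝ)..(2 * Real.pi), ((nonlin (v (c t)) x : ℝ) : ℂ) * Ψ.toFun t x)
            + ∫ x in (0 : ℝ)..(2 * Real.pi), (v (c t) x : ℂ) * (Ψ.dt t : ℝ → ℂ) x := by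
        have m3 : Continuous fun x => ((iteratedDeriv 3 (v (c t)) x : ℝ) : ℂ) * Ψ.toFun t x :=
          i3.mul iΨ
        have mn : Continuous fun x => ((nonlin (v (c t)) x : ℝ) : ℂ) * Ψ.toFun t x := i_n.mul iΨ
        have m0 : Continuous fun x => (v (c t) x : ℂ) * (Ψ.dt t : ℝ → ℂ) x := i0.mul it
        have ms : Continuous fun x => -(((iteratedDeriv 3 (v (c t)) x : ℝ) : ℂ) * Ψ.toFun t x
          + ((nonlin (v (c t)) x : ℝ) : ℂ) * Ψ.toFun t x) := (m3.add mn).neg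
        rw [← intervalIntegral.integral_add (m3.intervalIntegrable _ _)
          (mn.intervalIntegrable _ _), ← intervalIntegral.integral_neg,
          ← intervalIntegral.integral_add (ms.intervalIntegrable _ _)
            (m0.intervalIntegrable _ _)]
        refine intervalIntegral.integral_congr fun x _ => ?_
        push_cast
        ring
      have e3 : ∫ x in (0 : ℝ)..(2 * Real.pi), (v (c t) x : ℂ) * (Ψ.dx3 t : ℝ → ℂ) x
          = -∫ x in (0 : ℝ)..(2 * Real.pi), ((iteratedDeriv 3 (v (c t)) x : ℝ) : ℂ) * Ψ.toFun t x := h3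
      rw [e1, e2, e3]
      ring
    simp only [key]
    -- After Fubini the time integral vanishes for every `x` separately.
    rw [integral_integral_swap_of_continuous (H := fun t x =>
      (-(iteratedDeriv 3 (v (c t)) x + nonlin (v (c t)) x : ℝ) * Ψ.toFun t x
            + v (c t) x * (Ψ.dt t : ℝ → ℂ) x)) ?_ hT.le Real.two_pi_pos.le]
    · simp only [hc, hv.integral_time_eq_zero hT Ψ, intervalIntegral.integral_zero]
    · simp only [Complex.ofReal_add]
      exact ((k3.add kn).neg.mul kΨ).add (k0.mul kt)

end IsClassicalSolution

/-! ### Passage to the limit in the weak equation -/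

theorem nlc_zero (n : ℤ) : nlc (fun _ => 0) n = 0 := by simp [nlc]

theorem NL_zero : NL 0 = 0 := by
  have h : fourierCoef (0 : Distrib) = fun _ => 0 := by funext n; simp [fourierCoef]
  refine distrib_ext fun n => ?_
  rw [NL, h, fourierCoef_ofSeq ⟨0, fun n => by simp [nlc_zero]⟩, nlc_zero]

theorem IsCubicConst.enorm_NL_le {s : ℝ} {p D : ℝ≥0∞} (h : IsCubicConst s p D) {L : ℝ≥0∞}
    (hL : L ≠ ⊤) {f : Distrib} (hf : flNorm s p f ≤ L) (ψ : TestSpace) :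
    ‖(NL f : Module.Dual ℂ TestSpace) ψ‖ₑ ≤ testNorm 1 ψ * (3 * D * L ^ 2 * L) := by
  have h0 : flNorm s p 0 ≤ L := by
    have := flNorm_self_sub s p 0
    rw [sub_self] at this
    rw [this]; exact zero_le
  have := h.enorm_NL_sub_le hL hf h0 ψ
  rw [NL_zero, sub_zero] at this
  refine le_trans (le_of_eq ?_) (this.trans (by gcongr))
  simp

theorem enorm_distrib_le {s : ℝ} {p : ℝ≥0∞} (hs : 0 ≤ s) (hp : 1 ≤ p) (f : Distrib)
    (ψ : TestSpace) :
    ‖(f : Module.Dual ℂ TestSpace) ψ‖ₑ ≤ testNorm 0 ψ * flNorm s p f := by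
  simpa using enorm_distrib_sub_le hs hp f 0 ψ

/-- Dominated convergence in which only the approximants have to be measurable, through their
agreement with continuous functions on `[0,T]`. -/
theorem tendsto_integral_of_enorm_le {T : ℝ} (hT : 0 < T) {f : ℕ → ℝ → ℂ} {g : ℝ → ℂ} {C : ℝ≥0∞}
    (hC : C ≠ ⊤) (hf : ∀ k, ∃ A : ℝ → ℂ, Continuous A ∧ ∀ t ∈ Set.Icc 0 T, f k t = A t)
    (hb : ∀ k, ∀ t ∈ Set.Icc 0 T, ‖f k t‖ₑ ≤ C) {δ : ℕ → ℝ≥0∞} (hδ : Tendsto δ atTop (𝓝 0))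
    (hd : ∀ k, ∀ t ∈ Set.Icc 0 T, ‖f k t - g t‖ₑ ≤ C * δ k) :
    Tendsto (fun k => ∫ t in (0 : ℝ)..T, f k t) atTop (𝓝 (∫ t in (0 : ℝ)..T, g t)) := by
  have hI : ∀ t ∈ Set.uIoc 0 T, t ∈ Set.Icc 0 T := fun t ht => by
    rw [Set.uIoc_of_le hT.le] at ht
    exact ⟨ht.1.le, ht.2⟩
  refine intervalIntegral.tendsto_integral_filter_of_dominated_convergence (fun _ => C.toReal)
    (Eventually.of_forall fun k => ?_) (Eventually.of_forall fun k => Eventually.of_forall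
      fun t ht => ?_) intervalIntegrable_const (Eventually.of_forall fun t ht => ?_)
  · obtain ⟨A, hA, he⟩ := hf k
    refine hA.aestronglyMeasurable.congr ?_
    filter_upwards [ae_restrict_mem measurableSet_uIoc] with t ht
    exact (he t (hI t ht)).symm
  · rw [← ENNReal.ofReal_le_iff_le_toReal hC, ofReal_norm]
    exact hb k t (hI t ht)
  · refine tendsto_iff_edist_tendsto_0.2 ?_
    have h1 := ENNReal.Tendsto.const_mul hδ (Or.inr hC)
    rw [mul_zero] at h1
    refine tendsto_of_tendsto_of_tendsto_of_le_of_le tendsto_const_nhds h1 (fun _ => zero_le)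
      fun k => ?_
    simp only [edist_eq_enorm_sub]
    exact hd k t (hI t ht)

/-- Both sides of the weak equation are continuous under convergence in `ℱL^{s,p}` that is uniform
in time: the linear side by duality, the nonlinear side by the Lipschitz bound for `NL`. The
identity is therefore inherited from nearby classical solutions. -/
theorem IsSolutionMap.solvesDistrib {s R T : ℝ} {p D : ℝ≥0∞} {W : Distrib → ℝ → Distrib}
    {φ : Distrib} (hD : IsCubicConst s p D) (hT : 0 < T) (hW : IsSolutionMap s p R T W)
    (hφ : φ ∈ ball s p R) : SolvesDistrib T (W φ) fun t => NL (W φ t) := by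
  intro Ψ
  have hu := hW.mem φ hφ
  obtain ⟨L₀, hL₀, hb₀⟩ := hu.exists_bound hD.hp
  -- The approximants stay within distance 1 of `W φ`, so `L` bounds them as well. Since `L ≥ 1`,
  -- one constant controls both their size and their differences from the limit.
  set L := L₀ + 1 with hL
  have hLt : L ≠ ⊤ := by finiteness
  have hb : ∀ t ∈ Set.Icc 0 T, flNorm s p (W φ t) ≤ L := fun t ht =>
    (hb₀ t ht).trans le_self_add
  have hk := fun k : ℕ => hW.exists_classical_near hD.hp hφ
    (ε := ((k : ℝ≥0∞) + 1)⁻¹) (by simp)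
  choose χ hχ _ hclose v hv _ hrep using hk
  have hle1 : ∀ k : ℕ, ((k : ℝ≥0∞) + 1)⁻¹ ≤ 1 := fun k => by
    rw [ENNReal.inv_le_one]; exact le_add_self
  have hbk : ∀ k, ∀ t ∈ Set.Icc 0 T, flNorm s p (W (χ k) t) ≤ L := fun k t ht => by
    refine (flNorm_le_add hD.hp _ (W φ t)).trans ?_
    rw [flNorm_sub_comm, hL, add_comm]
    exact add_le_add (hb₀ t ht) ((hclose k t ht).le.trans (hle1 k))
  have hδ : Tendsto (fun k : ℕ => ((k : ℝ≥0∞) + 1)⁻¹) atTop (𝓝 0) := by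
    have := (tendsto_add_atTop_iff_nat 1).2 ENNReal.tendsto_inv_nat_nhds_zero
    simpa using this
  choose A B hA hB hAB hint using fun k => (hv k).exists_continuous_eq hT Ψ
  have hAk : ∀ k, ∀ t ∈ Set.Icc 0 T,
      (W (χ k) t : Module.Dual ℂ TestSpace) (Ψ.dt t + Ψ.dx3 t) = A k t ∧
      (NL (W (χ k) t) : Module.Dual ℂ TestSpace) (Ψ.slice t) = B k t := fun k t ht => by
    obtain ⟨ψ, hψ⟩ := (hv k).exists_test ht
    have e := (represents_iff ψ (W (χ k) t)).1 (hψ ▸ hrep k t ht)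
    obtain ⟨h1, h2⟩ := hAB k t ht ψ hψ
    have h3 := hbk k t ht
    rw [e] at h3 ⊢
    exact ⟨h1, (hD.NL_ofFun (ne_top_of_le_ne_top hLt h3) _).trans h2⟩
  have hDt := hD.ne_top
  obtain ⟨C₀, hC₀, hC₀'⟩ := exists_testNorm_le (ψ := fun t => Ψ.dt t + Ψ.dx3 t)
    ((contDiff_deriv_left Ψ.smooth).add (contDiff_iteratedDeriv_right Ψ.smooth 3)) T 0
  obtain ⟨C₁, hC₁, hC₁'⟩ := exists_testNorm_le (ψ := Ψ.slice) Ψ.smooth T 1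
  have l1 := tendsto_integral_of_enorm_le hT (f := fun k t =>
    (W (χ k) t : Module.Dual ℂ TestSpace) (Ψ.dt t + Ψ.dx3 t))
    (g := fun t => (W φ t : Module.Dual ℂ TestSpace) (Ψ.dt t + Ψ.dx3 t))
    (C := C₀ * L) (by finiteness) (fun k => ⟨A k, hA k, fun t ht => (hAk k t ht).1⟩)
    (fun k t ht => (enorm_distrib_le hD.hs hD.hp _ _).trans
      (mul_le_mul' (hC₀' t ht) (hbk k t ht))) hδ fun k t ht => by
        refine (enorm_distrib_sub_le hD.hs hD.hp _ _ _).trans (mul_le_mul' ?_ ?_)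
        · exact (hC₀' t ht).trans (le_mul_of_one_le_right zero_le (by rw [hL]; exact le_add_self))
        · rw [flNorm_sub_comm]; exact (hclose k t ht).le
  have l2 := tendsto_integral_of_enorm_le hT (f := fun k t =>
    (NL (W (χ k) t) : Module.Dual ℂ TestSpace) (Ψ.slice t))
    (g := fun t => (NL (W φ t) : Module.Dual ℂ TestSpace) (Ψ.slice t))
    (C := C₁ * (3 * D * L ^ 2 * L)) (by finiteness)
    (fun k => ⟨B k, hB k, fun t ht => (hAk k t ht).2⟩)
    (fun k t ht => (hD.enorm_NL_le hLt (hbk k t ht) _).trans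
      (mul_le_mul' (hC₁' t ht) le_rfl)) hδ fun k t ht => by
        refine (hD.enorm_NL_sub_le hLt (hbk k t ht) (hb t ht) _).trans ?_
        rw [mul_assoc C₁]
        refine mul_le_mul' (hC₁' t ht) (mul_le_mul' ?_ ?_)
        · exact le_mul_of_one_le_right zero_le (by rw [hL]; exact le_add_self)
        · rw [flNorm_sub_comm]; exact (hclose k t ht).le
  refine tendsto_nhds_unique l1 (l2.congr fun k => ?_)
  have e1 : ∫ t in (0 : ℝ)..T, (W (χ k) t : Module.Dual ℂ TestSpace) (Ψ.dt t + Ψ.dx3 t)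
      = ∫ t in (0 : ℝ)..T, A k t := intervalIntegral.integral_congr fun t ht => by
    rw [Set.uIcc_of_le hT.le] at ht
    exact (hAk k t ht).1
  have e2 : ∫ t in (0 : ℝ)..T, (NL (W (χ k) t) : Module.Dual ℂ TestSpace) (Ψ.slice t)
      = ∫ t in (0 : ℝ)..T, B k t := intervalIntegral.integral_congr fun t ht => by
    rw [Set.uIcc_of_le hT.le] at ht
    exact (hAk k t ht).2
  rw [e1, e2, hint k]

end MKdV

theorem mainTheorem3 (s : ℝ) (p p' : ℝ≥0∞) (hs : 1 / 2 ≤ s) (hp : 1 ≤ p)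
    (hpp' : p⁻¹ + p'⁻¹ = 1) (hsp : 1 < p' * ENNReal.ofReal (s + 1 / 4)) :
    (∀ R : ℝ, 0 < R → ∃ T : ℝ, 0 < T ∧ ∃ W : MKdV.Distrib → ℝ → MKdV.Distrib,
      MKdV.IsSolutionMap s p R T W) ∧
    (∀ (R T : ℝ) (W : MKdV.Distrib → ℝ → MKdV.Distrib), 0 < R → 0 < T →
      MKdV.IsSolutionMap s p R T W → ∀ φ ∈ MKdV.ball s p R,
        W φ 0 = φ ∧ ∃ F : ℝ → MKdV.Distrib,
          MKdV.IsNonlinearity T (W φ) F ∧ MKdV.SolvesDistrib T (W φ) F) := by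
  obtain ⟨D, hD⟩ := MKdV.exists_isCubicConst hs hp hpp' hsp
  refine ⟨fun R _ => MKdV.exists_isSolutionMap hs hp hpp' hsp R,
    fun R T W _ hT hW φ hφ => ⟨hW.apply_zero hD.hs hp hT.le hφ, fun t => MKdV.NL (W φ t),
      (hW.mem φ hφ).isNonlinearity_NL hD fun t ht ε hε => hW.exists_test_near hp hφ ht hε,
      hW.solvesDistrib hD hT hφ⟩⟩
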